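/- Fix integers $m\ge 0$ and $\alpha\ge 1$. Let $z,w$ be state variables ($w$ plays the role of $\bar z$) and $\mu=(\mu_1,\dots,\mu_m)$ parameters, and put $$X_{jk}=(z^jw^k,\;w^jz^k),\qquad Y_{jk}=(i z^jw^k,\;-i w^jz^k).$$ **Spaces and gradings.** The parametric state space $\mathscr L$ is the real vector space of formal sums $aY_{10}+\sum\alpha_{jk\mathbf n}X_{jk}\mu^{\mathbf n}+\sum\beta_{jk\mathbf n}Y_{jk}\mu^{\mathbf n}$ with real coefficients, $j+k\ge1$, $j+k+|\mathbf n|\ge 2$, with bracket $[u,v]=u'v-v'u$ (derivatives in $(z,w)$); $X_{jk}\mu^{\mathbf n}$ and $Y_{jk}\mu^{\mathbf n}$ have grade $j+k-1+\alpha|\mathbf n|$. The time space is $\mathscr R=\mathbb R[[zw,\mu]]$, where $(zw)^k\mu^{\mathbf n}$ has grade $2k+\alpha|\mathbf n|$; the parameter space is $\mathscr P=\mathbb R^m[[\mu]]$, where $\mu^{\mathbf n}\mathbf e_k$ has grade $\alpha|\mathbf n|-\alpha$. For each of these, $\mathcal F^p$ denotes the series all of whose terms have grade $\ge p$, $\mathscr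 L_n$ the grade-$n$ part of $\mathscr L$, and $x_n\to x$ in the filtration topology means that for every $N$, $x_n-x\in\mathcal F^N$ for all large $n$. Put $A^0=\mathcal F^1\mathscr P\times\mathcal F^1\mathscr R\times\mathcal F^1\mathscr L$, with $\mathcal F^pA^0=A^0\cap(\mathcal F^p\mathscr P\times\mathcal F^p\mathscr R\times\mathcal F^p\mathscr L)$. **Near-identity maps.** For $Y=(Y^P,Y^T,Y^S)\in A^0$ let $\phi^S_{Y^S}(u)=\exp(\mathrm{ad}_{Y^S})u$, $\phi^P_{Y^P}(u)(z,w,\mu)=u(z,w,\mu+Y^P(\mu))$, $\phi^T_{Y^T}(u)=u+Y^Tu$ and $\phi_Y=\phi^T_{Y^T}\circ\phi^P_{Y^P}\circ\phi^S_{Y^S}$. **Spectral sequence.** For $v\in\mathscr L$ let $d(Y)=D_\mu(v)Y^P+Y^Tv+\mathrm{ad}_{Y^S}v$, and consider the filtered complex $0\to A^0\xrightarrow{d}\mathscr L\to0$. In total degree $1$ its spectral sequence is $E_r^{p,1-p}=\mathcal F^p\mathscr L/\big(\mathcal F^{p+1}\mathscr L+\mathcal F^p\mathscr L\cap d(\mathcal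 F^{p-r+1}A^0)\big)$, with limit $E_\infty^{p,1-p}=\mathcal F^p\mathscr L/\big(\mathcal F^{p+1}\mathscr L+\mathcal F^p\mathscr L\cap d(A^0)\big)$. Let $\mathcal T_n^{(r)}(v)\subseteq\mathscr L_n$ be the set of grade-$n$ parts of the elements of $\mathcal F^n\mathscr L\cap d(\mathcal F^{n-r+1}A^0)$. Fix an enumeration of the formal basis consisting of $Y_{10}$ and all $X_{jk}\mu^{\mathbf n},Y_{jk}\mu^{\mathbf n}$ with $j+k\ge1$, $j+k+|\mathbf n|\ge2$. Let $\mathcal N_n^{(r)}$ be the formal-basis-style complement of $\mathcal T_n^{(r)}(v)$ in $\mathscr L_n$: run through the basis elements of grade $n$ in the given order, select one whenever it does not lie in the sum of $\mathcal T_n^{(r)}(v)$ and the span of those already selected, and let $\mathcal N_n^{(r)}$ be the span of the selected ones. **Theorem.** Let $v\in\mathscr L$ have a Hopf singularity, that is, its coefficient $a$ of $Y_{10}$ is nonzero. Then: 1. For every $r\ge0$, $E_\infty^{r,1-r}=E_r^{r,1-r}$; the inclusion $\mathscr L_r\subseteq\mathcal F^r\mathscr L$ induces $\mathscr L_r/\mathcal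 T_r^{(r)}(v)\cong E_r^{r,1-r}$; $\mathscr L_r=\mathcal N_r^{(r)}\oplus\mathcal T_r^{(r)}(v)$; and $\mathcal N_r^{(r)}\to E_r^{r,1-r}$ is an isomorphism. 2. There are $v^{(\infty)}=\sum_{r\ge0}v_r^{(\infty)}\in\mathscr L$ with $v_r^{(\infty)}\in\mathcal N_r^{(r)}$ for all $r$, generators $Y_1,Y_2,\dots\in A^0$ with near-identity maps $\Phi_n=\phi_{Y_n}$, and generators $Y_{(0)},Y_{(1)},\dots$ and $Y^{(\infty)}=(Y^P,Y^T,Y^S)$ in $A^0$ such that, with $v^{(0)}=v$ and $v^{(n+1)}=\Phi_{n+1}(v^{(n)})$: all $v^{(n)}$ lie in $\mathscr L$; $v_k^{(n)}\in\mathcal N_k^{(k)}$ for $k\le n$; $\mathcal T_r^{(r)}(v^{(n)})=\mathcal T_r^{(r)}(v)$ for all $n,r$ (so the spaces may equally be computed from the updated fields); $v^{(n)}\to v^{(\infty)}$ in the filtration topology; $\Phi_n\circ\cdots\circ\Phi_1=\phi_{Y_{(n)}}$ on $\mathscr L$ for all $n$; $Y_{(n)}\to Y^{(\infty)}$ in the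 filtration topology; and $$v^{(\infty)}=\phi^T_{Y^T}\circ\phi^P_{Y^P}\circ\phi^S_{Y^S}(v).$$ 3. The normal form is unique: if a sequence obtained from $v$ by successively applying maps $\phi_{Y'_n}$ with $Y'_n\in A^0$ converges in the filtration topology to some $u$ with $u_r\in\mathcal N_r^{(r)}$ for all $r$, then $u=v^{(\infty)}$. -/

import Mathlib

open Filter
open scoped ComplexConjugate

namespace ParamNF

noncomputable section

/-! ### Variables, monomials and weights -/

/-- The formal variables: `Sum.inl 0` is `z`, `Sum.inl 1` is `w` (the formal conjugate of `z`),
and `Sum.inr l` is the parameter `μ_l`. -/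
abbrev Var (m : ℕ) : Type := Fin 2 ⊕ Fin m

/-- Exponents of monomials `z^j w^k μ^n`. -/
abbrev Expo (m : ℕ) : Type := Var m →₀ ℕ

/-- Formal power series `ℂ[[z, w, μ]]`. -/
abbrev Ser (m : ℕ) : Type := MvPowerSeries (Var m) ℂ

/-- Formal parametric vector fields on `ℂ²`: pairs of power series (the right-hand sides of the
equations for `z` and `w`). -/
abbrev VF (m : ℕ) : Type := Fin 2 → Ser m

/-- The degree `j + k` of a monomial in the state variables. -/
def stateDeg {m : ℕ} (e : Expo m) : ℕ := e (Sum.inl 0) + e (Sum.inl 1)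

/-- The degree `|n|` of a monomial in the parameters. -/
def paramDeg {m : ℕ} (e : Expo m) : ℕ := ∑ l : Fin m, e (Sum.inr l)

/-- The weight `j + k + α |n|`. -/
def wt {m : ℕ} (α : ℕ) (e : Expo m) : ℕ := stateDeg e + α * paramDeg e

/-- The exponent of the monomial `z`. -/
def zExp (m : ℕ) : Expo m := Finsupp.single (Sum.inl 0) 1

/-- Interchange of the exponents of `z` and `w`. -/
def swapExp {m : ℕ} (e : Expo m) : Expo m :=
  e.equivMapDomain (Equiv.sumCongr (Equiv.swap (0 : Fin 2) 1) (Equiv.refl (Fin m)))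

/-! ### Parametric state space -/

/-- The exponents `z^j w^k μ^n` with `j + k ≥ 1` that occur in the first component of an element
of the parametric state space: everything of total degree at least two, and `z`. -/
def Admissible {m : ℕ} (e : Expo m) : Prop :=
  1 ≤ stateDeg e ∧ (2 ≤ stateDeg e + paramDeg e ∨ e = zExp m)

/-- The parametric state space: formal sums
`a Y₁₀ + ∑ α_{jkn} X_{jk} μ^n + ∑ β_{jkn} Y_{jk} μ^n` with real coefficients, where
`j + k ≥ 1`, `j + k + |n| ≥ 2`, `X_{jk} = (z^j w^k, w^j z^k)` and
`Y_{jk} = (i z^j w^k, -i w^j z^k)`. -/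
def stateSpace (m : ℕ) : Submodule ℝ (VF m) where
  carrier := {v |
    (∀ e : Expo m, MvPowerSeries.coeff e (v 1) = conj (MvPowerSeries.coeff (swapExp e) (v 0))) ∧
    (∀ e : Expo m, MvPowerSeries.coeff e (v 0) ≠ 0 → Admissible e) ∧
    (MvPowerSeries.coeff (zExp m) (v 0)).re = 0}
  zero_mem' := by simp
  add_mem' := by
    rintro u v ⟨hu1, hu2, hu3⟩ ⟨hv1, hv2, hv3⟩
    refine ⟨fun e => ?_, fun e he => ?_, ?_⟩
    · simp [hu1 e, hv1 e]
    · by_contra hne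
      have h1 : MvPowerSeries.coeff e (u 0) = 0 := by
        by_contra h; exact hne (hu2 e h)
      have h2 : MvPowerSeries.coeff e (v 0) = 0 := by
        by_contra h; exact hne (hv2 e h)
      exact he (by simp [h1, h2])
    · simp [hu3, hv3]
  smul_mem' := by
    rintro c v ⟨hv1, hv2, hv3⟩
    refine ⟨fun e => ?_, fun e he => ?_, ?_⟩
    · simp [hv1 e]
    · refine hv2 e fun h => he ?_
      simp [h]
    · simp [hv3]

/-- `F^p` of the parametric state space; the grade of `X_{jk} μ^n` and `Y_{jk} μ^n` is
`j + k - 1 + α |n|`. -/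
def stateFilt {m : ℕ} (α : ℕ) (p : ℤ) : Submodule ℝ (VF m) where
  carrier := {v | v ∈ stateSpace m ∧
    ∀ (i : Fin 2) (e : Expo m), (wt α e : ℤ) - 1 < p → MvPowerSeries.coeff e (v i) = 0}
  zero_mem' := ⟨Submodule.zero_mem _, by simp⟩
  add_mem' := by
    rintro u v ⟨hu, hu'⟩ ⟨hv, hv'⟩
    exact ⟨Submodule.add_mem _ hu hv, fun i e h => by simp [hu' i e h, hv' i e h]⟩
  smul_mem' := by
    rintro c v ⟨hv, hv'⟩
    exact ⟨Submodule.smul_mem _ c hv, fun i e h => by simp [hv' i e h]⟩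

/-- The projection of a vector field to its part of grade `n`. -/
def gradePart {m : ℕ} (α : ℕ) (n : ℤ) : VF m →ₗ[ℝ] VF m where
  toFun v := fun i e => if (wt α e : ℤ) - 1 = n then MvPowerSeries.coeff e (v i) else 0
  map_add' u v := by
    funext i e
    change (if (wt α e : ℤ) - 1 = n then MvPowerSeries.coeff e ((u + v) i) else 0) =
      (if (wt α e : ℤ) - 1 = n then MvPowerSeries.coeff e (u i) else 0) +
        (if (wt α e : ℤ) - 1 = n then MvPowerSeries.coeff e (v i) else 0)
    split_ifs <;> simp
  map_smul' c v := by
    funext i e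
    change (if (wt α e : ℤ) - 1 = n then MvPowerSeries.coeff e ((c • v) i) else 0) =
      c • (if (wt α e : ℤ) - 1 = n then MvPowerSeries.coeff e (v i) else 0)
    split_ifs <;> simp

/-- The homogeneous part of grade `n` of the parametric state space. -/
def stateGrade {m : ℕ} (α : ℕ) (n : ℤ) : Submodule ℝ (VF m) where
  carrier := {v | v ∈ stateSpace m ∧
    ∀ (i : Fin 2) (e : Expo m), (wt α e : ℤ) - 1 ≠ n → MvPowerSeries.coeff e (v i) = 0}
  zero_mem' := ⟨Submodule.zero_mem _, by simp⟩
  add_mem' := by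
    rintro u v ⟨hu, hu'⟩ ⟨hv, hv'⟩
    exact ⟨Submodule.add_mem _ hu hv, fun i e h => by simp [hu' i e h, hv' i e h]⟩
  smul_mem' := by
    rintro c v ⟨hv, hv'⟩
    exact ⟨Submodule.smul_mem _ c hv, fun i e h => by simp [hv' i e h]⟩

/-! ### Parametric time space and parameter space -/

/-- `F^p` of the parametric time space `ℝ[[z w, μ]]`; the grade of `(z w)^k μ^n` is
`2 k + α |n|`. -/
def timeFilt {m : ℕ} (α : ℕ) (p : ℤ) : Submodule ℝ (Ser m) where
  carrier := {f | ∀ e : Expo m,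
    (MvPowerSeries.coeff e f).im = 0 ∧
    (e (Sum.inl 0) ≠ e (Sum.inl 1) → MvPowerSeries.coeff e f = 0) ∧
    ((wt α e : ℤ) < p → MvPowerSeries.coeff e f = 0)}
  zero_mem' := by simp
  add_mem' := by
    intro f g hf hg e
    refine ⟨by simp [(hf e).1, (hg e).1], fun h => ?_, fun h => ?_⟩
    · simp [(hf e).2.1 h, (hg e).2.1 h]
    · simp [(hf e).2.2 h, (hg e).2.2 h]
  smul_mem' := by
    intro c f hf e
    refine ⟨by simp [(hf e).1], fun h => ?_, fun h => ?_⟩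
    · simp [(hf e).2.1 h]
    · simp [(hf e).2.2 h]

/-- `F^p` of the parameter space `ℝ^m[[μ]]`; the grade of `μ^n e_k` is `α |n| - α`. -/
def paramFilt {m : ℕ} (α : ℕ) (p : ℤ) : Submodule ℝ (Fin m → Ser m) where
  carrier := {f | ∀ (l : Fin m) (e : Expo m),
    (MvPowerSeries.coeff e (f l)).im = 0 ∧
    (stateDeg e ≠ 0 → MvPowerSeries.coeff e (f l) = 0) ∧
    ((wt α e : ℤ) - α < p → MvPowerSeries.coeff e (f l) = 0)}
  zero_mem' := by simp
  add_mem' := by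
    intro f g hf hg l e
    refine ⟨by simp [(hf l e).1, (hg l e).1], fun h => ?_, fun h => ?_⟩
    · simp [(hf l e).2.1 h, (hg l e).2.1 h]
    · simp [(hf l e).2.2 h, (hg l e).2.2 h]
  smul_mem' := by
    intro c f hf l e
    refine ⟨by simp [(hf l e).1], fun h => ?_, fun h => ?_⟩
    · simp [(hf l e).2.1 h]
    · simp [(hf l e).2.2 h]

/-! ### Generators and their near-identity maps -/

/-- Triples `(Y^P, Y^T, Y^S)`. -/
abbrev Gen (m : ℕ) : Type := (Fin m → Ser m) × Ser m × VF m

/-- `F^p A^{0,*}`, where `A^{0,*} = F¹P × F¹R × F¹L`. -/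
def genFilt {m : ℕ} (α : ℕ) (p : ℤ) : Submodule ℝ (Gen m) :=
  (paramFilt α (max 1 p)).prod ((timeFilt α (max 1 p)).prod (stateFilt α (max 1 p)))

/-- The space `A^{0,*} = F¹P × F¹R × F¹L` of generators of near-identity maps. -/
def genSpace {m : ℕ} (α : ℕ) : Submodule ℝ (Gen m) :=
  (paramFilt α 1).prod ((timeFilt α 1).prod (stateFilt α 1))

/-- The bracket `[u, v] = u' v - v' u`, the derivatives being taken in `(z, w)` only. -/
def bracket {m : ℕ} (u v : VF m) : VF m := fun i =>
  ∑ j : Fin 2, (MvPowerSeries.pderiv ℂ (Sum.inl j) (u i) * v j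
    - MvPowerSeries.pderiv ℂ (Sum.inl j) (v i) * u j)

/-- State map `exp(ad_u) v = ∑ ad_u^n v / n!`. For `u` of positive grade every coefficient of
this series is a finite sum. -/
def stateMap {m : ℕ} (u v : VF m) : VF m := fun i e =>
  ∑ᶠ n : ℕ, ((n.factorial : ℂ)⁻¹) * MvPowerSeries.coeff e ((bracket u)^[n] v i)

/-- Time rescaling `v ↦ v + Y^T v`. -/
def timeMap {m : ℕ} (T : Ser m) (v : VF m) : VF m := fun i => v i + T * v i

/-- Reparametrization: `v(z, w, μ) ↦ v(z, w, μ + Y^P(μ))`. -/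
def paramMap {m : ℕ} (P : Fin m → Ser m) (v : VF m) : VF m := fun i =>
  MvPowerSeries.subst
    (Sum.elim (fun j : Fin 2 => (MvPowerSeries.X (Sum.inl j) : Ser m))
      (fun l : Fin m => (MvPowerSeries.X (Sum.inr l) : Ser m) + P l)) (v i)

/-- The near-identity map `φ^T ∘ φ^P ∘ φ^S` associated with `Y = (Y^P, Y^T, Y^S)`. -/
def nearId {m : ℕ} (Y : Gen m) (v : VF m) : VF m :=
  timeMap Y.2.1 (paramMap Y.1 (stateMap Y.2.2 v))

/-- The composition `Φ_n ∘ ⋯ ∘ Φ_2 ∘ Φ_1` of the near-identity maps associated with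
`Y 1, …, Y n`. -/
def composite {m : ℕ} (Y : ℕ → Gen m) : ℕ → VF m → VF m
  | 0 => id
  | n + 1 => nearId (Y (n + 1)) ∘ composite Y n

/-- Convergence of sequences in the topology given by a filtration. -/
def FiltTendsto {V : Type*} [AddCommGroup V] [Module ℝ V] (F : ℤ → Submodule ℝ V)
    (x : ℕ → V) (y : V) : Prop :=
  ∀ N : ℤ, ∀ᶠ n in atTop, x n - y ∈ F N

/-! ### The spectral sequence of a filtered complex -/

/-- A subquotient `num / (den ∩ num)` of a vector space. -/
structure Subquot (V : Type*) [AddCommGroup V] [Module ℝ V] where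
  num : Submodule ℝ V
  den : Submodule ℝ V

/-- The vector space given by a subquotient. -/
abbrev Subquot.Space {V : Type*} [AddCommGroup V] [Module ℝ V] (Q : Subquot V) : Type _ :=
  ↥Q.num ⧸ (Q.den.comap Q.num.subtype)

/-- The natural map from a subspace of the numerator to the subquotient. -/
def Subquot.ofLE {V : Type*} [AddCommGroup V] [Module ℝ V] (Q : Subquot V)
    (W : Submodule ℝ V) (h : W ≤ Q.num) : ↥W →ₗ[ℝ] Q.Space :=
  (Q.den.comap Q.num.subtype).mkQ ∘ₗ Submodule.inclusion h

section Spectral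

variable {K M N : Type*} [AddCommGroup K] [Module ℝ K] [AddCommGroup M] [Module ℝ M]
  [AddCommGroup N] [Module ℝ N]

/-- `Z_r^p = F^p M ∩ d⁻¹(F^{p+r} N)`. -/
def specZ (FM : ℤ → Submodule ℝ M) (FN : ℤ → Submodule ℝ N) (d' : M →ₗ[ℝ] N) (r p : ℤ) :
    Submodule ℝ M :=
  FM p ⊓ (FN (p + r)).comap d'

/-- `Z_∞^p = F^p M ∩ ker d`. -/
def specZInf (FM : ℤ → Submodule ℝ M) (d' : M →ₗ[ℝ] N) (p : ℤ) : Submodule ℝ M :=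
  FM p ⊓ LinearMap.ker d'

/-- `B_r^p = F^p M ∩ d(F^{p-r} K)`. -/
def specB (FK : ℤ → Submodule ℝ K) (FM : ℤ → Submodule ℝ M) (d : K →ₗ[ℝ] M) (r p : ℤ) :
    Submodule ℝ M :=
  FM p ⊓ (FK (p - r)).map d

/-- `B_∞^p = F^p M ∩ d(A)`, where `A` is the whole term preceding `M` in the complex. -/
def specBInf (A : Submodule ℝ K) (FM : ℤ → Submodule ℝ M) (d : K →ₗ[ℝ] M) (p : ℤ) :
    Submodule ℝ M :=
  FM p ⊓ A.map d

/-- `E_r^p = Z_r^p / (Z_{r-1}^{p+1} + B_{r-1}^p)` at the middle term of `K → M → N`. -/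
def specE (FK : ℤ → Submodule ℝ K) (FM : ℤ → Submodule ℝ M) (FN : ℤ → Submodule ℝ N)
    (d : K →ₗ[ℝ] M) (d' : M →ₗ[ℝ] N) (r p : ℤ) : Subquot M where
  num := specZ FM FN d' r p
  den := specZ FM FN d' (r - 1) (p + 1) ⊔ specB FK FM d (r - 1) p

/-- `E_∞^p = Z_∞^p / (Z_∞^{p+1} + B_∞^p)` at the middle term of `K → M → N`. -/
def specEInf (A : Submodule ℝ K) (FM : ℤ → Submodule ℝ M)
    (d : K →ₗ[ℝ] M) (d' : M →ₗ[ℝ] N) (p : ℤ) : Subquot M where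
  num := specZInf FM d' p
  den := specZInf FM d' (p + 1) ⊔ specBInf A FM d p

end Spectral

/-! ### The spectral sequence of a parametric vector field -/

/-- The differential `d(Y) = D_μ(v) Y^P + Y^T v + ad_{Y^S} v`. -/
def diffl {m : ℕ} (v : VF m) : Gen m →ₗ[ℝ] VF m where
  toFun Y := fun i =>
    (∑ l : Fin m, MvPowerSeries.pderiv ℂ (Sum.inr l) (v i) * Y.1 l) + Y.2.1 * v i
      + bracket Y.2.2 v i
  map_add' Y Y' := by
    funext i
    simp only [bracket, Prod.fst_add, Prod.snd_add, Pi.add_apply, map_add, mul_add, add_mul,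
      Finset.sum_add_distrib, Finset.sum_sub_distrib]
    ring
  map_smul' c Y := by
    have hc : ∀ (s : Var m) (f : Ser m),
        MvPowerSeries.pderiv ℂ s (c • f) = c • MvPowerSeries.pderiv ℂ s f := by
      intro s f
      ext e
      simp [MvPowerSeries.coeff_pderiv]
    funext i
    simp only [bracket, Prod.smul_fst, Prod.smul_snd, Pi.smul_apply, hc, mul_smul_comm,
      smul_mul_assoc, RingHom.id_apply, smul_add, Finset.smul_sum, smul_sub]

/-- The page entry `E_r^{p,1-p}` of the spectral sequence of the two-term filtered complex
`0 → A^{0,*} → L → 0` with differential `diffl v`. -/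
def pageE {m : ℕ} (α : ℕ) (v : VF m) (r p : ℤ) : Subquot (VF m) :=
  specE (genFilt α) (stateFilt α) (fun _ => (⊥ : Submodule ℝ PUnit.{1})) (diffl v)
    (0 : VF m →ₗ[ℝ] PUnit.{1}) r p

/-- The limit entry `E_∞^{p,1-p}`. -/
def pageEInf {m : ℕ} (α : ℕ) (v : VF m) (p : ℤ) : Subquot (VF m) :=
  specEInf (genSpace α) (stateFilt α) (diffl v) (0 : VF m →ₗ[ℝ] PUnit.{1}) p

/-- The removable space `T_n^{(r)}` of grade `n` and level `r`: the grade-`n` parts of the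
elements of `B_{r-1}^{n,1-n}`. -/
def removable {m : ℕ} (α : ℕ) (v : VF m) (r n : ℤ) : Submodule ℝ (VF m) :=
  (specB (genFilt α) (stateFilt α) (diffl v) (r - 1) n).map (gradePart α n)

/-! ### Formal basis style -/

/-- Indices of the formal basis of the parametric state space: `(false, e)` stands for
`X_{jk} μ^n` and `(true, e)` for `Y_{jk} μ^n`, where `e = (j, k, n)`. -/
abbrev BasisIndex (m : ℕ) : Type :=
  {b : Bool × Expo m // Admissible b.2 ∧ (b.2 = zExp m → b.1 = true)}

/-- `X_{jk} μ^n = (z^j w^k μ^n, w^j z^k μ^n)` and `Y_{jk} μ^n = (i z^j w^k μ^n, -i w^j z^k μ^n)`. -/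
def basisField {m : ℕ} (b : BasisIndex m) : VF m :=
  let c : ℂ := if b.1.1 then Complex.I else 1
  ![MvPowerSeries.monomial b.1.2 c, MvPowerSeries.monomial (swapExp b.1.2) (conj c)]

/-- The grade of a basis element. -/
def basisGrade {m : ℕ} (α : ℕ) (b : BasisIndex m) : ℤ := (wt α b.1.2 : ℤ) - 1

open Classical in
/-- Successive choice of basis elements: running through the ordered basis, an element of grade
`n` is taken if it is not in the sum of `W` and the span of the elements taken before it.
The value at `k` is the span of the elements taken among the first `k`. -/
def styleSpan {m : ℕ} (α : ℕ) (ord : ℕ ≃ BasisIndex m) (n : ℤ) (W : Submodule ℝ (VF m)) :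
    ℕ → Submodule ℝ (VF m)
  | 0 => ⊥
  | k + 1 =>
    if basisGrade α (ord k) = n ∧ basisField (ord k) ∉ W ⊔ styleSpan α ord n W k then
      styleSpan α ord n W k ⊔ Submodule.span ℝ {basisField (ord k)}
    else styleSpan α ord n W k

/-- The formal-basis-style complement of `W` in the grade-`n` part of the state space. -/
def styleComplement {m : ℕ} (α : ℕ) (ord : ℕ ≃ BasisIndex m) (n : ℤ)
    (W : Submodule ℝ (VF m)) : Submodule ℝ (VF m) :=
  ⨆ k, styleSpan α ord n W k

/-- The complement `N_n^{(r)}` of `T_n^{(r)}` in the grade-`n` part of the state space. -/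
def normalSpace {m : ℕ} (α : ℕ) (ord : ℕ ≃ BasisIndex m) (v : VF m) (r n : ℤ) :
    Submodule ℝ (VF m) :=
  styleComplement α ord n (removable α v r n)

end

end ParamNF

namespace ParamNF

noncomputable section

/-! ### Complete filtered vector spaces -/

/-! A near-identity map acts on ℂ[[z,w,μ]] through a unipotent ring automorphism `B`, followed by
multiplication by a unit (the time rescaling). It is thus a pair `(A, B)` with `A f = A 1 * B f`.
Viewing a field v as the derivation X_v, its image w is given by X_w = A X_v B⁻¹ (`Rel`,
`GPair.act`). Such pairs form a group (`GPair`). Its Lie algebra consists of pairs of a derivation b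
and an operator a = b + t (`LPair`); exponential and logarithm of filtration-raising operators
connect the two. The infinitesimal action a X_v − X_v b (`tanAct`) of the pair of a generator Y is
exactly d(Y) (`tanAct_gen`), so removable terms are lowest-grade parts of tangent vectors to the
orbit of v.

The time components in A⁰ are series in zw and μ only, whereas the Lie algebra contains every real
t. The Hopf condition bridges the gap. The equation T = g + X_v h is solvable with g of charge zero
(`hopf_homological`), and X_v(h) v = [hv, v], so the surplus time component can be moved into the
state component. Hence A⁰ already yields all tangent vectors (`mem_removable_iff`).

Invariance and uniqueness follow. Conjugation carries tangent vectors at v to tangent vectors at w,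
and unipotent maps do not change lowest-grade parts, so the removable spaces are constant on orbits
(`Rel.removable_eq`). If v and w are equivalent and agree below grade r, the logarithm of the
transformation shows that the grade-r part of w − v is removable (`Rel.exists_tangent`). Two normal
forms therefore agree grade by grade, because the complement meets the removable space trivially.

Existence has two difficulties. A term of grade r may only be removable by generators of low grade,
so convergence of the composites is not automatic. The generators, however, form a complete space
with finite-dimensional quotients, and a Chevalley-type argument (`exists_deep_preimage`) gives s(r)
→ ∞ such that a term of grade r can be removed by a generator of filtration s(r). Moreover the
composites must again have time components in zw and μ. For this v is first made resonant by some σ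
without time rescaling (`exists_resonant`). The complements are resonant as well
(`normalSpace_le_resonant`), so the remaining removals are done by resonant generators
(`exists_resGen_of_removable`). The resulting pairs commute with the charge operator, whence `A 1`
has charge zero. `GPair.gen` reads a generator off any pair, continuously, and σ is absorbed into
the first step.

The statement on the pages is formal: at level r and grade r the generators range over F¹A⁰ = A⁰, so
nothing changes on later pages. -/

/-- A decreasing, exhaustive, separated and complete filtration of a real vector space. -/
structure CFilt (M : Type*) [AddCommGroup M] [Module ℝ M] where
  F : ℕ → Submodule ℝ M
  F_zero : F 0 = ⊤
  anti : Antitone F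
  sep : ∀ x, (∀ n, x ∈ F n) → x = 0
  complete : ∀ x : ℕ → M, (∀ N, ∀ᶠ n in atTop, x (n + 1) - x n ∈ F N) →
    ∃ y, ∀ N, ∀ᶠ n in atTop, x n - y ∈ F N

section Filtered

variable {M M₁ M₂ M₃ : Type*} [AddCommGroup M] [Module ℝ M] [AddCommGroup M₁] [Module ℝ M₁]
  [AddCommGroup M₂] [Module ℝ M₂] [AddCommGroup M₃] [Module ℝ M₃]
  {Φ : CFilt M} {Φ₁ : CFilt M₁} {Φ₂ : CFilt M₂} {Φ₃ : CFilt M₃}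

/-- A linear map raises the filtration by at least `p`. -/
def Raises (Φ₁ : CFilt M₁) (Φ₂ : CFilt M₂) (p : ℕ) (K : M₁ →ₗ[ℝ] M₂) : Prop :=
  ∀ n x, x ∈ Φ₁.F n → K x ∈ Φ₂.F (n + p)

theorem CFilt.mem_zero (Φ : CFilt M) (x : M) : x ∈ Φ.F 0 := by rw [Φ.F_zero]; trivial

theorem CFilt.mem_of_le (Φ : CFilt M) {i j : ℕ} (h : i ≤ j) {x : M} (hx : x ∈ Φ.F j) :
    x ∈ Φ.F i := Φ.anti h hx

theorem CFilt.eq_of_forall_sub_mem (Φ : CFilt M) {x y : M} (h : ∀ n, x - y ∈ Φ.F n) : x = y :=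
  sub_eq_zero.1 (Φ.sep _ h)

theorem Raises.mem {p : ℕ} {K : M₁ →ₗ[ℝ] M₂} (hK : Raises Φ₁ Φ₂ p K) (x : M₁) :
    K x ∈ Φ₂.F p := by simpa using hK 0 x (Φ₁.mem_zero x)

theorem Raises.mono {p q : ℕ} (h : q ≤ p) {K : M₁ →ₗ[ℝ] M₂} (hK : Raises Φ₁ Φ₂ p K) :
    Raises Φ₁ Φ₂ q K := fun n x hx => Φ₂.mem_of_le (by lia) (hK n x hx)

theorem Raises.add {p : ℕ} {K L : M₁ →ₗ[ℝ] M₂} (hK : Raises Φ₁ Φ₂ p K)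
    (hL : Raises Φ₁ Φ₂ p L) : Raises Φ₁ Φ₂ p (K + L) :=
  fun n x hx => Submodule.add_mem _ (hK n x hx) (hL n x hx)

theorem Raises.sub {p : ℕ} {K L : M₁ →ₗ[ℝ] M₂} (hK : Raises Φ₁ Φ₂ p K)
    (hL : Raises Φ₁ Φ₂ p L) : Raises Φ₁ Φ₂ p (K - L) :=
  fun n x hx => Submodule.sub_mem _ (hK n x hx) (hL n x hx)

theorem Raises.neg {p : ℕ} {K : M₁ →ₗ[ℝ] M₂} (hK : Raises Φ₁ Φ₂ p K) :
    Raises Φ₁ Φ₂ p (-K) :=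
  fun n x hx => Submodule.neg_mem _ (hK n x hx)

theorem Raises.mul {p q : ℕ} {K L : Module.End ℝ M} (hK : Raises Φ Φ p K)
    (hL : Raises Φ Φ q L) : Raises Φ Φ (p + q) (K * L) := fun n x hx => by
  have := hK _ _ (hL n x hx)
  rw [add_assoc, add_comm q p] at this
  exact this

theorem Raises.one : Raises Φ Φ 0 (1 : Module.End ℝ M) := fun n x hx => by simpa using hx

theorem Raises.pow_mem {K : Module.End ℝ M} (hK : Raises Φ Φ 1 K) (k : ℕ) {n : ℕ} {x : M}
    (hx : x ∈ Φ.F n) : (K ^ k) x ∈ Φ.F (n + k) := by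
  induction k with
  | zero => simpa using hx
  | succ k ih => rw [pow_succ', ← add_assoc]; exact hK _ _ ih

theorem Raises.of_sub_one {K : Module.End ℝ M} (hK : Raises Φ Φ 1 (K - 1)) : Raises Φ Φ 0 K := by
  have := (hK.mono (Nat.zero_le 1)).add (Raises.one (Φ := Φ))
  simpa using this

/-- Convergence with respect to a filtration. -/
def Tends (Φ : CFilt M) (x : ℕ → M) (y : M) : Prop := ∀ N, ∀ᶠ n in atTop, x n - y ∈ Φ.F N

theorem Tends.unique {x : ℕ → M} {y z : M} (hy : Tends Φ x y) (hz : Tends Φ x z) : y = z := by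
  refine Φ.eq_of_forall_sub_mem fun N => ?_
  obtain ⟨n, h1, h2⟩ := ((hy N).and (hz N)).exists
  have := Submodule.sub_mem _ h2 h1
  simpa using this

theorem Tends.const (y : M) : Tends Φ (fun _ => y) y := fun N => by simp

theorem Tends.add {x x' : ℕ → M} {y y' : M} (h : Tends Φ x y) (h' : Tends Φ x' y') :
    Tends Φ (fun n => x n + x' n) (y + y') := fun N => by
  filter_upwards [h N, h' N] with n h1 h2
  have := Submodule.add_mem _ h1 h2
  rwa [add_sub_add_comm]

theorem Tends.map {p : ℕ} {K : M₁ →ₗ[ℝ] M₂} (hK : Raises Φ₁ Φ₂ p K) {x : ℕ → M₁} {y : M₁}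
    (h : Tends Φ₁ x y) : Tends Φ₂ (fun n => K (x n)) (K y) := fun N => by
  filter_upwards [h N] with n h1
  have := hK.mono (Nat.zero_le p) _ _ h1
  simpa using this

theorem Tends.mem {x : ℕ → M} {y : M} (h : Tends Φ x y) {N : ℕ} (hx : ∀ᶠ n in atTop, x n ∈ Φ.F N) :
    y ∈ Φ.F N := by
  obtain ⟨n, h1, h2⟩ := ((h N).and hx).exists
  have := Submodule.sub_mem _ h2 h1
  simpa using this

/-! ### Functional calculus -/

theorem aeval_mem {K : Module.End ℝ M} (hK : Raises Φ Φ 1 K) {p : Polynomial ℝ} {n : ℕ}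
    (hp : ∀ i < n, p.coeff i = 0) (x : M) : Polynomial.aeval K p x ∈ Φ.F n := by
  rw [Polynomial.aeval_eq_sum_range, LinearMap.sum_apply]
  refine Submodule.sum_mem _ fun i _ => ?_
  by_cases hi : i < n
  · simp [hp i hi]
  · exact Submodule.smul_mem _ _ (Φ.mem_of_le (by lia) (hK.pow_mem i (Φ.mem_zero x)))

/-- Powers of `K` beyond the n-th land in step n of the filtration, so the truncations are Cauchy.
The explicit rate determines the sum uniquely, and this is what makes the chosen value linear and
multiplicative below. -/
theorem exists_series (Φ : CFilt M) {K : Module.End ℝ M} (hK : Raises Φ Φ 1 K)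
    (a : PowerSeries ℝ) (x : M) :
    ∃ y, ∀ n, y - Polynomial.aeval K (PowerSeries.trunc n a) x ∈ Φ.F n := by
  have key : ∀ n k, n ≤ k → Polynomial.aeval K (PowerSeries.trunc k a) x -
      Polynomial.aeval K (PowerSeries.trunc n a) x ∈ Φ.F n := by
    intro n k hnk
    rw [← LinearMap.sub_apply, ← map_sub]
    refine aeval_mem hK (fun i hi => ?_) x
    simp [PowerSeries.coeff_trunc, hi, hi.trans_le hnk]
  obtain ⟨y, hy⟩ := Φ.complete (fun n => Polynomial.aeval K (PowerSeries.trunc n a) x)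
    (fun N => by
      filter_upwards [eventually_ge_atTop N] with n hn
      exact Φ.mem_of_le hn (key n (n + 1) (Nat.le_succ n)))
  refine ⟨y, fun n => ?_⟩
  obtain ⟨k, h1, h2⟩ := ((hy n).and (eventually_ge_atTop n)).exists
  have := Submodule.sub_mem _ (key n k h2) h1
  simpa using this

/-- The operator `∑ aₖ Kᵏ` for a filtration-raising operator `K`. -/
def serOp (Φ : CFilt M) {K : Module.End ℝ M} (hK : Raises Φ Φ 1 K) (a : PowerSeries ℝ) :
    Module.End ℝ M where
  toFun x := (exists_series Φ hK a x).choose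
  map_add' x y := Φ.eq_of_forall_sub_mem fun n => by
    have h := (exists_series Φ hK a (x + y)).choose_spec n
    have hx := (exists_series Φ hK a x).choose_spec n
    have hy := (exists_series Φ hK a y).choose_spec n
    have := Submodule.sub_mem _ h (Submodule.add_mem _ hx hy)
    rw [map_add] at this
    convert this using 1
    abel
  map_smul' c x := Φ.eq_of_forall_sub_mem fun n => by
    have h := (exists_series Φ hK a (c • x)).choose_spec n
    have hx := (exists_series Φ hK a x).choose_spec n
    have := Submodule.sub_mem _ h (Submodule.smul_mem _ c hx)
    rw [map_smul, smul_sub] at this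
    convert this using 1
    simp

theorem serOp_sub_mem {K : Module.End ℝ M} (hK : Raises Φ Φ 1 K) (a : PowerSeries ℝ) (x : M)
    (n : ℕ) : serOp Φ hK a x - Polynomial.aeval K (PowerSeries.trunc n a) x ∈ Φ.F n :=
  (exists_series Φ hK a x).choose_spec n

theorem serOp_sub_mem' {K : Module.End ℝ M} (hK : Raises Φ Φ 1 K) {a : PowerSeries ℝ}
    {p : Polynomial ℝ} {n : ℕ} (h : ∀ i < n, PowerSeries.coeff i a = p.coeff i) (x : M) :
    serOp Φ hK a x - Polynomial.aeval K p x ∈ Φ.F n := by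
  have h1 := serOp_sub_mem hK a x n
  have h2 : Polynomial.aeval K (PowerSeries.trunc n a - p) x ∈ Φ.F n := by
    refine aeval_mem hK (fun i hi => ?_) x
    simp [PowerSeries.coeff_trunc, hi, h i hi]
  rw [map_sub, LinearMap.sub_apply] at h2
  have := Submodule.add_mem _ h1 h2
  simpa using this

theorem serOp_eq_of_poly {K : Module.End ℝ M} (hK : Raises Φ Φ 1 K) (p : Polynomial ℝ) :
    serOp Φ hK (p : PowerSeries ℝ) = Polynomial.aeval K p := by
  ext x
  exact Φ.eq_of_forall_sub_mem fun n => serOp_sub_mem' hK (by simp) x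

theorem aeval_raises_zero {K : Module.End ℝ M} (hK : Raises Φ Φ 1 K) (p : Polynomial ℝ) :
    Raises Φ Φ 0 (Polynomial.aeval K p) := fun n x hx => by
  rw [Polynomial.aeval_eq_sum_range, LinearMap.sum_apply]
  exact Submodule.sum_mem _ fun i _ =>
    Submodule.smul_mem _ _ (Φ.mem_of_le (by lia) (hK.pow_mem i hx))

theorem serOp_mul {K : Module.End ℝ M} (hK : Raises Φ Φ 1 K) (a b : PowerSeries ℝ) :
    serOp Φ hK (a * b) = serOp Φ hK a * serOp Φ hK b := by
  ext x
  refine Φ.eq_of_forall_sub_mem fun n => ?_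
  have h1 := serOp_sub_mem hK a (serOp Φ hK b x) n
  have h2 := aeval_raises_zero hK (PowerSeries.trunc n a) _ _ (serOp_sub_mem hK b x n)
  have h3 : serOp Φ hK (a * b) x - Polynomial.aeval K
      (PowerSeries.trunc n a * PowerSeries.trunc n b) x ∈ Φ.F n := by
    refine serOp_sub_mem' hK (fun i hi => ?_) x
    rw [PowerSeries.coeff_mul, Polynomial.coeff_mul]
    refine Finset.sum_congr rfl fun q hq => ?_
    have := Finset.HasAntidiagonal.mem_antidiagonal.1 hq
    rw [PowerSeries.coeff_trunc, PowerSeries.coeff_trunc, if_pos (by lia), if_pos (by lia)]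
  rw [map_mul, Module.End.mul_apply] at h3
  have := Submodule.sub_mem _ h3 (Submodule.add_mem _ h1 h2)
  rw [map_sub] at this
  convert this using 1
  rw [Module.End.mul_apply]
  abel

/-- The algebra homomorphism `a ↦ ∑ aₖ Kᵏ`. -/
def ser (Φ : CFilt M) {K : Module.End ℝ M} (hK : Raises Φ Φ 1 K) :
    PowerSeries ℝ →ₐ[ℝ] Module.End ℝ M :=
  AlgHom.ofLinearMap
    { toFun := serOp Φ hK
      map_add' := fun a b => by
        ext x
        refine Φ.eq_of_forall_sub_mem fun n => ?_
        have := Submodule.sub_mem _ (serOp_sub_mem hK (a + b) x n)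
          (Submodule.add_mem _ (serOp_sub_mem hK a x n) (serOp_sub_mem hK b x n))
        rw [map_add, map_add, LinearMap.add_apply] at this
        convert this using 1
        rw [LinearMap.add_apply]; abel
      map_smul' := fun c a => by
        ext x
        refine Φ.eq_of_forall_sub_mem fun n => ?_
        have h := Submodule.smul_mem _ c (serOp_sub_mem hK a x n)
        have h' : serOp Φ hK (c • a) x - Polynomial.aeval K (c • PowerSeries.trunc n a) x ∈
            Φ.F n := serOp_sub_mem' hK (fun i hi => by simp [PowerSeries.coeff_trunc, hi]) x
        have := Submodule.sub_mem _ h' h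
        rw [map_smul, LinearMap.smul_apply, smul_sub] at this
        convert this using 1
        simp }
    (by
      change serOp Φ hK 1 = 1
      rw [← Polynomial.coe_one, serOp_eq_of_poly, map_one])
    (serOp_mul hK)

theorem ser_sub_mem {K : Module.End ℝ M} (hK : Raises Φ Φ 1 K) {a : PowerSeries ℝ}
    {p : Polynomial ℝ} {n : ℕ} (h : ∀ i < n, PowerSeries.coeff i a = p.coeff i) (x : M) :
    ser Φ hK a x - Polynomial.aeval K p x ∈ Φ.F n := serOp_sub_mem' hK h x

theorem ser_coe {K : Module.End ℝ M} (hK : Raises Φ Φ 1 K) (p : Polynomial ℝ) :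
    ser Φ hK (p : PowerSeries ℝ) = Polynomial.aeval K p := serOp_eq_of_poly hK p

theorem ser_X {K : Module.End ℝ M} (hK : Raises Φ Φ 1 K) : ser Φ hK PowerSeries.X = K := by
  rw [← Polynomial.coe_X, ser_coe, Polynomial.aeval_X]

theorem ser_sub_sum_mem {K : Module.End ℝ M} (hK : Raises Φ Φ 1 K) (a : PowerSeries ℝ) (n : ℕ)
    (x : M) : ser Φ hK a x - ∑ i ∈ Finset.range n, PowerSeries.coeff i a • (K ^ i) x ∈ Φ.F n := by
  have h := ser_sub_mem hK (a := a) (n := n)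
    (p := ∑ i ∈ Finset.range n, Polynomial.monomial i (PowerSeries.coeff i a))
    (fun i hi => by simp [Polynomial.finsetSum_coeff, Polynomial.coeff_monomial, hi]) x
  convert h using 2
  rw [map_sum, LinearMap.sum_apply]
  simp [Polynomial.aeval_monomial, Algebra.algebraMap_eq_smul_one]

theorem ser_raises_zero {K : Module.End ℝ M} (hK : Raises Φ Φ 1 K) (a : PowerSeries ℝ) :
    Raises Φ Φ 0 (ser Φ hK a) := fun n x hx => by
  have := Submodule.add_mem _ (serOp_sub_mem hK a x n)
    (aeval_raises_zero hK (PowerSeries.trunc n a) _ _ hx)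
  rwa [sub_add_cancel] at this

/-- If `K` raises by `p` then so does every series in `K` without constant term. -/
theorem ser_raises {K : Module.End ℝ M} (hK : Raises Φ Φ 1 K) {p : ℕ} (hp : Raises Φ Φ p K)
    {a : PowerSeries ℝ} (ha : PowerSeries.constantCoeff a = 0) :
    Raises Φ Φ p (ser Φ hK a) := by
  obtain ⟨b, rfl⟩ := PowerSeries.X_dvd_iff.2 ha
  rw [map_mul, ser_X]
  simpa using hp.mul (ser_raises_zero hK b)

/-- For polynomials this is compatibility of an algebra homomorphism with evaluation. The tail X^n b
of `a` stays divisible by X^n after substituting a series without constant term, hence is negligible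
modulo step n. -/
theorem ser_comp {K : Module.End ℝ M} (hK : Raises Φ Φ 1 K) {l : PowerSeries ℝ}
    (hl : PowerSeries.constantCoeff l = 0) (a : PowerSeries ℝ) :
    ser Φ (ser_raises hK hK hl) a = ser Φ hK (a.subst l) := by
  have hs : PowerSeries.HasSubst l := PowerSeries.HasSubst.of_constantCoeff_zero' hl
  ext x
  refine Φ.eq_of_forall_sub_mem fun n => ?_
  have h1 := serOp_sub_mem (ser_raises hK hK hl) a x n
  have h2 : Polynomial.aeval (ser Φ hK l) (PowerSeries.trunc n a) =
      ser Φ hK ((PowerSeries.trunc n a : PowerSeries ℝ).subst l) := by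
    rw [PowerSeries.subst_coe hs, Polynomial.aeval_algHom_apply]
  obtain ⟨b, hb⟩ : (PowerSeries.X : PowerSeries ℝ) ^ n ∣
      a - (PowerSeries.trunc n a : PowerSeries ℝ) := by
    rw [PowerSeries.X_pow_dvd_iff]
    intro i hi
    simp [PowerSeries.coeff_trunc, hi]
  obtain ⟨l', hl'⟩ := PowerSeries.X_dvd_iff.2 hl
  have h3 : a.subst l = (PowerSeries.trunc n a : PowerSeries ℝ).subst l +
      PowerSeries.X ^ n * (l' ^ n * b.subst l) := by
    have : a = (PowerSeries.trunc n a : PowerSeries ℝ) + PowerSeries.X ^ n * b := by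
      rw [← hb]; ring
    conv_lhs => rw [this]
    rw [PowerSeries.subst_add hs, PowerSeries.subst_mul hs, PowerSeries.subst_pow hs,
      PowerSeries.subst_X hs]
    conv_lhs => enter [2, 1]; rw [hl', mul_pow]
    ring
  have h4 : ser Φ hK (PowerSeries.X ^ n * (l' ^ n * b.subst l)) x ∈ Φ.F n := by
    rw [map_mul, map_pow, ser_X, Module.End.mul_apply]
    exact Φ.mem_of_le (by lia) (hK.pow_mem n (Φ.mem_zero _))
  rw [h3, map_add, LinearMap.add_apply, ← h2]
  have := Submodule.sub_mem _ h1 h4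
  convert this using 1
  rw [sub_sub]
  rfl

/-- By this, compatibility with complex scalars, the real structure, the axis and the charge passes
to exponentials, logarithms and inverses. -/
theorem commute_of_limit {K : Module.End ℝ M} (hK : Raises Φ Φ 1 K) (a : PowerSeries ℝ)
    {ρ : Module.End ℝ M} (hρ : Raises Φ Φ 0 ρ) (h : Commute K ρ) : Commute (ser Φ hK a) ρ := by
  refine LinearMap.ext fun x => Φ.eq_of_forall_sub_mem fun n => ?_
  have h1 := serOp_sub_mem hK a (ρ x) n
  have h2 := hρ _ _ (serOp_sub_mem hK a x n)
  have h3 : Commute (Polynomial.aeval K (PowerSeries.trunc n a)) ρ := by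
    rw [Polynomial.aeval_eq_sum_range]
    exact Commute.sum_left _ _ _ fun i _ => (h.pow_left i).smul_left _
  have h4 := LinearMap.congr_fun h3.eq x
  rw [Module.End.mul_apply, Module.End.mul_apply] at h4
  rw [map_sub, ← h4] at h2
  have := Submodule.sub_mem _ h1 h2
  rwa [sub_sub_sub_cancel_right] at this

end Filtered

section Filtered

variable {M M₁ M₂ M₃ : Type*} [AddCommGroup M] [Module ℝ M] [AddCommGroup M₁] [Module ℝ M₁]
  [AddCommGroup M₂] [Module ℝ M₂] [AddCommGroup M₃] [Module ℝ M₃]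
  {Φ : CFilt M} {Φ₁ : CFilt M₁} {Φ₂ : CFilt M₂} {Φ₃ : CFilt M₃}

/-! ### Exponential, logarithm and inverse -/

/-- Only the identity exp(l) = 1 + X and the linear coefficient are ever used, so l is taken as the
compositional inverse of exp − 1 and no further coefficient is computed. -/
theorem exists_logSeries : ∃ l : PowerSeries ℝ, PowerSeries.constantCoeff l = 0 ∧
    PowerSeries.coeff 1 l = 1 ∧ (PowerSeries.exp ℝ).subst l = 1 + PowerSeries.X := by
  have h0 : PowerSeries.constantCoeff (PowerSeries.exp ℝ - 1) = 0 := by simp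
  have h1 : IsUnit (PowerSeries.coeff 1 (PowerSeries.exp ℝ - 1)) := by
    simp [PowerSeries.coeff_exp, PowerSeries.coeff_one]
  have hs := PowerSeries.HasSubst.substInvOfIsUnit (P := PowerSeries.exp ℝ - 1) (hP' := h1)
  refine ⟨_, PowerSeries.constantCoeff_substInvOfIsUnit _ h1, ?_, ?_⟩
  · rw [PowerSeries.coeff_one_substInvOfIsUnit]
    simp [PowerSeries.coeff_exp, PowerSeries.coeff_one]
  · have := PowerSeries.subst_substInvOfIsUnit_right _ h0 h1
    rw [PowerSeries.subst_sub hs] at this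
    have h2 : (1 : PowerSeries ℝ).subst
      (PowerSeries.substInvOfIsUnit (PowerSeries.exp ℝ - 1) h1) = 1 := by
      rw [← PowerSeries.coe_substAlgHom hs, map_one]
    rw [h2] at this
    rw [← this]; ring

/-- The power series of `log (1 + X)`, as the compositional inverse of `exp X - 1`. -/
def logSeries : PowerSeries ℝ := exists_logSeries.choose

theorem constantCoeff_logSeries : PowerSeries.constantCoeff logSeries = 0 :=
  exists_logSeries.choose_spec.1

theorem coeff_one_logSeries : PowerSeries.coeff 1 logSeries = 1 :=
  exists_logSeries.choose_spec.2.1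

theorem exp_subst_logSeries : (PowerSeries.exp ℝ).subst logSeries = 1 + PowerSeries.X :=
  exists_logSeries.choose_spec.2.2

/-- The exponential of a filtration-raising operator. -/
def expOp (Φ : CFilt M) {K : Module.End ℝ M} (hK : Raises Φ Φ 1 K) : Module.End ℝ M :=
  ser Φ hK (PowerSeries.exp ℝ)

/-- The logarithm of a unipotent operator. -/
def logOp (Φ : CFilt M) {A : Module.End ℝ M} (hA : Raises Φ Φ 1 (A - 1)) : Module.End ℝ M :=
  ser Φ hA logSeries

/-- The inverse of a unipotent operator. -/
def invOp (Φ : CFilt M) {A : Module.End ℝ M} (hA : Raises Φ Φ 1 (A - 1)) : Module.End ℝ M :=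
  ser Φ hA (1 + PowerSeries.X)⁻¹

theorem logOp_raises {A : Module.End ℝ M} (hA : Raises Φ Φ 1 (A - 1)) :
    Raises Φ Φ 1 (logOp Φ hA) := ser_raises hA hA constantCoeff_logSeries

theorem ser_one_add_X {A : Module.End ℝ M} (hA : Raises Φ Φ 1 (A - 1)) :
    ser Φ hA (1 + PowerSeries.X) = A := by
  rw [map_add, map_one, ser_X]; abel

theorem expOp_logOp {A : Module.End ℝ M} (hA : Raises Φ Φ 1 (A - 1)) :
    expOp Φ (logOp_raises hA) = A := by
  unfold expOp logOp
  rw [ser_comp hA constantCoeff_logSeries, exp_subst_logSeries, ser_one_add_X]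

theorem expOp_sub_one_raises {K : Module.End ℝ M} (hK : Raises Φ Φ 1 K) {p : ℕ}
    (hp : Raises Φ Φ p K) : Raises Φ Φ p (expOp Φ hK - 1) := by
  have : expOp Φ hK - 1 = ser Φ hK (PowerSeries.exp ℝ - 1) := by
    rw [map_sub, map_one, expOp]
  rw [this]
  exact ser_raises hK hp (by simp)

theorem mul_invOp {A : Module.End ℝ M} (hA : Raises Φ Φ 1 (A - 1)) : A * invOp Φ hA = 1 := by
  conv_lhs => enter [1]; rw [← ser_one_add_X hA]
  rw [invOp, ← map_mul, PowerSeries.mul_inv_cancel _ (by simp), map_one]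

theorem invOp_mul {A : Module.End ℝ M} (hA : Raises Φ Φ 1 (A - 1)) : invOp Φ hA * A = 1 := by
  conv_lhs => enter [2]; rw [← ser_one_add_X hA]
  rw [invOp, ← map_mul, PowerSeries.inv_mul_cancel _ (by simp), map_one]

theorem apply_invOp {A : Module.End ℝ M} (hA : Raises Φ Φ 1 (A - 1)) (x : M) :
    A (invOp Φ hA x) = x := by
  rw [← Module.End.mul_apply, mul_invOp, Module.End.one_apply]

theorem invOp_apply {A : Module.End ℝ M} (hA : Raises Φ Φ 1 (A - 1)) (x : M) :
    invOp Φ hA (A x) = x := by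
  rw [← Module.End.mul_apply, invOp_mul, Module.End.one_apply]

theorem invOp_sub_one_raises {A : Module.End ℝ M} (hA : Raises Φ Φ 1 (A - 1)) :
    Raises Φ Φ 1 (invOp Φ hA - 1) := by
  have : invOp Φ hA - 1 = ser Φ hA ((1 + PowerSeries.X)⁻¹ - 1) := by
    rw [map_sub, map_one, invOp]
  rw [this]
  exact ser_raises hA hA (by simp)

/-! ### Bilinear maps -/

theorem sum_range_antidiagonal {V : Type*} [AddCommMonoid V] (n : ℕ) (f : ℕ × ℕ → V) :
    ∑ k ∈ Finset.range n, ∑ p ∈ Finset.HasAntidiagonal.antidiagonal k, f p =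
      ∑ p ∈ (Finset.range n ×ˢ Finset.range n) with p.1 + p.2 < n, f p := by
  rw [← Finset.sum_fiberwise_of_maps_to (s := {p ∈ Finset.range n ×ˢ Finset.range n |
    p.1 + p.2 < n}) (t := Finset.range n) (g := fun p => p.1 + p.2) (by simp)]
  refine Finset.sum_congr rfl fun k hk => Finset.sum_congr ?_ fun _ _ => rfl
  ext p
  simp at hk ⊢
  lia

/-- On the tensor product the operators K₁ ⊗ 1 and 1 ⊗ K₂ commute, and `K₃` after `β` is `β` after
their sum. The formula is then the binomial theorem. -/
theorem factorial_smul_iterate (β : M₁ →ₗ[ℝ] M₂ →ₗ[ℝ] M₃) {K₁ : Module.End ℝ M₁}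
    {K₂ : Module.End ℝ M₂} {K₃ : Module.End ℝ M₃}
    (h : ∀ x y, K₃ (β x y) = β (K₁ x) y + β x (K₂ y)) (x : M₁) (y : M₂) (k : ℕ) :
    (k.factorial : ℝ)⁻¹ • (K₃ ^ k) (β x y) = ∑ p ∈ Finset.HasAntidiagonal.antidiagonal k,
      β ((p.1.factorial : ℝ)⁻¹ • (K₁ ^ p.1) x) ((p.2.factorial : ℝ)⁻¹ • (K₂ ^ p.2) y) := by
  open TensorProduct in
  have hβ : ∀ (k : ℕ) (t : M₁ ⊗[ℝ] M₂), (K₃ ^ k) (TensorProduct.lift β t) =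
      TensorProduct.lift β (((LinearMap.rTensor M₂ K₁ + LinearMap.lTensor M₁ K₂) ^ k) t) := by
    intro k
    induction k with
    | zero => simp
    | succ k ih =>
      intro t
      rw [pow_succ, pow_succ, Module.End.mul_apply, Module.End.mul_apply, ← ih]
      congr 1
      induction t with
      | zero => simp
      | tmul x y => simp [h]
      | add s t hs ht => rw [map_add, map_add, hs, ht, map_add, map_add]
  have hc : Commute (LinearMap.rTensor M₂ K₁) (LinearMap.lTensor M₁ K₂) := by
    rw [Commute, SemiconjBy, Module.End.mul_eq_comp, Module.End.mul_eq_comp,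
      LinearMap.lTensor_comp_rTensor, LinearMap.rTensor_comp_lTensor]
  have := hβ k (x ⊗ₜ y)
  rw [hc.add_pow', TensorProduct.lift.tmul] at this
  rw [this, LinearMap.sum_apply, map_sum, Finset.smul_sum]
  refine Finset.sum_congr rfl fun p hp => ?_
  have hp' := Finset.HasAntidiagonal.mem_antidiagonal.1 hp
  rw [LinearMap.smul_apply, Module.End.mul_apply, LinearMap.rTensor_pow, LinearMap.lTensor_pow,
    LinearMap.lTensor_tmul, LinearMap.rTensor_tmul, map_nsmul, TensorProduct.lift.tmul,
    map_smul, map_smul, LinearMap.smul_apply, smul_smul, ← Nat.cast_smul_eq_nsmul ℝ, smul_smul]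
  congr 1
  have h1 := Nat.choose_mul_factorial_mul_factorial (show p.1 ≤ k by lia)
  rw [show k - p.1 = p.2 by lia] at h1
  have h2 : ((k.choose p.1 : ℕ) : ℝ) * p.1.factorial * p.2.factorial = k.factorial := by
    exact_mod_cast h1
  have h3 : (p.1.factorial : ℝ) ≠ 0 := by positivity
  have h4 : (p.2.factorial : ℝ) ≠ 0 := by positivity
  have h5 : (k.factorial : ℝ) ≠ 0 := by positivity
  field_simp
  linarith

theorem coeff_exp_real (i : ℕ) : PowerSeries.coeff i (PowerSeries.exp ℝ) =
    (i.factorial : ℝ)⁻¹ := by simp [PowerSeries.coeff_exp]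

/-- The product of partial sums exceeds the truncated Cauchy product by terms of total index at
least n, which lie in step n − d. Here d is the loss of `β`: 0 for multiplication of series, 1 for a
field acting on a series. -/
theorem bilin_sum_sub_mem (β : M₁ →ₗ[ℝ] M₂ →ₗ[ℝ] M₃) {d : ℕ}
    (hβ : ∀ i j x y, x ∈ Φ₁.F i → y ∈ Φ₂.F j → β x y ∈ Φ₃.F (i + j - d))
    {a : ℕ → M₁} {b : ℕ → M₂} (ha : ∀ i, a i ∈ Φ₁.F i) (hb : ∀ i, b i ∈ Φ₂.F i) {n N : ℕ}
    (hn : N + d ≤ n) :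
    β (∑ i ∈ Finset.range n, a i) (∑ i ∈ Finset.range n, b i) -
      ∑ k ∈ Finset.range n, ∑ p ∈ Finset.HasAntidiagonal.antidiagonal k, β (a p.1) (b p.2) ∈
        Φ₃.F N := by
  have h : β (∑ i ∈ Finset.range n, a i) (∑ i ∈ Finset.range n, b i) =
      ∑ p ∈ Finset.range n ×ˢ Finset.range n, β (a p.1) (b p.2) := by
    rw [Finset.sum_product, map_sum β, LinearMap.sum_apply]
    exact Finset.sum_congr rfl fun i _ => map_sum _ _ _
  rw [sum_range_antidiagonal n (fun p => β (a p.1) (b p.2)), h,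
    ← Finset.sum_filter_add_sum_filter_not _ (fun p : ℕ × ℕ => p.1 + p.2 < n),
    add_sub_cancel_left]
  refine Submodule.sum_mem _ fun p hp => ?_
  simp only [Finset.mem_filter] at hp
  exact Φ₃.mem_of_le (show N ≤ p.1 + p.2 - d by lia) (hβ _ _ _ _ (ha _) (hb _))

/-- The exponential form of a Leibniz rule. -/
theorem expOp_bilin (β : M₁ →ₗ[ℝ] M₂ →ₗ[ℝ] M₃) {d : ℕ}
    (hβ : ∀ i j x y, x ∈ Φ₁.F i → y ∈ Φ₂.F j → β x y ∈ Φ₃.F (i + j - d))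
    {K₁ : Module.End ℝ M₁} {K₂ : Module.End ℝ M₂} {K₃ : Module.End ℝ M₃}
    (h₁ : Raises Φ₁ Φ₁ 1 K₁) (h₂ : Raises Φ₂ Φ₂ 1 K₂) (h₃ : Raises Φ₃ Φ₃ 1 K₃)
    (h : ∀ x y, K₃ (β x y) = β (K₁ x) y + β x (K₂ y)) (x : M₁) (y : M₂) :
    expOp Φ₃ h₃ (β x y) = β (expOp Φ₁ h₁ x) (expOp Φ₂ h₂ y) := by
  refine Φ₃.eq_of_forall_sub_mem fun N => ?_
  set n := N + d with hn
  have e₃ := Φ₃.mem_of_le (show N ≤ n by lia) (ser_sub_sum_mem h₃ (PowerSeries.exp ℝ) n (β x y))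
  have e₁ := ser_sub_sum_mem h₁ (PowerSeries.exp ℝ) n x
  have e₂ := ser_sub_sum_mem h₂ (PowerSeries.exp ℝ) n y
  simp only [coeff_exp_real] at e₁ e₂ e₃
  change expOp Φ₁ h₁ x - _ ∈ _ at e₁
  change expOp Φ₂ h₂ y - _ ∈ _ at e₂
  change expOp Φ₃ h₃ (β x y) - _ ∈ _ at e₃
  set s₁ := ∑ i ∈ Finset.range n, (i.factorial : ℝ)⁻¹ • (K₁ ^ i) x with hs₁
  set s₂ := ∑ i ∈ Finset.range n, (i.factorial : ℝ)⁻¹ • (K₂ ^ i) y with hs₂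
  have f₁ := Φ₃.mem_of_le (show N ≤ n + 0 - d by lia)
    (hβ _ _ _ (expOp Φ₂ h₂ y) e₁ (Φ₂.mem_zero _))
  have f₂ := Φ₃.mem_of_le (show N ≤ 0 + n - d by lia) (hβ _ _ s₁ _ (Φ₁.mem_zero _) e₂)
  have hS : β s₁ s₂ - ∑ i ∈ Finset.range n, (i.factorial : ℝ)⁻¹ • (K₃ ^ i) (β x y) ∈ Φ₃.F N := by
    rw [Finset.sum_congr rfl fun k _ => factorial_smul_iterate β h x y k]
    exact bilin_sum_sub_mem β hβ
      (fun i => Submodule.smul_mem _ _ (by simpa using h₁.pow_mem i (Φ₁.mem_zero x)))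
      (fun i => Submodule.smul_mem _ _ (by simpa using h₂.pow_mem i (Φ₂.mem_zero y))) hn.ge
  have := Submodule.sub_mem _ (Submodule.sub_mem _ (Submodule.sub_mem _ e₃ hS) f₁) f₂
  simp only [map_sub, LinearMap.sub_apply] at this
  convert this using 1
  abel

/-- Tested by a linear functional modulo `W`, the sum becomes a real polynomial in t vanishing at
every natural number, hence the zero polynomial. -/
theorem coeff_mem_of_forall_eval (W : Submodule ℝ M) (n : ℕ) (c : ℕ → M)
    (h : ∀ t : ℕ, ∑ k ∈ Finset.range n, (t : ℝ) ^ k • c k ∈ W) {k : ℕ} (hk : k < n) :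
    c k ∈ W := by
  rw [← Submodule.Quotient.mk_eq_zero, ← Module.forall_dual_apply_eq_zero_iff ℝ]
  intro φ
  let P : Polynomial ℝ := ∑ k ∈ Finset.range n, Polynomial.monomial k (φ (W.mkQ (c k)))
  have hP : P = 0 := by
    refine Polynomial.eq_zero_of_infinite_isRoot P
      ((Set.infinite_range_of_injective (f := fun t : ℕ => (t : ℝ)) Nat.cast_injective).mono ?_)
    rintro _ ⟨t, rfl⟩
    have h2 : φ (W.mkQ (∑ k ∈ Finset.range n, (t : ℝ) ^ k • c k)) = 0 := by
      rw [Submodule.mkQ_apply, (Submodule.Quotient.mk_eq_zero _).2 (h t), map_zero]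
    simp only [map_sum, map_smul, smul_eq_mul] at h2
    simp only [Set.mem_ofPred_eq, Polynomial.IsRoot, P, Polynomial.eval_finsetSum,
      Polynomial.eval_monomial]
    rw [← h2]
    exact Finset.sum_congr rfl fun _ _ => mul_comm _ _
  have : P.coeff k = 0 := by rw [hP, Polynomial.coeff_zero]
  simpa [P, Polynomial.finsetSum_coeff, Polynomial.coeff_monomial, hk] using this

/-- Modulo each step of the filtration, A^t = exp(t log A) is polynomial in t. This permits
comparison of coefficients of t in identities known for all natural powers. -/
theorem pow_eq_ser_logOp {A : Module.End ℝ M} (hA : Raises Φ Φ 1 (A - 1)) (t : ℕ) :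
    A ^ t = ser Φ (logOp_raises hA) (PowerSeries.rescale (t : ℝ) (PowerSeries.exp ℝ)) := by
  rw [← PowerSeries.exp_pow_eq_rescale_exp, map_pow]
  congr 1
  exact (expOp_logOp hA).symm

/-- The logarithmic form of a multiplicativity rule. -/
theorem logOp_bilin (β : M₁ →ₗ[ℝ] M₂ →ₗ[ℝ] M₃) {d : ℕ}
    (hβ : ∀ i j x y, x ∈ Φ₁.F i → y ∈ Φ₂.F j → β x y ∈ Φ₃.F (i + j - d))
    {A₁ : Module.End ℝ M₁} {A₂ : Module.End ℝ M₂} {A₃ : Module.End ℝ M₃}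
    (h₁ : Raises Φ₁ Φ₁ 1 (A₁ - 1)) (h₂ : Raises Φ₂ Φ₂ 1 (A₂ - 1)) (h₃ : Raises Φ₃ Φ₃ 1 (A₃ - 1))
    (h : ∀ x y, A₃ (β x y) = β (A₁ x) (A₂ y)) (x : M₁) (y : M₂) :
    logOp Φ₃ h₃ (β x y) = β (logOp Φ₁ h₁ x) y + β x (logOp Φ₂ h₂ y) := by
  refine Φ₃.eq_of_forall_sub_mem fun N => ?_
  set L₁ := logOp Φ₁ h₁
  set L₂ := logOp Φ₂ h₂
  set L₃ := logOp Φ₃ h₃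
  have hpow : ∀ t : ℕ, (A₃ ^ t) (β x y) = β ((A₁ ^ t) x) ((A₂ ^ t) y) := by
    intro t
    induction t with
    | zero => simp
    | succ t ih => rw [pow_succ', pow_succ', pow_succ', Module.End.mul_apply, ih, h]; rfl
  -- The summand d compensates the loss of `β`, and 2 keeps the index 1 below n. The vector `c k` is
  -- the discrepancy between the coefficients of t^k on the two sides of A₃^t β(x,y) = β(A₁^t x,
  -- A₂^t y); the claim is the case k = 1.
  set n := N + d + 2 with hn
  let c : ℕ → M₃ := fun k => (k.factorial : ℝ)⁻¹ • (L₃ ^ k) (β x y) -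
    ∑ p ∈ Finset.HasAntidiagonal.antidiagonal k,
      β ((p.1.factorial : ℝ)⁻¹ • (L₁ ^ p.1) x) ((p.2.factorial : ℝ)⁻¹ • (L₂ ^ p.2) y)
  have hc : ∀ t : ℕ, ∑ k ∈ Finset.range n, (t : ℝ) ^ k • c k ∈ Φ₃.F N := by
    intro t
    have e₃ := Φ₃.mem_of_le (show N ≤ n by lia) (ser_sub_sum_mem (logOp_raises h₃)
      (PowerSeries.rescale (t : ℝ) (PowerSeries.exp ℝ)) n (β x y))
    have e₁ := ser_sub_sum_mem (logOp_raises h₁)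
      (PowerSeries.rescale (t : ℝ) (PowerSeries.exp ℝ)) n x
    have e₂ := ser_sub_sum_mem (logOp_raises h₂)
      (PowerSeries.rescale (t : ℝ) (PowerSeries.exp ℝ)) n y
    simp only [PowerSeries.coeff_rescale, coeff_exp_real, ← pow_eq_ser_logOp] at e₁ e₂ e₃
    set s₁ := ∑ i ∈ Finset.range n, ((t : ℝ) ^ i * (i.factorial : ℝ)⁻¹) • (L₁ ^ i) x with hs₁
    set s₂ := ∑ i ∈ Finset.range n, ((t : ℝ) ^ i * (i.factorial : ℝ)⁻¹) • (L₂ ^ i) y with hs₂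
    have f₁ := Φ₃.mem_of_le (show N ≤ n + 0 - d by lia)
      (hβ _ _ _ ((A₂ ^ t) y) e₁ (Φ₂.mem_zero _))
    have f₂ := Φ₃.mem_of_le (show N ≤ 0 + n - d by lia) (hβ _ _ s₁ _ (Φ₁.mem_zero _) e₂)
    have hS : β s₁ s₂ - ∑ k ∈ Finset.range n, (t : ℝ) ^ k •
        ∑ p ∈ Finset.HasAntidiagonal.antidiagonal k,
        β ((p.1.factorial : ℝ)⁻¹ • (L₁ ^ p.1) x) ((p.2.factorial : ℝ)⁻¹ • (L₂ ^ p.2) y)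
        ∈ Φ₃.F N := by
      have hr : ∀ k ∈ Finset.range n, (t : ℝ) ^ k •
          ∑ p ∈ Finset.HasAntidiagonal.antidiagonal k,
          β ((p.1.factorial : ℝ)⁻¹ • (L₁ ^ p.1) x) ((p.2.factorial : ℝ)⁻¹ • (L₂ ^ p.2) y) =
          ∑ p ∈ Finset.HasAntidiagonal.antidiagonal k,
          β (((t : ℝ) ^ p.1 * (p.1.factorial : ℝ)⁻¹) • (L₁ ^ p.1) x)
            (((t : ℝ) ^ p.2 * (p.2.factorial : ℝ)⁻¹) • (L₂ ^ p.2) y) := by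
        intro k _
        rw [Finset.smul_sum]
        refine Finset.sum_congr rfl fun p hp => ?_
        rw [← Finset.HasAntidiagonal.mem_antidiagonal.1 hp, pow_add]
        simp only [map_smul, LinearMap.smul_apply, smul_smul]
        congr 1
        ring
      rw [Finset.sum_congr rfl hr]
      exact bilin_sum_sub_mem β hβ
        (fun i => Submodule.smul_mem _ _
          (by simpa using (logOp_raises h₁).pow_mem i (Φ₁.mem_zero x)))
        (fun i => Submodule.smul_mem _ _
          (by simpa using (logOp_raises h₂).pow_mem i (Φ₂.mem_zero y))) (by lia)
    have := Submodule.sub_mem _ (Submodule.sub_mem _ (Submodule.sub_mem _ e₃ hS) f₁) f₂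
    rw [← Submodule.neg_mem_iff] at this
    simp only [map_sub, LinearMap.sub_apply, hpow t] at this
    convert this using 1
    simp only [c, smul_sub, Finset.sum_sub_distrib, smul_smul]
    abel
  have h1 := coeff_mem_of_forall_eval (Φ₃.F N) n c hc (k := 1) (by lia)
  simp only [c, Finset.Nat.antidiagonal_succ] at h1
  simp at h1
  convert h1 using 1
  abel

/-! ### Continuity and limits of operators -/

theorem pow_sub_pow_mem {K L : Module.End ℝ M} (hK : Raises Φ Φ 0 K) {N : ℕ}
    (h : ∀ x, K x - L x ∈ Φ.F N) (k : ℕ) (x : M) : (K ^ k) x - (L ^ k) x ∈ Φ.F N := by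
  induction k with
  | zero => simp
  | succ k ih =>
    have h1 := hK _ _ ih
    have h2 := h ((L ^ k) x)
    rw [map_sub] at h1
    have := Submodule.add_mem _ h1 h2
    rwa [sub_add_sub_cancel, ← Module.End.mul_apply, ← Module.End.mul_apply, ← pow_succ',
      ← pow_succ'] at this

theorem ser_sub_ser_mem {K L : Module.End ℝ M} (hK : Raises Φ Φ 1 K) (hL : Raises Φ Φ 1 L)
    {N : ℕ} (h : ∀ x, K x - L x ∈ Φ.F N) (a : PowerSeries ℝ) (x : M) :
    ser Φ hK a x - ser Φ hL a x ∈ Φ.F N := by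
  have h1 := ser_sub_sum_mem hK a N x
  have h2 := ser_sub_sum_mem hL a N x
  have h3 : ∑ i ∈ Finset.range N, PowerSeries.coeff i a • (K ^ i) x -
      ∑ i ∈ Finset.range N, PowerSeries.coeff i a • (L ^ i) x ∈ Φ.F N := by
    rw [← Finset.sum_sub_distrib]
    refine Submodule.sum_mem _ fun i _ => ?_
    rw [← smul_sub]
    exact Submodule.smul_mem _ _ (pow_sub_pow_mem (hK.mono (Nat.zero_le 1)) h i x)
  have := Submodule.sub_mem _ (Submodule.add_mem _ h1 h3) h2
  convert this using 1
  abel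

theorem exists_limit_op (Φ : CFilt M) (A : ℕ → Module.End ℝ M)
    (hA : ∀ N, ∀ᶠ n in atTop, ∀ x, A (n + 1) x - A n x ∈ Φ.F N) :
    ∃ B : Module.End ℝ M, ∀ N, ∀ᶠ n in atTop, ∀ x, A n x - B x ∈ Φ.F N := by
  choose B hB using fun x => Φ.complete (fun n => A n x)
    (fun N => (hA N).mono fun n hn => hn x)
  have hB' : ∀ x, Tends Φ (fun n => A n x) (B x) := hB
  refine ⟨{ toFun := B, map_add' := fun x y => ?_, map_smul' := fun c x => ?_ }, fun N => ?_⟩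
  · refine (hB' (x + y)).unique ?_
    simpa only [map_add] using (hB' x).add (hB' y)
  · refine (hB' (c • x)).unique fun N => ?_
    filter_upwards [hB' x N] with n hn
    rw [map_smul, RingHom.id_apply, ← smul_sub]
    exact Submodule.smul_mem _ c hn
  · obtain ⟨n₀, hn₀⟩ := eventually_atTop.1 (hA N)
    refine eventually_atTop.2 ⟨n₀, fun n hn x => ?_⟩
    have h1 : ∀ k, n ≤ k → A k x - A n x ∈ Φ.F N := by
      intro k hk
      induction k, hk using Nat.le_induction with
      | base => simp
      | succ k hk ih =>
        have := Submodule.add_mem _ (hn₀ k (hn.trans hk) x) ih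
        rwa [sub_add_sub_cancel] at this
    obtain ⟨k, h2, h3⟩ := ((hB' x N).and (eventually_ge_atTop n)).exists
    have := Submodule.sub_mem _ h2 (h1 k h3)
    rwa [sub_sub_sub_cancel_left] at this

end Filtered

/-! ### The weight filtrations -/

/-- The filtration of a space of families of complex numbers by a weight of the coordinates. -/
def CFilt.ofCoords {M J : Type*} [AddCommGroup M] [Module ℝ M] (κ : J → M →ₗ[ℝ] ℂ) (ω : J → ℕ)
    (hinj : ∀ x, (∀ j, κ j x = 0) → x = 0) (hsurj : ∀ g : J → ℂ, ∃ x, ∀ j, κ j x = g j) :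
    CFilt M where
  F N :=
    { carrier := {x | ∀ j, ω j < N → κ j x = 0}
      zero_mem' := by simp
      add_mem' := fun {x y} hx hy j hj => by simp [hx j hj, hy j hj]
      smul_mem' := fun c x hx j hj => by simp [hx j hj] }
  F_zero := by ext; simp
  anti := fun i j hij x hx k hk => hx k (hk.trans_le hij)
  sep := fun x hx => hinj x fun j => hx (ω j + 1) j (Nat.lt_succ_self _)
  complete := fun x hx => by
    choose n₀ hn₀ using fun N => eventually_atTop.1 (hx N)
    -- A coordinate of weight ω is constant from index n₀(ω + 1) on; the limit collects these final
    -- values.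
    obtain ⟨y, hy⟩ := hsurj fun j => κ j (x (n₀ (ω j + 1)))
    have hstab : ∀ N n, n₀ N ≤ n → ∀ j, ω j < N → κ j (x n) = κ j (x (n₀ N)) := by
      intro N n hn j hj
      induction n, hn using Nat.le_induction with
      | base => rfl
      | succ k hk ih =>
        have := hn₀ N k hk j hj
        rw [map_sub, sub_eq_zero] at this
        rw [this, ih]
    refine ⟨y, fun N => eventually_atTop.2 ⟨n₀ N, fun n hn j hj => ?_⟩⟩
    rw [map_sub, hy, hstab N n hn j hj, sub_eq_zero]
    rw [← hstab N (max (n₀ N) (n₀ (ω j + 1))) (le_max_left _ _) j hj,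
      ← hstab (ω j + 1) (max (n₀ N) (n₀ (ω j + 1))) (le_max_right _ _) j (Nat.lt_succ_self _)]

variable {m : ℕ}

/-- The coefficient of a power series as a real linear map. -/
def coeffR (e : Expo m) : Ser m →ₗ[ℝ] ℂ := (MvPowerSeries.coeff e).restrictScalars ℝ

/-- The filtration of power series by weight. -/
def serFilt (m α : ℕ) : CFilt (Ser m) :=
  CFilt.ofCoords coeffR (wt α) (fun _ hx => MvPowerSeries.ext hx) (fun g => ⟨g, fun _ => rfl⟩)

/-- The filtration of vector fields by weight of the coefficients. -/
def vfFilt (m α : ℕ) : CFilt (VF m) :=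
  CFilt.ofCoords (J := Fin 2 × Expo m) (fun j => coeffR j.2 ∘ₗ LinearMap.proj j.1)
    (fun j => wt α j.2) (fun _ hx => funext fun i => MvPowerSeries.ext fun e => hx (i, e))
    (fun g => ⟨fun i e => g (i, e), fun _ => rfl⟩)

theorem mem_serFilt {α N : ℕ} {f : Ser m} :
    f ∈ (serFilt m α).F N ↔ ∀ e, wt α e < N → MvPowerSeries.coeff e f = 0 := Iff.rfl

theorem mem_vfFilt {α N : ℕ} {v : VF m} :
    v ∈ (vfFilt m α).F N ↔ ∀ i, v i ∈ (serFilt m α).F N :=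
  ⟨fun h i e he => h (i, e) he, fun h j hj => h j.1 j.2 hj⟩

/-- The weight of a variable. -/
def varWt (m α : ℕ) : Var m → ℕ := Sum.elim (fun _ => 1) (fun _ => α)

theorem wt_add (α : ℕ) (e e' : Expo m) : wt α (e + e') = wt α e + wt α e' := by
  simp only [wt, stateDeg, paramDeg, Finsupp.add_apply, Finset.sum_add_distrib]
  ring

theorem wt_zero (α : ℕ) : wt α (0 : Expo m) = 0 := by simp [wt, stateDeg, paramDeg]

theorem wt_single (α : ℕ) (s : Var m) : wt α (Finsupp.single s 1) = varWt m α s := by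
  rcases s with s | s
  · fin_cases s <;> simp [wt, stateDeg, paramDeg, varWt]
  · simp [wt, stateDeg, paramDeg, varWt, Finsupp.single_apply]

theorem wt_eq_sum (α : ℕ) (e : Expo m) : wt α e = ∑ s, e s * varWt m α s := by
  simp only [wt, stateDeg, paramDeg, varWt, Fintype.sum_sum_type, Fin.sum_univ_two, Sum.elim_inl,
    Sum.elim_inr, mul_one, ← Finset.sum_mul]
  ring

theorem swapExp_inl_zero (e : Expo m) : swapExp e (Sum.inl 0) = e (Sum.inl 1) := by
  simp [swapExp, Finsupp.equivMapDomain_apply]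

theorem swapExp_inl_one (e : Expo m) : swapExp e (Sum.inl 1) = e (Sum.inl 0) := by
  simp [swapExp, Finsupp.equivMapDomain_apply]

theorem swapExp_inr (e : Expo m) (l : Fin m) : swapExp e (Sum.inr l) = e (Sum.inr l) := rfl

theorem swapExp_swapExp (e : Expo m) : swapExp (swapExp e) = e := by
  ext s
  rcases s with s | s
  · fin_cases s
    · exact (swapExp_inl_zero _).trans (swapExp_inl_one _)
    · exact (swapExp_inl_one _).trans (swapExp_inl_zero _)
  · simp [swapExp_inr]

theorem swapExp_add (e e' : Expo m) : swapExp (e + e') = swapExp e + swapExp e' := by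
  ext s
  rcases s with s | s
  · fin_cases s
    · simp [swapExp_inl_zero]
    · simp [swapExp_inl_one]
  · simp [swapExp_inr]

theorem stateDeg_swapExp (e : Expo m) : stateDeg (swapExp e) = stateDeg e := by
  simp [stateDeg, swapExp_inl_zero, swapExp_inl_one, add_comm]

theorem paramDeg_swapExp (e : Expo m) : paramDeg (swapExp e) = paramDeg e := by
  simp [paramDeg, swapExp_inr]

theorem wt_swapExp (α : ℕ) (e : Expo m) : wt α (swapExp e) = wt α e := by
  simp [wt, stateDeg_swapExp, paramDeg_swapExp]

theorem stateDeg_add (e e' : Expo m) : stateDeg (e + e') = stateDeg e + stateDeg e' := by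
  simp only [stateDeg, Finsupp.add_apply]; ring

/-- Every variable, parameters included, has positive weight because α ≥ 1. This finiteness
underlies the density of polynomials and the finite-dimensional quotients used for convergence. -/
theorem finite_wt_lt {α : ℕ} (hα : 1 ≤ α) (N : ℕ) : {e : Expo m | wt α e < N}.Finite := by
  refine Set.Finite.subset (Set.finite_Iic (Finsupp.equivFunOnFinite.symm fun _ => N)) ?_
  intro e he s
  have h1 : e s * varWt m α s ≤ wt α e := by
    rw [wt_eq_sum]
    exact Finset.single_le_sum (f := fun s => e s * varWt m α s) (by simp) (Finset.mem_univ s)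
  have h2 : 1 ≤ varWt m α s := by rcases s with s | s <;> simp [varWt, hα]
  have h3 : wt α e < N := he
  simp
  nlinarith

theorem mul_mem_serFilt {α i j : ℕ} {f g : Ser m} (hf : f ∈ (serFilt m α).F i)
    (hg : g ∈ (serFilt m α).F j) : f * g ∈ (serFilt m α).F (i + j) := by
  classical
  intro e he
  change MvPowerSeries.coeff e (f * g) = 0
  rw [MvPowerSeries.coeff_mul]
  refine Finset.sum_eq_zero fun p hp => ?_
  have := Finset.HasAntidiagonal.mem_antidiagonal.1 hp
  have hw : wt α p.1 + wt α p.2 = wt α e := by rw [← wt_add, this]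
  by_cases h : wt α p.1 < i
  · rw [mem_serFilt.1 hf _ h, zero_mul]
  · rw [mem_serFilt.1 hg _ (by lia), mul_zero]

theorem pderiv_mem_serFilt {α n : ℕ} {f : Ser m} (hf : f ∈ (serFilt m α).F n) (s : Var m) :
    MvPowerSeries.pderiv ℂ s f ∈ (serFilt m α).F (n - varWt m α s) := by
  intro e he
  change MvPowerSeries.coeff e (MvPowerSeries.pderiv ℂ s f) = 0
  rw [MvPowerSeries.coeff_pderiv, mem_serFilt.1 hf, zero_mul]
  rw [wt_add, wt_single]
  lia

theorem pderiv_mul_mem_serFilt {α n p : ℕ} {f a : Ser m} {s : Var m}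
    (hf : f ∈ (serFilt m α).F n) (ha : a ∈ (serFilt m α).F (varWt m α s + p)) :
    MvPowerSeries.pderiv ℂ s f * a ∈ (serFilt m α).F (n + p) :=
  (serFilt m α).mem_of_le (by lia) (mul_mem_serFilt (pderiv_mem_serFilt hf s) ha)

/-! ### Derivations of the ring of power series -/

/-- The derivation `∑ aₛ ∂ₛ`. -/
def der : (Var m → Ser m) →ₗ[ℝ] Module.End ℝ (Ser m) where
  toFun a :=
    { toFun := fun f => ∑ s, MvPowerSeries.pderiv ℂ s f * a s
      map_add' := fun f g => by simp [add_mul, Finset.sum_add_distrib]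
      map_smul' := fun c f => by simp [Finset.smul_sum] }
  map_add' a b := by ext f : 1; simp [mul_add, Finset.sum_add_distrib]
  map_smul' c a := by ext f : 1; simp [Finset.smul_sum]

theorem der_apply (a : Var m → Ser m) (f : Ser m) :
    der a f = ∑ s, MvPowerSeries.pderiv ℂ s f * a s := rfl

theorem der_mul (a : Var m → Ser m) (f g : Ser m) :
    der a (f * g) = der a f * g + f * der a g := by
  simp only [der_apply, Derivation.leibniz, smul_eq_mul, Finset.sum_mul, Finset.mul_sum,
    ← Finset.sum_add_distrib]
  exact Finset.sum_congr rfl fun s _ => by ring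

theorem der_X (a : Var m → Ser m) (s : Var m) : der a (MvPowerSeries.X s) = a s := by
  classical
  rw [der_apply, Finset.sum_eq_single s]
  · simp [MvPowerSeries.pderiv_X_self]
  · intro t _ h
    rw [MvPowerSeries.pderiv_X_of_ne h.symm, zero_mul]
  · simp

theorem der_raises {α p : ℕ} {a : Var m → Ser m}
    (ha : ∀ s, a s ∈ (serFilt m α).F (varWt m α s + p)) :
    Raises (serFilt m α) (serFilt m α) p (der a) := fun _ _ hf =>
  der_apply a _ ▸ Submodule.sum_mem _ fun s _ => pderiv_mul_mem_serFilt hf (ha s)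

/-- The derivation of power series given by a vector field. -/
def vder : VF m →ₗ[ℝ] Module.End ℝ (Ser m) where
  toFun v := der (Sum.elim v 0)
  map_add' u v := by
    rw [← map_add]; congr 1; ext s : 1; rcases s with s | s <;> simp
  map_smul' c v := by
    rw [RingHom.id_apply, ← map_smul]; congr 1; ext s : 1; rcases s with s | s <;> simp

theorem vder_eq_der (v : VF m) : vder v = der (Sum.elim v 0) := rfl

theorem vder_apply (v : VF m) (f : Ser m) :
    vder v f = ∑ j : Fin 2, MvPowerSeries.pderiv ℂ (Sum.inl j) f * v j := by
  rw [vder_eq_der, der_apply, Fintype.sum_sum_type]; simp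

theorem vder_mul (v : VF m) (f g : Ser m) : vder v (f * g) = vder v f * g + f * vder v g :=
  der_mul _ f g

theorem vder_X_inl (v : VF m) (j : Fin 2) : vder v (MvPowerSeries.X (Sum.inl j)) = v j :=
  der_X _ _

theorem vder_X_inr (v : VF m) (l : Fin m) : vder v (MvPowerSeries.X (Sum.inr l)) = 0 :=
  der_X _ _

theorem vder_mem {α i j : ℕ} {v : VF m} {f : Ser m} (hv : v ∈ (vfFilt m α).F i)
    (hf : f ∈ (serFilt m α).F j) : vder v f ∈ (serFilt m α).F (i + j - 1) := by
  rw [vder_apply]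
  refine Submodule.sum_mem _ fun s _ => ?_
  refine (serFilt m α).mem_of_le ?_
    (mul_mem_serFilt (pderiv_mem_serFilt hf _) (mem_vfFilt.1 hv s))
  simp [varWt]
  lia

theorem vder_raises {α p : ℕ} {v : VF m} (hv : v ∈ (vfFilt m α).F (p + 1)) :
    Raises (serFilt m α) (serFilt m α) p (vder v) := fun n f hf =>
  (serFilt m α).mem_of_le (by lia) (vder_mem hv hf)

theorem bracket_apply (u v : VF m) (i : Fin 2) : bracket u v i = vder v (u i) - vder u (v i) := by
  rw [bracket, vder_apply, vder_apply, Finset.sum_sub_distrib]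

/-! ### The structure operators -/

/-- Multiplication by the imaginary unit. -/
def iOp : Module.End ℝ (Ser m) where
  toFun f := Complex.I • f
  map_add' := smul_add _
  map_smul' _ _ := smul_comm _ _ _

/-- The real structure: interchange of `z` and `w` combined with conjugation of coefficients. -/
def conjOp : Module.End ℝ (Ser m) where
  toFun f := fun e => conj (MvPowerSeries.coeff (swapExp e) f)
  map_add' f g := by
    ext e
    change conj (MvPowerSeries.coeff (swapExp e) (f + g)) =
      conj (MvPowerSeries.coeff (swapExp e) f) + conj (MvPowerSeries.coeff (swapExp e) g)
    simp
  map_smul' c f := by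
    ext e
    change conj (MvPowerSeries.coeff (swapExp e) (c • f)) =
      c • conj (MvPowerSeries.coeff (swapExp e) f)
    simp

/-- Restriction of a power series to `z = w = 0`. -/
def axisOp : Module.End ℝ (Ser m) where
  toFun f := fun e => if stateDeg e = 0 then MvPowerSeries.coeff e f else 0
  map_add' f g := by
    ext e
    change (if stateDeg e = 0 then MvPowerSeries.coeff e (f + g) else 0) =
      (if stateDeg e = 0 then MvPowerSeries.coeff e f else 0) +
      (if stateDeg e = 0 then MvPowerSeries.coeff e g else 0)
    split_ifs <;> simp
  map_smul' c f := by
    ext e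
    change (if stateDeg e = 0 then MvPowerSeries.coeff e (c • f) else 0) =
      c • (if stateDeg e = 0 then MvPowerSeries.coeff e f else 0)
    split_ifs <;> simp

/-- The charge of a monomial under rotations. -/
def charge (e : Expo m) : ℂ := (e (Sum.inl 0) : ℂ) - e (Sum.inl 1)

/-- The operator multiplying each monomial by its charge. -/
def chargeOp : Module.End ℝ (Ser m) where
  toFun f := fun e => charge e * MvPowerSeries.coeff e f
  map_add' f g := by
    ext e
    change charge e * MvPowerSeries.coeff e (f + g) =
      charge e * MvPowerSeries.coeff e f + charge e * MvPowerSeries.coeff e g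
    simp [mul_add]
  map_smul' c f := by
    ext e
    change charge e * MvPowerSeries.coeff e (c • f) = c • (charge e * MvPowerSeries.coeff e f)
    simp
    ring

theorem iOp_apply (f : Ser m) : iOp f = Complex.I • f := rfl

theorem coeff_conjOp (e : Expo m) (f : Ser m) :
    MvPowerSeries.coeff e (conjOp f) = conj (MvPowerSeries.coeff (swapExp e) f) := rfl

theorem coeff_axisOp (e : Expo m) (f : Ser m) : MvPowerSeries.coeff e (axisOp f) =
    if stateDeg e = 0 then MvPowerSeries.coeff e f else 0 := rfl

theorem coeff_chargeOp (e : Expo m) (f : Ser m) :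
    MvPowerSeries.coeff e (chargeOp f) = charge e * MvPowerSeries.coeff e f := rfl

theorem iOp_raises (α : ℕ) : Raises (serFilt m α) (serFilt m α) 0 iOp := fun n f hf e he => by
  change MvPowerSeries.coeff e (Complex.I • f) = 0
  rw [map_smul, mem_serFilt.1 hf e he, smul_zero]

theorem conjOp_raises (α : ℕ) : Raises (serFilt m α) (serFilt m α) 0 conjOp :=
  fun n f hf e he => by
    change conj (MvPowerSeries.coeff (swapExp e) f) = 0
    rw [mem_serFilt.1 hf _ (by rwa [wt_swapExp]), map_zero]

theorem axisOp_raises (α : ℕ) : Raises (serFilt m α) (serFilt m α) 0 axisOp :=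
  fun n f hf e he => by
    change (if stateDeg e = 0 then MvPowerSeries.coeff e f else 0) = 0
    rw [mem_serFilt.1 hf e he, ite_self]

theorem chargeOp_raises (α : ℕ) : Raises (serFilt m α) (serFilt m α) 0 chargeOp :=
  fun n f hf e he => by
    change charge e * MvPowerSeries.coeff e f = 0
    rw [mem_serFilt.1 hf e he, mul_zero]

theorem conjOp_conjOp (f : Ser m) : conjOp (conjOp f) = f := by
  ext e; simp [coeff_conjOp, swapExp_swapExp]

theorem conjOp_mul (f g : Ser m) : conjOp (f * g) = conjOp f * conjOp g := by
  classical
  ext e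
  rw [coeff_conjOp, MvPowerSeries.coeff_mul, MvPowerSeries.coeff_mul, map_sum]
  refine Finset.sum_bij' (fun p _ => (swapExp p.1, swapExp p.2))
    (fun p _ => (swapExp p.1, swapExp p.2)) ?_ ?_ ?_ ?_ ?_
  · intro p hp
    rw [Finset.HasAntidiagonal.mem_antidiagonal] at hp ⊢
    rw [← swapExp_add, hp, swapExp_swapExp]
  · intro p hp
    rw [Finset.HasAntidiagonal.mem_antidiagonal] at hp ⊢
    rw [← swapExp_add, hp]
  · intro p _; simp [swapExp_swapExp]
  · intro p _; simp [swapExp_swapExp]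
  · intro p _; simp [coeff_conjOp, swapExp_swapExp]

theorem axisOp_mul (f g : Ser m) : axisOp (f * g) = axisOp f * axisOp g := by
  classical
  ext e
  rw [coeff_axisOp, MvPowerSeries.coeff_mul, MvPowerSeries.coeff_mul]
  split_ifs with h
  · refine Finset.sum_congr rfl fun p hp => ?_
    rw [Finset.HasAntidiagonal.mem_antidiagonal] at hp
    have : stateDeg p.1 + stateDeg p.2 = 0 := by rw [← stateDeg_add, hp, h]
    rw [coeff_axisOp, coeff_axisOp, if_pos (by lia), if_pos (by lia)]
  · symm
    refine Finset.sum_eq_zero fun p hp => ?_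
    rw [Finset.HasAntidiagonal.mem_antidiagonal] at hp
    have : stateDeg p.1 + stateDeg p.2 ≠ 0 := by rwa [← stateDeg_add, hp]
    rw [coeff_axisOp, coeff_axisOp]
    by_cases h1 : stateDeg p.1 = 0
    · rw [if_neg (show stateDeg p.2 ≠ 0 by lia), mul_zero]
    · rw [if_neg h1, zero_mul]

theorem charge_add (e e' : Expo m) : charge (e + e') = charge e + charge e' := by
  simp only [charge, Finsupp.add_apply, Nat.cast_add]; ring

theorem chargeOp_mul (f g : Ser m) : chargeOp (f * g) = chargeOp f * g + f * chargeOp g := by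
  classical
  ext e
  rw [coeff_chargeOp, map_add, MvPowerSeries.coeff_mul, MvPowerSeries.coeff_mul,
    MvPowerSeries.coeff_mul, Finset.mul_sum, ← Finset.sum_add_distrib]
  refine Finset.sum_congr rfl fun p hp => ?_
  rw [Finset.HasAntidiagonal.mem_antidiagonal] at hp
  rw [coeff_chargeOp, coeff_chargeOp, ← hp, charge_add]
  ring

/-! ### Density of polynomials -/

theorem exists_poly_sub_mem (hα : 1 ≤ α) (f : Ser m) (N : ℕ) :
    ∃ p : MvPolynomial (Var m) ℂ, f - (p : Ser m) ∈ (serFilt m α).F N := by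
  classical
  refine ⟨∑ e ∈ (finite_wt_lt hα N).toFinset,
    MvPolynomial.monomial e (MvPowerSeries.coeff e f), fun e he => ?_⟩
  change MvPowerSeries.coeff e _ = 0
  rw [map_sub, MvPolynomial.coeff_coe, MvPolynomial.coeff_sum]
  simp [MvPolynomial.coeff_monomial, he]

/-- Two filtered operators agree if they agree on the scalars and if agreement is inherited by
products with variables. -/
theorem end_ext (hα : 1 ≤ α) {K L : Module.End ℝ (Ser m)}
    (hK : Raises (serFilt m α) (serFilt m α) 0 K) (hL : Raises (serFilt m α) (serFilt m α) 0 L)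
    (hC : ∀ c : ℂ, K (MvPowerSeries.C c) = L (MvPowerSeries.C c))
    (hX : ∀ f s, K f = L f → K (f * MvPowerSeries.X s) = L (f * MvPowerSeries.X s)) : K = L := by
  have hp : ∀ p : MvPolynomial (Var m) ℂ, K (p : Ser m) = L (p : Ser m) := by
    intro p
    induction p using MvPolynomial.induction_on with
    | C a => rw [MvPolynomial.coe_C]; exact hC a
    | add p q hp hq => rw [MvPolynomial.coe_add, map_add, map_add, hp, hq]
    | mul_X p s hp => rw [MvPolynomial.coe_mul, MvPolynomial.coe_X]; exact hX _ _ hp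
  ext1 f
  refine (serFilt m α).eq_of_forall_sub_mem fun N => ?_
  obtain ⟨p, hp'⟩ := exists_poly_sub_mem hα f N
  have := Submodule.sub_mem _ (hK _ _ hp') (hL _ _ hp')
  rw [map_sub, map_sub, hp p, sub_sub_sub_cancel_right] at this
  exact this

theorem C_eq (c : ℂ) : (MvPowerSeries.C c : Ser m) = c.re • 1 + c.im • iOp 1 := by
  classical
  ext e
  have h : MvPowerSeries.coeff e (c.re • (1 : Ser m) + c.im • iOp 1) =
      c.re • MvPowerSeries.coeff e (1 : Ser m) +
        c.im • (Complex.I • MvPowerSeries.coeff e (1 : Ser m)) := rfl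
  rw [h, MvPowerSeries.coeff_C, MvPowerSeries.coeff_one]
  split_ifs
  · simp
  · simp

theorem leibniz_one {δ : Module.End ℝ (Ser m)} (h : ∀ f g, δ (f * g) = δ f * g + f * δ g) :
    δ 1 = 0 := by
  have := h 1 1
  simpa using this

theorem leibniz_C {δ : Module.End ℝ (Ser m)} (h : ∀ f g, δ (f * g) = δ f * g + f * δ g)
    (hi : Commute δ iOp) (c : ℂ) : δ (MvPowerSeries.C c) = 0 := by
  have h1 : δ (iOp 1) = iOp (δ 1) := LinearMap.congr_fun hi.eq 1
  rw [C_eq, map_add, map_smul, map_smul, h1, leibniz_one h]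
  simp

/-- A filtered complex derivation is determined by its values on the variables. -/
theorem leibniz_ext (hα : 1 ≤ α) {δ ε : Module.End ℝ (Ser m)}
    (hδ : Raises (serFilt m α) (serFilt m α) 0 δ) (hε : Raises (serFilt m α) (serFilt m α) 0 ε)
    (h : ∀ f g, δ (f * g) = δ f * g + f * δ g) (h' : ∀ f g, ε (f * g) = ε f * g + f * ε g)
    (hi : Commute δ iOp) (hi' : Commute ε iOp)
    (hX : ∀ s, δ (MvPowerSeries.X s) = ε (MvPowerSeries.X s)) : δ = ε :=
  end_ext hα hδ hε (fun c => by rw [leibniz_C h hi, leibniz_C h' hi'])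
    (fun f s hf => by rw [h, h', hX, hf])

theorem der_commute_iOp (a : Var m → Ser m) : Commute (der a) iOp := by
  refine LinearMap.ext fun f => ?_
  change der a (iOp f) = iOp (der a f)
  simp [iOp_apply, der_apply, Finset.smul_sum]

theorem X_mem_serFilt (s : Var m) : (MvPowerSeries.X s : Ser m) ∈ (serFilt m α).F (varWt m α s) := by
  classical
  intro e he
  change MvPowerSeries.coeff e (MvPowerSeries.X s) = 0
  rw [MvPowerSeries.coeff_X, if_neg]
  rintro rfl
  rw [wt_single] at he
  exact lt_irrefl _ he

theorem leibniz_eq_der (hα : 1 ≤ α) {δ : Module.End ℝ (Ser m)}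
    (hδ : Raises (serFilt m α) (serFilt m α) 0 δ)
    (h : ∀ f g, δ (f * g) = δ f * g + f * δ g) (hi : Commute δ iOp) :
    δ = der fun s => δ (MvPowerSeries.X s) := by
  refine leibniz_ext hα hδ (der_raises fun s => ?_) h (der_mul _) hi (der_commute_iOp _)
    fun s => (der_X (fun s => δ (MvPowerSeries.X s)) s).symm
  exact hδ _ _ (X_mem_serFilt s)

/-! ### Structure operators on the variables -/

theorem conjOp_C (c : ℂ) : conjOp (MvPowerSeries.C c : Ser m) = MvPowerSeries.C (conj c) := by
  classical
  ext e
  rw [coeff_conjOp, MvPowerSeries.coeff_C, MvPowerSeries.coeff_C]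
  have : swapExp e = 0 ↔ e = 0 := by
    constructor
    · intro h
      rw [← swapExp_swapExp e, h]
      ext s; rcases s with s | s
      · fin_cases s <;> simp [swapExp_inl_zero, swapExp_inl_one]
      · simp [swapExp_inr]
    · rintro rfl
      ext s; rcases s with s | s
      · fin_cases s <;> simp [swapExp_inl_zero, swapExp_inl_one]
      · simp [swapExp_inr]
  simp only [this]
  split_ifs <;> simp

theorem conjOp_one : conjOp (1 : Ser m) = 1 := by
  have := conjOp_C (m := m) 1
  simpa using this

/-- Interchange of the variables `z` and `w`. -/
def swapVar : Var m → Var m := Equiv.sumCongr (Equiv.swap (0 : Fin 2) 1) (Equiv.refl (Fin m))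

theorem swapExp_single (s : Var m) (n : ℕ) :
    swapExp (Finsupp.single s n) = Finsupp.single (swapVar s) n := by
  rw [swapExp, Finsupp.equivMapDomain_single]; rfl

theorem swapVar_swapVar (s : Var m) : swapVar (swapVar s) = s := by
  rcases s with s | s <;> simp [swapVar]

theorem conjOp_X (s : Var m) : conjOp (MvPowerSeries.X s : Ser m) = MvPowerSeries.X (swapVar s) := by
  classical
  ext e
  rw [coeff_conjOp, MvPowerSeries.coeff_X, MvPowerSeries.coeff_X]
  have : swapExp e = Finsupp.single s 1 ↔ e = Finsupp.single (swapVar s) 1 := by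
    constructor
    · intro h; rw [← swapExp_swapExp e, h, swapExp_single]
    · rintro rfl; rw [swapExp_single, swapVar_swapVar]
  simp only [this]
  split_ifs <;> simp

theorem axisOp_C (c : ℂ) : axisOp (MvPowerSeries.C c : Ser m) = MvPowerSeries.C c := by
  classical
  ext e
  rw [coeff_axisOp, MvPowerSeries.coeff_C]
  split_ifs with h1 h2 h2
  · rfl
  · rfl
  · subst h2; simp [stateDeg] at h1
  · rfl

theorem axisOp_X_inl (j : Fin 2) : axisOp (MvPowerSeries.X (Sum.inl j) : Ser m) = 0 := by
  classical
  ext e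
  rw [coeff_axisOp, MvPowerSeries.coeff_X]
  split_ifs with h1 h2
  · subst h2; fin_cases j <;> simp [stateDeg] at h1
  · simp
  · simp

theorem axisOp_X_inr (l : Fin m) :
    axisOp (MvPowerSeries.X (Sum.inr l) : Ser m) = MvPowerSeries.X (Sum.inr l) := by
  classical
  ext e
  rw [coeff_axisOp, MvPowerSeries.coeff_X]
  split_ifs with h1 h2 h2
  · rfl
  · rfl
  · subst h2; simp [stateDeg] at h1
  · rfl

/-- The charge of a variable. -/
def varCharge (m : ℕ) : Var m → ℂ := Sum.elim ![1, -1] 0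

theorem charge_single (s : Var m) : charge (Finsupp.single s 1) = varCharge m s := by
  rcases s with s | s
  · fin_cases s <;> simp [charge, varCharge]
  · simp [charge, varCharge]

theorem chargeOp_X (s : Var m) :
    chargeOp (MvPowerSeries.X s : Ser m) = varCharge m s • MvPowerSeries.X s := by
  classical
  ext e
  rw [coeff_chargeOp, map_smul, MvPowerSeries.coeff_X]
  split_ifs with h
  · subst h; rw [charge_single]; simp
  · simp

theorem chargeOp_commute_iOp : Commute (chargeOp : Module.End ℝ (Ser m)) iOp := by
  refine LinearMap.ext fun f => ?_
  ext e
  change MvPowerSeries.coeff e (chargeOp (iOp f)) = MvPowerSeries.coeff e (iOp (chargeOp f))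
  simp only [coeff_chargeOp, iOp_apply, map_smul, smul_eq_mul]
  ring

/-- The charge operator is the derivation along the linear rotation field, so commuting with it
expresses equivariance under rotations of z. -/
theorem chargeOp_eq_vder (hα : 1 ≤ α) : (chargeOp : Module.End ℝ (Ser m)) =
    vder ![MvPowerSeries.X (Sum.inl 0), -MvPowerSeries.X (Sum.inl 1)] := by
  refine leibniz_ext (α := α) hα (chargeOp_raises α) (vder_raises ?_) chargeOp_mul (vder_mul _)
    chargeOp_commute_iOp (der_commute_iOp _) ?_
  · rw [mem_vfFilt]
    intro i
    fin_cases i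
    · exact X_mem_serFilt (α := α) (Sum.inl 0)
    · exact Submodule.neg_mem _ (X_mem_serFilt (α := α) (Sum.inl 1))
  · rintro (s | s)
    · rw [chargeOp_X, vder_X_inl]
      fin_cases s <;> simp [varCharge]
    · rw [chargeOp_X, vder_X_inr]; simp [varCharge]

/-! ### Operators compatible with the structure -/

/-- Compatibility with complex scalars and with the real structure. -/
structure IsReal (K : Module.End ℝ (Ser m)) : Prop where
  commI : Commute K iOp
  commConj : Commute K conjOp

/-- Compatibility with complex scalars, with the real structure and with restriction to
`z = w = 0`. -/
structure IsStruct (K : Module.End ℝ (Ser m)) : Prop extends IsReal K where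
  commAxis : Commute K axisOp

theorem IsReal.mul {K L : Module.End ℝ (Ser m)} (hK : IsReal K) (hL : IsReal L) :
    IsReal (K * L) :=
  ⟨hK.commI.mul_left hL.commI, hK.commConj.mul_left hL.commConj⟩

theorem IsReal.sub {K L : Module.End ℝ (Ser m)} (hK : IsReal K) (hL : IsReal L) :
    IsReal (K - L) :=
  ⟨hK.commI.sub_left hL.commI, hK.commConj.sub_left hL.commConj⟩

theorem IsReal.add {K L : Module.End ℝ (Ser m)} (hK : IsReal K) (hL : IsReal L) :
    IsReal (K + L) :=
  ⟨hK.commI.add_left hL.commI, hK.commConj.add_left hL.commConj⟩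

theorem IsReal.ser {K : Module.End ℝ (Ser m)} (hK : Raises (serFilt m α) (serFilt m α) 1 K)
    (h : IsReal K) (a : PowerSeries ℝ) : IsReal (ser (serFilt m α) hK a) :=
  ⟨commute_of_limit hK a (iOp_raises α) h.commI, commute_of_limit hK a (conjOp_raises α) h.commConj⟩

theorem IsStruct.one : IsStruct (1 : Module.End ℝ (Ser m)) :=
  ⟨⟨Commute.one_left _, Commute.one_left _⟩, Commute.one_left _⟩

theorem IsStruct.mul {K L : Module.End ℝ (Ser m)} (hK : IsStruct K) (hL : IsStruct L) :
    IsStruct (K * L) :=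
  ⟨hK.toIsReal.mul hL.toIsReal, hK.commAxis.mul_left hL.commAxis⟩

theorem IsStruct.sub {K L : Module.End ℝ (Ser m)} (hK : IsStruct K) (hL : IsStruct L) :
    IsStruct (K - L) :=
  ⟨hK.toIsReal.sub hL.toIsReal, hK.commAxis.sub_left hL.commAxis⟩

theorem IsStruct.ser {K : Module.End ℝ (Ser m)} (hK : Raises (serFilt m α) (serFilt m α) 1 K)
    (h : IsStruct K) (a : PowerSeries ℝ) : IsStruct (ser (serFilt m α) hK a) :=
  ⟨h.toIsReal.ser hK a, commute_of_limit hK a (axisOp_raises α) h.commAxis⟩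

theorem commute_apply {K L : Module.End ℝ (Ser m)} (h : Commute K L) (f : Ser m) :
    K (L f) = L (K f) := LinearMap.congr_fun h.eq f

theorem commute_of_tends {A : ℕ → Module.End ℝ (Ser m)} {B ρ : Module.End ℝ (Ser m)}
    (hρ : Raises (serFilt m α) (serFilt m α) 0 ρ)
    (hB : ∀ f, Tends (serFilt m α) (fun n => A n f) (B f)) (h : ∀ n, Commute (A n) ρ) :
    Commute B ρ := by
  refine LinearMap.ext fun f => (hB (ρ f)).unique ?_
  change Tends _ _ (ρ (B f))
  simp only [commute_apply (h _)]
  exact (hB f).map hρ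

/-! ### Derivations compatible with the structure -/

theorem der_C (a : Var m → Ser m) (c : ℂ) : der a (MvPowerSeries.C c) = 0 :=
  leibniz_C (der_mul a) (der_commute_iOp a) c

theorem der_commute_conjOp (hα : 1 ≤ α) {a : Var m → Ser m}
    (ha : ∀ s, a s ∈ (serFilt m α).F (varWt m α s))
    (h : ∀ s, conjOp (a s) = a (swapVar s)) : Commute (der a) conjOp := by
  have hr : Raises (serFilt m α) (serFilt m α) 0 (der a) := der_raises ha
  refine end_ext (α := α) hα (hr.mul (conjOp_raises α)) ((conjOp_raises α).mul hr) ?_ ?_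
  · intro c
    rw [Module.End.mul_apply, Module.End.mul_apply, conjOp_C, der_C, der_C, map_zero]
  · intro f s hf
    rw [Module.End.mul_apply, Module.End.mul_apply] at hf ⊢
    rw [conjOp_mul, der_mul, der_mul, map_add, conjOp_mul, conjOp_mul, hf, conjOp_X, der_X,
      der_X, h]

theorem der_commute_axisOp (hα : 1 ≤ α) {a : Var m → Ser m}
    (ha : ∀ s, a s ∈ (serFilt m α).F (varWt m α s))
    (h0 : ∀ j, axisOp (a (Sum.inl j)) = 0) (h1 : ∀ l, axisOp (a (Sum.inr l)) = a (Sum.inr l)) :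
    Commute (der a) axisOp := by
  have hr : Raises (serFilt m α) (serFilt m α) 0 (der a) := der_raises ha
  refine end_ext (α := α) hα (hr.mul (axisOp_raises α)) ((axisOp_raises α).mul hr) ?_ ?_
  · intro c
    rw [Module.End.mul_apply, Module.End.mul_apply, axisOp_C, der_C, map_zero]
  · intro f s hf
    rw [Module.End.mul_apply, Module.End.mul_apply] at hf ⊢
    rw [axisOp_mul, der_mul, der_mul, map_add, axisOp_mul, axisOp_mul, hf, der_X]
    rcases s with s | s
    · rw [axisOp_X_inl, h0, map_zero]
    · rw [axisOp_X_inr, h1, der_X]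

theorem chargeOp_C (c : ℂ) : chargeOp (MvPowerSeries.C c : Ser m) = 0 :=
  leibniz_C chargeOp_mul chargeOp_commute_iOp c

theorem der_commute_chargeOp (hα : 1 ≤ α) {a : Var m → Ser m}
    (ha : ∀ s, a s ∈ (serFilt m α).F (varWt m α s))
    (h : ∀ s, chargeOp (a s) = varCharge m s • a s) : Commute (der a) chargeOp := by
  have hr : Raises (serFilt m α) (serFilt m α) 0 (der a) := der_raises ha
  refine end_ext (α := α) hα (hr.mul (chargeOp_raises α)) ((chargeOp_raises α).mul hr) ?_ ?_
  · intro c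
    rw [Module.End.mul_apply, Module.End.mul_apply, chargeOp_C, der_C, map_zero, map_zero]
  · intro f s hf
    rw [Module.End.mul_apply, Module.End.mul_apply] at hf ⊢
    have hs : der a (varCharge m s • MvPowerSeries.X s) = varCharge m s • a s := by
      have : der a (varCharge m s • MvPowerSeries.X s) =
          varCharge m s • der a (MvPowerSeries.X s) := by
        simp [der_apply, Finset.smul_sum]
      rw [this, der_X]
    rw [chargeOp_mul, map_add, der_mul, der_mul, der_mul, map_add, chargeOp_mul, chargeOp_mul, hf,
      chargeOp_X, der_X, hs, h]
    ring

/-- A field has no component in the parameter directions and therefore kills every series in μ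
alone. -/
theorem vder_axisOp (hα : 1 ≤ α) {v : VF m} (hv : v ∈ (vfFilt m α).F 1) (f : Ser m) :
    vder v (axisOp f) = 0 := by
  have h : vder v * axisOp = 0 := by
    refine end_ext (α := α) hα ((vder_raises (p := 0) hv).mul (axisOp_raises α))
      (fun n x _ => Submodule.zero_mem _) ?_ ?_
    · intro c
      rw [Module.End.mul_apply, axisOp_C, vder_eq_der, der_C]; rfl
    · intro f s hf
      rw [Module.End.mul_apply, LinearMap.zero_apply] at hf ⊢
      rw [axisOp_mul, vder_mul, hf]
      rcases s with s | s
      · rw [axisOp_X_inl]; simp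
      · rw [axisOp_X_inr, vder_X_inr]; simp
  exact LinearMap.congr_fun h f

theorem axisOp_commute_conjOp : Commute (axisOp : Module.End ℝ (Ser m)) conjOp := by
  refine LinearMap.ext fun f => MvPowerSeries.ext fun e => ?_
  change MvPowerSeries.coeff e (axisOp (conjOp f)) = MvPowerSeries.coeff e (conjOp (axisOp f))
  rw [coeff_axisOp, coeff_conjOp, coeff_conjOp, coeff_axisOp, stateDeg_swapExp]
  split_ifs <;> simp

/-! ### Characterizations of the spaces -/

/-- The exponent of the monomial `w`. -/
def wExp (m : ℕ) : Expo m := Finsupp.single (Sum.inl 1) 1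

theorem wt_zExp : wt α (zExp m) = 1 := by
  rw [zExp, wt_single]; rfl

theorem wt_wExp : wt α (wExp m) = 1 := by
  rw [wExp, wt_single]; rfl

/-- Among exponents of positive state degree only z and w have total degree below two, and z is
admitted separately. -/
theorem admissible_iff (e : Expo m) :
    Admissible e ↔ 1 ≤ stateDeg e ∧ e ≠ wExp m := by
  constructor
  · rintro ⟨h1, h2⟩
    refine ⟨h1, ?_⟩
    rintro rfl
    rcases h2 with h2 | h2
    · simp [stateDeg, paramDeg, wExp] at h2
    · have := DFunLike.congr_fun h2 (Sum.inl 0)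
      simp [wExp, zExp] at this
  · rintro ⟨h1, h2⟩
    refine ⟨h1, ?_⟩
    by_contra! h
    have hp : paramDeg e = 0 := by lia
    have hs : stateDeg e = 1 := by lia
    have hp' : ∀ l, e (Sum.inr l) = 0 := by
      intro l
      rw [paramDeg, Finset.sum_eq_zero_iff] at hp
      exact hp l (Finset.mem_univ l)
    rw [stateDeg] at hs
    rcases Nat.eq_zero_or_pos (e (Sum.inl 0)) with h0 | h0
    · refine h2 (Finsupp.ext fun s => ?_)
      rcases s with s | s
      · fin_cases s
        · simpa [wExp] using h0
        · simp [wExp]; lia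
      · simpa [wExp] using hp' s
    · refine h.2 (Finsupp.ext fun s => ?_)
      rcases s with s | s
      · fin_cases s
        · simp [zExp]; lia
        · simp [zExp]; lia
      · simpa [zExp] using hp' s

theorem axisOp_eq_zero_iff (f : Ser m) :
    axisOp f = 0 ↔ ∀ e, stateDeg e = 0 → MvPowerSeries.coeff e f = 0 := by
  constructor
  · intro h e he
    have := congrArg (MvPowerSeries.coeff e) h
    rwa [coeff_axisOp, if_pos he] at this
  · intro h
    ext e
    rw [coeff_axisOp]
    split_ifs with he
    · rw [h e he]; simp
    · simp

theorem axisOp_eq_self_iff (f : Ser m) :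
    axisOp f = f ↔ ∀ e, stateDeg e ≠ 0 → MvPowerSeries.coeff e f = 0 := by
  constructor
  · intro h e he
    rw [← h, coeff_axisOp, if_neg he]
  · intro h
    ext e
    rw [coeff_axisOp]
    split_ifs with he
    · rfl
    · rw [h e he]

/-- Expressed through the structure operators, membership can be verified for a transformed field by
commuting these operators past the transformation. -/
theorem mem_stateSpace_iff (v : VF m) : v ∈ stateSpace m ↔ v 1 = conjOp (v 0) ∧
    axisOp (v 0) = 0 ∧ MvPowerSeries.coeff (wExp m) (v 0) = 0 ∧
    (MvPowerSeries.coeff (zExp m) (v 0)).re = 0 := by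
  constructor
  · rintro ⟨h1, h2, h3⟩
    refine ⟨MvPowerSeries.ext h1, ?_, ?_, h3⟩
    · rw [axisOp_eq_zero_iff]
      intro e he
      by_contra hne
      have := (h2 e hne).1
      lia
    · by_contra hne
      exact ((admissible_iff _).1 (h2 _ hne)).2 rfl
  · rintro ⟨h1, h2, h3, h4⟩
    refine ⟨fun e => by rw [h1]; rfl, fun e he => ?_, h4⟩
    rw [axisOp_eq_zero_iff] at h2
    rw [admissible_iff]
    refine ⟨?_, ?_⟩
    · by_contra h
      exact he (h2 e (by lia))
    · rintro rfl
      exact he h3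

theorem mem_stateSpace_of_mem_two {v : VF m} (h : v ∈ (vfFilt m α).F 2) (h1 : v 1 = conjOp (v 0))
    (h2 : axisOp (v 0) = 0) : v ∈ stateSpace m := by
  rw [mem_stateSpace_iff]
  refine ⟨h1, h2, ?_, ?_⟩
  · exact mem_vfFilt.1 h 0 _ (by rw [wt_wExp]; lia)
  · have : MvPowerSeries.coeff (zExp m) (v 0) = 0 := mem_vfFilt.1 h 0 _ (by rw [wt_zExp]; lia)
    rw [this, Complex.zero_re]

theorem axisOp_of_mem_stateSpace {v : VF m} (hv : v ∈ stateSpace m) (i : Fin 2) :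
    axisOp (v i) = 0 := by
  rw [mem_stateSpace_iff] at hv
  fin_cases i
  · exact hv.2.1
  · change axisOp (v 1) = 0
    rw [hv.1, commute_apply axisOp_commute_conjOp, hv.2.1, map_zero]

theorem conjOp_of_mem_stateSpace {v : VF m} (hv : v ∈ stateSpace m) (s : Var m) :
    conjOp (Sum.elim v 0 s : Ser m) = Sum.elim v 0 (swapVar s) := by
  rw [mem_stateSpace_iff] at hv
  rcases s with s | s
  · fin_cases s
    · simp [swapVar, hv.1]
    · simp [swapVar, hv.1, conjOp_conjOp]
  · change conjOp 0 = 0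
    exact map_zero _

theorem stateSpace_le_vfFilt {v : VF m} (hv : v ∈ stateSpace m) : v ∈ (vfFilt m α).F 1 := by
  rw [mem_vfFilt]
  intro i e he
  have h := axisOp_of_mem_stateSpace hv i
  rw [axisOp_eq_zero_iff] at h
  refine h e ?_
  simp only [wt] at he
  lia

theorem mem_stateFilt_iff {p : ℕ} {v : VF m} :
    v ∈ stateFilt α (p : ℤ) ↔ v ∈ stateSpace m ∧ v ∈ (vfFilt m α).F (p + 1) := by
  constructor
  · rintro ⟨h, h'⟩
    exact ⟨h, mem_vfFilt.2 fun i e he => h' i e (by lia)⟩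
  · rintro ⟨h, h'⟩
    exact ⟨h, fun i e he => mem_vfFilt.1 h' i e (by lia)⟩

theorem vder_isStruct (hα : 1 ≤ α) {v : VF m} (hv : v ∈ stateSpace m) : IsStruct (vder v) := by
  have hr : ∀ s, (Sum.elim v 0 s : Ser m) ∈ (serFilt m α).F (varWt m α s) := by
    rintro (s | s)
    · exact mem_vfFilt.1 (stateSpace_le_vfFilt hv) s
    · exact Submodule.zero_mem _
  refine ⟨⟨der_commute_iOp _, der_commute_conjOp hα hr (conjOp_of_mem_stateSpace hv)⟩,
    der_commute_axisOp hα hr (axisOp_of_mem_stateSpace hv) fun l => ?_⟩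
  change axisOp 0 = 0
  simp

theorem axisOp_vder (hα : 1 ≤ α) {v : VF m} (hv : v ∈ stateSpace m) (f : Ser m) :
    axisOp (vder v f) = 0 := by
  rw [← commute_apply (vder_isStruct hα hv).commAxis,
    vder_axisOp hα (stateSpace_le_vfFilt hv)]

/-! ### Time and parameter spaces -/

theorem conjOp_eq_self_iff_of_axis {f : Ser m} (hf : axisOp f = f) :
    conjOp f = f ↔ ∀ e, (MvPowerSeries.coeff e f).im = 0 := by
  rw [axisOp_eq_self_iff] at hf
  have hswap : ∀ e : Expo m, stateDeg e = 0 → swapExp e = e := by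
    intro e he
    rw [stateDeg] at he
    ext s
    rcases s with s | s
    · fin_cases s
      · exact (swapExp_inl_zero e).trans (by lia)
      · exact (swapExp_inl_one e).trans (by lia)
    · rfl
  constructor
  · intro h e
    by_cases he : stateDeg e = 0
    · have := congrArg (MvPowerSeries.coeff e) h
      rw [coeff_conjOp, hswap e he] at this
      exact Complex.conj_eq_iff_im.1 this
    · rw [hf e he, Complex.zero_im]
  · intro h
    ext e
    rw [coeff_conjOp]
    by_cases he : stateDeg e = 0
    · rw [hswap e he]
      exact Complex.conj_eq_iff_im.2 (h e)
    · rw [hf e he, hf _ (by rwa [stateDeg_swapExp]), map_zero]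

theorem mem_paramFilt_iff {p : ℕ} {P : Fin m → Ser m} : P ∈ paramFilt α (p : ℤ) ↔
    ∀ l, conjOp (P l) = P l ∧ axisOp (P l) = P l ∧ P l ∈ (serFilt m α).F (α + p) := by
  constructor
  · intro h l
    have ha : axisOp (P l) = P l := (axisOp_eq_self_iff _).2 fun e he => (h l e).2.1 he
    exact ⟨(conjOp_eq_self_iff_of_axis ha).2 fun e => (h l e).1, ha,
      fun e he => (h l e).2.2 (by lia)⟩
  · intro h l e
    exact ⟨(conjOp_eq_self_iff_of_axis (h l).2.1).1 (h l).1 e,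
      (axisOp_eq_self_iff _).1 (h l).2.1 e, fun he => (h l).2.2 e (by lia)⟩

theorem charge_eq_zero_iff (e : Expo m) : charge e = 0 ↔ e (Sum.inl 0) = e (Sum.inl 1) := by
  rw [charge, sub_eq_zero, Nat.cast_inj]

theorem chargeOp_eq_zero_iff (f : Ser m) : chargeOp f = 0 ↔
    ∀ e : Expo m, e (Sum.inl 0) ≠ e (Sum.inl 1) → MvPowerSeries.coeff e f = 0 := by
  constructor
  · intro h e he
    have := congrArg (MvPowerSeries.coeff e) h
    rw [coeff_chargeOp, MvPowerSeries.coeff_zero, mul_eq_zero, charge_eq_zero_iff] at this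
    exact this.resolve_left he
  · intro h
    ext e
    rw [coeff_chargeOp, MvPowerSeries.coeff_zero, mul_eq_zero, charge_eq_zero_iff]
    by_cases he : e (Sum.inl 0) = e (Sum.inl 1)
    · exact Or.inl he
    · exact Or.inr (h e he)

theorem mem_timeFilt_iff {p : ℕ} {f : Ser m} : f ∈ timeFilt α (p : ℤ) ↔
    conjOp f = f ∧ chargeOp f = 0 ∧ f ∈ (serFilt m α).F p := by
  have hswap : ∀ e : Expo m, e (Sum.inl 0) = e (Sum.inl 1) → swapExp e = e := by
    intro e he
    ext s
    rcases s with s | s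
    · fin_cases s
      · exact (swapExp_inl_zero e).trans he.symm
      · exact (swapExp_inl_one e).trans he
    · rfl
  constructor
  · intro h
    refine ⟨?_, (chargeOp_eq_zero_iff f).2 fun e he => (h e).2.1 he,
      fun e he => (h e).2.2 (by lia)⟩
    ext e
    rw [coeff_conjOp]
    by_cases he : e (Sum.inl 0) = e (Sum.inl 1)
    · rw [hswap e he]
      exact Complex.conj_eq_iff_im.2 (h e).1
    · rw [(h e).2.1 he, (h (swapExp e)).2.1 (by
        rw [swapExp_inl_zero, swapExp_inl_one]; exact fun h' => he h'.symm), map_zero]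
  · rintro ⟨h1, h2, h3⟩ e
    rw [chargeOp_eq_zero_iff] at h2
    refine ⟨?_, h2 e, fun he => h3 e (by lia)⟩
    by_cases he : e (Sum.inl 0) = e (Sum.inl 1)
    · have := congrArg (MvPowerSeries.coeff e) h1
      rw [coeff_conjOp, hswap e he] at this
      exact Complex.conj_eq_iff_im.1 this
    · rw [h2 e he, Complex.zero_im]

/-! ### The group of transformations and its Lie algebra -/

/-- A unipotent automorphism `B` of the ring of power series together with the operator
`A f = g * B f`, compatible with the structure operators. -/
structure GPair (m α : ℕ) (A B : Module.End ℝ (Ser m)) : Prop where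
  unipA : Raises (serFilt m α) (serFilt m α) 1 (A - 1)
  unipB : Raises (serFilt m α) (serFilt m α) 1 (B - 1)
  mulB : ∀ f g, B (f * g) = B f * B g
  mulA : ∀ f g, A (f * g) = A f * B g
  -- Compatibility with `axisOp` is demanded of `B` only: the unit `A 1` may involve z and w.
  realA : IsReal A
  structB : IsStruct B

/-- The infinitesimal version of `GPair`: a derivation `b` and the operator `a f = b f + t * f`. -/
structure LPair (m α : ℕ) (a b : Module.End ℝ (Ser m)) : Prop where
  raisesA : Raises (serFilt m α) (serFilt m α) 1 a
  raisesB : Raises (serFilt m α) (serFilt m α) 1 b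
  leibB : ∀ f g, b (f * g) = b f * g + f * b g
  leibA : ∀ f g, a (f * g) = a f * g + f * b g
  realA : IsReal a
  structB : IsStruct b

theorem mul_filtered (i j : ℕ) (f g : Ser m) (hf : f ∈ (serFilt m α).F i)
    (hg : g ∈ (serFilt m α).F j) :
    LinearMap.mul ℝ (Ser m) f g ∈ (serFilt m α).F (i + j - 0) := mul_mem_serFilt hf hg

theorem LPair.exp {a b : Module.End ℝ (Ser m)} (h : LPair m α a b) :
    GPair m α (expOp (serFilt m α) h.raisesA) (expOp (serFilt m α) h.raisesB) where
  unipA := expOp_sub_one_raises _ h.raisesA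
  unipB := expOp_sub_one_raises _ h.raisesB
  mulB f g := expOp_bilin (LinearMap.mul ℝ (Ser m)) mul_filtered h.raisesB h.raisesB h.raisesB
    h.leibB f g
  mulA f g := expOp_bilin (LinearMap.mul ℝ (Ser m)) mul_filtered h.raisesA h.raisesB h.raisesA
    h.leibA f g
  realA := h.realA.ser _ _
  structB := h.structB.ser _ _

/-- Together with `expOp_logOp` this makes the exponential surjective onto the group, so an
arbitrary composite of near-identity maps has a logarithm in the Lie algebra without recourse to the
Baker–Campbell–Hausdorff formula. -/
theorem GPair.log {A B : Module.End ℝ (Ser m)} (h : GPair m α A B) :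
    LPair m α (logOp (serFilt m α) h.unipA) (logOp (serFilt m α) h.unipB) where
  raisesA := logOp_raises _
  raisesB := logOp_raises _
  leibB f g := logOp_bilin (LinearMap.mul ℝ (Ser m)) mul_filtered h.unipB h.unipB h.unipB
    h.mulB f g
  leibA f g := logOp_bilin (LinearMap.mul ℝ (Ser m)) mul_filtered h.unipA h.unipB h.unipA
    h.mulA f g
  realA := (h.realA.sub IsStruct.one.toIsReal).ser _ _
  structB := (h.structB.sub IsStruct.one).ser _ _

theorem GPair.one : GPair m α 1 1 where
  unipA := by rw [sub_self]; exact fun _ _ _ => Submodule.zero_mem _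
  unipB := by rw [sub_self]; exact fun _ _ _ => Submodule.zero_mem _
  mulB _ _ := rfl
  mulA _ _ := rfl
  realA := IsStruct.one.toIsReal
  structB := IsStruct.one

theorem unip_mul {A A' : Module.End ℝ (Ser m)} (h : Raises (serFilt m α) (serFilt m α) 1 (A - 1))
    (h' : Raises (serFilt m α) (serFilt m α) 1 (A' - 1)) :
    Raises (serFilt m α) (serFilt m α) 1 (A * A' - 1) := by
  have := (h.mul h'.of_sub_one).add h'
  rwa [sub_mul, one_mul, sub_add_sub_cancel] at this

theorem GPair.mul {A B A' B' : Module.End ℝ (Ser m)} (h : GPair m α A B)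
    (h' : GPair m α A' B') : GPair m α (A * A') (B * B') where
  unipA := unip_mul h.unipA h'.unipA
  unipB := unip_mul h.unipB h'.unipB
  mulB f g := by simp only [Module.End.mul_apply, h'.mulB, h.mulB]
  mulA f g := by simp only [Module.End.mul_apply, h'.mulA, h.mulA]
  realA := h.realA.mul h'.realA
  structB := h.structB.mul h'.structB

theorem GPair.inv {A B : Module.End ℝ (Ser m)} (h : GPair m α A B) :
    GPair m α (invOp (serFilt m α) h.unipA) (invOp (serFilt m α) h.unipB) where
  unipA := invOp_sub_one_raises _
  unipB := invOp_sub_one_raises _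
  mulB f g := by
    conv_lhs => rw [← apply_invOp h.unipB f, ← apply_invOp h.unipB g, ← h.mulB, invOp_apply]
  mulA f g := by
    conv_lhs => rw [← apply_invOp h.unipA f, ← apply_invOp h.unipB g, ← h.mulA, invOp_apply]
  realA := (h.realA.sub IsStruct.one.toIsReal).ser _ _
  structB := (h.structB.sub IsStruct.one).ser _ _

theorem GPair.raisesA {A B : Module.End ℝ (Ser m)} (h : GPair m α A B) :
    Raises (serFilt m α) (serFilt m α) 0 A := h.unipA.of_sub_one

theorem GPair.raisesB {A B : Module.End ℝ (Ser m)} (h : GPair m α A B) :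
    Raises (serFilt m α) (serFilt m α) 0 B := h.unipB.of_sub_one

/-- `B 1` is an idempotent of a domain, and unipotence excludes the value 0. -/
theorem GPair.map_one_B {A B : Module.End ℝ (Ser m)} (h : GPair m α A B) : B 1 = 1 := by
  have h1 := h.mulB 1 1
  rw [mul_one] at h1
  have h2 : B 1 * (B 1 - 1) = 0 := by rw [mul_sub, ← h1, mul_one, sub_self]
  rcases mul_eq_zero.1 h2 with h3 | h3
  · have h4 := h.unipB.mem (1 : Ser m) 0 (by rw [wt_zero]; lia)
    rw [LinearMap.sub_apply, h3] at h4
    change MvPowerSeries.coeff 0 (0 - 1 : Ser m) = 0 at h4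
    simp at h4
  · exact sub_eq_zero.1 h3

theorem GPair.apply_A {A B : Module.End ℝ (Ser m)} (h : GPair m α A B) (f : Ser m) :
    A f = A 1 * B f := by
  rw [← h.mulA, one_mul]

theorem GPair.mulA' {A B : Module.End ℝ (Ser m)} (h : GPair m α A B) (f g : Ser m) :
    A (f * g) = B f * A g := by
  rw [mul_comm, h.mulA, mul_comm]

theorem LPair.leibA' {a b : Module.End ℝ (Ser m)} (h : LPair m α a b) (f g : Ser m) :
    a (f * g) = b f * g + f * a g := by
  rw [mul_comm, h.leibA]; ring

theorem GPair.of_tends {A B : ℕ → Module.End ℝ (Ser m)} {A' B' : Module.End ℝ (Ser m)}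
    (h : ∀ n, GPair m α (A n) (B n))
    (hA : ∀ f, Tends (serFilt m α) (fun n => A n f) (A' f))
    (hB : ∀ f, Tends (serFilt m α) (fun n => B n f) (B' f)) : GPair m α A' B' := by
  have hmul : ∀ {x y : ℕ → Ser m} {x' y' : Ser m}, Tends (serFilt m α) x x' →
      Tends (serFilt m α) y y' → Tends (serFilt m α) (fun n => x n * y n) (x' * y') := by
    intro x y x' y' hx hy N
    filter_upwards [hx N, hy N] with n h1 h2
    have h3 := mul_mem_serFilt h1 ((serFilt m α).mem_zero (y n))
    have h4 := mul_mem_serFilt ((serFilt m α).mem_zero x') h2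
    rw [zero_add] at h4
    have h5 : x n * y n - x' * y' = (x n - x') * y n + x' * (y n - y') := by ring
    exact h5 ▸ Submodule.add_mem _ h3 h4
  have hunip : ∀ {C : ℕ → Module.End ℝ (Ser m)} {C' : Module.End ℝ (Ser m)},
      (∀ n, Raises (serFilt m α) (serFilt m α) 1 (C n - 1)) →
      (∀ f, Tends (serFilt m α) (fun n => C n f) (C' f)) →
      Raises (serFilt m α) (serFilt m α) 1 (C' - 1) := by
    intro C C' hC hC' n f hf
    have := (hC' f).add (Tends.const (-f))
    rw [LinearMap.sub_apply, Module.End.one_apply, sub_eq_add_neg]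
    refine this.mem (Eventually.of_forall fun k => ?_)
    have h1 := hC k n f hf
    rwa [LinearMap.sub_apply, Module.End.one_apply, sub_eq_add_neg] at h1
  refine ⟨hunip (fun n => (h n).unipA) hA, hunip (fun n => (h n).unipB) hB, fun f g => ?_,
    fun f g => ?_, ⟨?_, ?_⟩, ⟨⟨?_, ?_⟩, ?_⟩⟩
  · refine (hB (f * g)).unique ?_
    simp only [(h _).mulB]
    exact hmul (hB f) (hB g)
  · refine (hA (f * g)).unique ?_
    simp only [(h _).mulA]
    exact hmul (hA f) (hB g)
  · exact commute_of_tends (iOp_raises α) hA fun n => (h n).realA.commI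
  · exact commute_of_tends (conjOp_raises α) hA fun n => (h n).realA.commConj
  · exact commute_of_tends (iOp_raises α) hB fun n => (h n).structB.commI
  · exact commute_of_tends (conjOp_raises α) hB fun n => (h n).structB.commConj
  · exact commute_of_tends (axisOp_raises α) hB fun n => (h n).structB.commAxis

/-! ### Action on vector fields -/

/-- The pair `(A, B)` transforms the vector field `v` into `w`. -/
def Rel (A B : Module.End ℝ (Ser m)) (v w : VF m) : Prop := ∀ f, vder w (B f) = A (vder v f)

theorem Rel.trans {A B A' B' : Module.End ℝ (Ser m)} {u v w : VF m} (h : Rel A B u v)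
    (h' : Rel A' B' v w) : Rel (A' * A) (B' * B) u w := fun f => by
  rw [Module.End.mul_apply, h', h, Module.End.mul_apply]

theorem Rel.symm {A B : Module.End ℝ (Ser m)} (h : GPair m α A B) {v w : VF m}
    (hr : Rel A B v w) : Rel (invOp (serFilt m α) h.unipA) (invOp (serFilt m α) h.unipB) w v :=
  fun f => by
    conv_rhs => rw [← apply_invOp h.unipB f, hr, invOp_apply]

theorem Rel.refl (v : VF m) : Rel 1 1 v v := fun _ => rfl

/-- The image of a vector field under a transformation. -/
def GPair.act {A B : Module.End ℝ (Ser m)} (h : GPair m α A B) (v : VF m) : VF m :=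
  fun j => A (vder v (invOp (serFilt m α) h.unipB (MvPowerSeries.X (Sum.inl j))))

theorem Rel.eq_act {A B : Module.End ℝ (Ser m)} (h : GPair m α A B) {v w : VF m}
    (hr : Rel A B v w) : w = h.act v := by
  funext j
  rw [GPair.act, ← hr, apply_invOp, vder_X_inl]

/-- A derivation that kills the parameters is given by a vector field. -/
theorem leibniz_eq_vder (hα : 1 ≤ α) {δ : Module.End ℝ (Ser m)}
    (hδ : Raises (serFilt m α) (serFilt m α) 0 δ)
    (h : ∀ f g, δ (f * g) = δ f * g + f * δ g) (hi : Commute δ iOp)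
    (hp : ∀ l, δ (MvPowerSeries.X (Sum.inr l)) = 0) :
    δ = vder fun j => δ (MvPowerSeries.X (Sum.inl j)) := by
  rw [vder_eq_der]
  conv_lhs => rw [leibniz_eq_der hα hδ h hi]
  congr 1
  funext s
  rcases s with s | s
  · rfl
  · exact hp s

theorem IsStruct.axis_of_X_inr {K : Module.End ℝ (Ser m)} (h : IsStruct K) (l : Fin m) :
    axisOp (K (MvPowerSeries.X (Sum.inr l))) = K (MvPowerSeries.X (Sum.inr l)) := by
  rw [← commute_apply h.commAxis, axisOp_X_inr]

/-- The operator A X_v B⁻¹ is a derivation because the unit in `A` factors out of the Leibniz rule.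
It kills the parameters because B⁻¹ μ_l is a series in μ alone. Hence it is the derivation of a
field. -/
theorem GPair.rel_act (hα : 1 ≤ α) {A B : Module.End ℝ (Ser m)} (h : GPair m α A B) {v : VF m}
    (hv : v ∈ (vfFilt m α).F 1) : Rel A B v (h.act v) := by
  have hvr : Raises (serFilt m α) (serFilt m α) 0 (vder v) := vder_raises (p := 0) hv
  have key : A * vder v * invOp (serFilt m α) h.unipB = vder (h.act v) := by
    refine leibniz_eq_vder hα ((h.raisesA.mul hvr).mul h.inv.raisesB) ?_ ?_ ?_
    · intro f g
      simp only [Module.End.mul_apply, h.inv.mulB, vder_mul, map_add]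
      rw [h.mulA, h.mulA', apply_invOp, apply_invOp]
    · exact (h.realA.commI.mul_left (der_commute_iOp _)).mul_left h.inv.structB.commI
    · intro l
      rw [Module.End.mul_apply, Module.End.mul_apply, ← h.inv.structB.axis_of_X_inr,
        vder_axisOp hα hv, map_zero]
  intro f
  rw [← key]
  simp only [Module.End.mul_apply, invOp_apply]

theorem GPair.act_sub_mem {A B : Module.End ℝ (Ser m)} (h : GPair m α A B) {v : VF m} {r : ℕ}
    (hv : v ∈ (vfFilt m α).F r) : h.act v - v ∈ (vfFilt m α).F (r + 1) := by
  rw [mem_vfFilt]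
  intro j
  have h1 : (invOp (serFilt m α) h.unipB - 1) (MvPowerSeries.X (Sum.inl j)) ∈
      (serFilt m α).F 2 := h.inv.unipB _ _ (X_mem_serFilt (α := α) (Sum.inl j))
  have h2 := h.raisesA _ _ (vder_mem hv h1)
  have h3 := h.unipA _ _ (mem_vfFilt.1 hv j)
  have := Submodule.add_mem _ ((serFilt m α).mem_of_le (show r + 1 ≤ _ by lia) h2) h3
  convert this using 1
  rw [LinearMap.sub_apply, map_sub, map_sub, Module.End.one_apply, vder_X_inl]
  simp [GPair.act]

theorem GPair.act_mem (hα : 1 ≤ α) {A B : Module.End ℝ (Ser m)} (h : GPair m α A B) {v : VF m}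
    (hv : v ∈ stateSpace m) : h.act v ∈ stateSpace m := by
  have hd := h.act_sub_mem (stateSpace_le_vfFilt (α := α) hv)
  have hsub : ∀ e : Expo m, wt α e = 1 →
      MvPowerSeries.coeff e (h.act v 0) = MvPowerSeries.coeff e (v 0) := by
    intro e he
    have : MvPowerSeries.coeff e (h.act v 0 - v 0) = 0 := mem_vfFilt.1 hd 0 e (by lia)
    rwa [map_sub, sub_eq_zero] at this
  have hv' := (mem_stateSpace_iff v).1 hv
  rw [mem_stateSpace_iff]
  refine ⟨?_, ?_, ?_, ?_⟩
  · simp only [GPair.act]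
    rw [← commute_apply h.realA.commConj, ← commute_apply (vder_isStruct hα hv).commConj,
      ← commute_apply h.inv.structB.commConj, conjOp_X]
    simp [swapVar]
  · simp only [GPair.act]
    rw [h.apply_A, axisOp_mul, ← commute_apply h.structB.commAxis, axisOp_vder hα hv, map_zero,
      mul_zero]
  · rw [hsub _ wt_wExp]; exact hv'.2.2.1
  · rw [hsub _ wt_zExp]; exact hv'.2.2.2

/-- The infinitesimal action on vector fields. -/
def tanAct (a b : Module.End ℝ (Ser m)) (v : VF m) : VF m :=
  fun j => a (v j) - vder v (b (MvPowerSeries.X (Sum.inl j)))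

/-- This is the derivative of (A, B) ↦ A X_v B⁻¹ at the identity. It is again a derivation killing
the parameters, for the same reasons as in `GPair.rel_act`. -/
theorem LPair.vder_tanAct (hα : 1 ≤ α) {a b : Module.End ℝ (Ser m)} (h : LPair m α a b) {v : VF m}
    (hv : v ∈ (vfFilt m α).F 1) : vder (tanAct a b v) = a * vder v - vder v * b := by
  have hvr : Raises (serFilt m α) (serFilt m α) 0 (vder v) := vder_raises (p := 0) hv
  have key : a * vder v - vder v * b =
      vder fun j => (a * vder v - vder v * b) (MvPowerSeries.X (Sum.inl j)) := by
    refine leibniz_eq_vder hα ?_ ?_ ?_ ?_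
    · exact ((h.raisesA.mono (Nat.zero_le 1)).mul hvr).sub
        (hvr.mul (h.raisesB.mono (Nat.zero_le 1)))
    · intro f g
      simp only [LinearMap.sub_apply, Module.End.mul_apply, vder_mul, map_add, h.leibB]
      rw [h.leibA, h.leibA']
      ring
    · exact (h.realA.commI.mul_left (der_commute_iOp _)).sub_left
        (Commute.mul_left (der_commute_iOp _) h.structB.commI)
    · intro l
      rw [LinearMap.sub_apply, Module.End.mul_apply, Module.End.mul_apply, vder_X_inr, map_zero,
        ← h.structB.axis_of_X_inr, vder_axisOp hα hv, sub_zero]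
  rw [key]
  congr 1
  funext j
  rw [LinearMap.sub_apply, Module.End.mul_apply, Module.End.mul_apply, vder_X_inl]
  rfl

theorem vder_injective {u v : VF m} (h : vder u = vder v) : u = v := by
  funext j
  rw [← vder_X_inl u, h, vder_X_inl]

/-! ### Generators as elements of the Lie algebra -/

/-- The derivation attached to a generator. -/
def genB (Y : Gen m) : Module.End ℝ (Ser m) := der (Sum.elim (fun j => -Y.2.2 j) Y.1)

/-- The derivation attached to a generator plus the multiplication by its time component. -/
def genA (Y : Gen m) : Module.End ℝ (Ser m) := genB Y + LinearMap.mulLeft ℝ Y.2.1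

theorem genB_X_inl (Y : Gen m) (j : Fin 2) : genB Y (MvPowerSeries.X (Sum.inl j)) = -Y.2.2 j :=
  der_X _ _

theorem genB_apply (Y : Gen m) (f : Ser m) : genB Y f =
    (∑ l, MvPowerSeries.pderiv ℂ (Sum.inr l) f * Y.1 l) - vder Y.2.2 f := by
  rw [genB, der_apply, Fintype.sum_sum_type, vder_apply]
  simp
  ring

/-- The differential of the spectral sequence is the infinitesimal action. The minus sign in `genB`
is forced by the bracket convention: exp(ad_S) on fields is conjugation by exp(−X_S). -/
theorem tanAct_gen (Y : Gen m) (v : VF m) : tanAct (genA Y) (genB Y) v = diffl v Y := by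
  funext i
  change genB Y (v i) + Y.2.1 * v i - vder v (genB Y (MvPowerSeries.X (Sum.inl i))) =
    (∑ l : Fin m, MvPowerSeries.pderiv ℂ (Sum.inr l) (v i) * Y.1 l) + Y.2.1 * v i
      + bracket Y.2.2 v i
  rw [genB_X_inl, genB_apply, bracket_apply, map_neg]
  ring

theorem genB_raises {Y : Gen m} {p : ℕ} (hP : ∀ l, Y.1 l ∈ (serFilt m α).F (α + p))
    (hS : Y.2.2 ∈ (vfFilt m α).F (p + 1)) : Raises (serFilt m α) (serFilt m α) p (genB Y) := by
  refine der_raises ?_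
  rintro (s | s)
  · have := Submodule.neg_mem _ (mem_vfFilt.1 hS s)
    rwa [add_comm] at this
  · exact hP s

theorem mulLeft_raises {T : Ser m} {p : ℕ} (hT : T ∈ (serFilt m α).F p) :
    Raises (serFilt m α) (serFilt m α) p (LinearMap.mulLeft ℝ T) := fun n f hf => by
  rw [add_comm]; exact mul_mem_serFilt hT hf

theorem genA_raises {Y : Gen m} {p : ℕ} (hP : ∀ l, Y.1 l ∈ (serFilt m α).F (α + p))
    (hT : Y.2.1 ∈ (serFilt m α).F p)
    (hS : Y.2.2 ∈ (vfFilt m α).F (p + 1)) : Raises (serFilt m α) (serFilt m α) p (genA Y) :=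
  (genB_raises hP hS).add (mulLeft_raises hT)

theorem mulLeft_isReal {T : Ser m} (h : conjOp T = T) : IsReal (LinearMap.mulLeft ℝ T) := by
  refine ⟨LinearMap.ext fun f => ?_, LinearMap.ext fun f => ?_⟩
  · change T * iOp f = iOp (T * f)
    simp [iOp_apply]
  · change T * conjOp f = conjOp (T * f)
    rw [conjOp_mul, h]

/-- Generators whose time component is an arbitrary real power series. -/
structure IsGen (α : ℕ) (Y : Gen m) : Prop where
  conjP : ∀ l, conjOp (Y.1 l) = Y.1 l
  axisP : ∀ l, axisOp (Y.1 l) = Y.1 l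
  memP : ∀ l, Y.1 l ∈ (serFilt m α).F (α + 1)
  conjT : conjOp Y.2.1 = Y.2.1
  memT : Y.2.1 ∈ (serFilt m α).F 1
  stateS : Y.2.2 ∈ stateSpace m
  memS : Y.2.2 ∈ (vfFilt m α).F 2

theorem mem_genFilt_iff {N : ℕ} (hN : 1 ≤ N) {Y : Gen m} : Y ∈ genFilt α (N : ℤ) ↔
    (∀ l, conjOp (Y.1 l) = Y.1 l ∧ axisOp (Y.1 l) = Y.1 l ∧ Y.1 l ∈ (serFilt m α).F (α + N)) ∧
    (conjOp Y.2.1 = Y.2.1 ∧ chargeOp Y.2.1 = 0 ∧ Y.2.1 ∈ (serFilt m α).F N) ∧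
    Y.2.2 ∈ stateSpace m ∧ Y.2.2 ∈ (vfFilt m α).F (N + 1) := by
  rw [genFilt, max_eq_right (by exact_mod_cast hN), Submodule.mem_prod, Submodule.mem_prod,
    mem_paramFilt_iff, mem_timeFilt_iff, mem_stateFilt_iff]

theorem genSpace_eq (m α : ℕ) : (genSpace α : Submodule ℝ (Gen m)) = genFilt α ((1 : ℕ) : ℤ) := by
  simp [genSpace, genFilt]

theorem mem_genSpace_iff {Y : Gen m} : Y ∈ genSpace α ↔ IsGen α Y ∧ chargeOp Y.2.1 = 0 := by
  rw [genSpace_eq, mem_genFilt_iff le_rfl]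
  constructor
  · rintro ⟨h1, h2, h3⟩
    exact ⟨⟨fun l => (h1 l).1, fun l => (h1 l).2.1, fun l => (h1 l).2.2, h2.1, h2.2.2, h3.1, h3.2⟩,
      h2.2.1⟩
  · rintro ⟨h, h'⟩
    exact ⟨fun l => ⟨h.conjP l, h.axisP l, h.memP l⟩, ⟨h.conjT, h', h.memT⟩, h.stateS, h.memS⟩

theorem IsGen.lPair (hα : 1 ≤ α) {Y : Gen m} (h : IsGen α Y) : LPair m α (genA Y) (genB Y) := by
  have hr : ∀ s, (Sum.elim (fun j => -Y.2.2 j) Y.1 s : Ser m) ∈ (serFilt m α).F (varWt m α s) := by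
    rintro (s | s)
    · exact Submodule.neg_mem _ (mem_vfFilt.1 ((vfFilt m α).mem_of_le one_le_two h.memS) s)
    · exact (serFilt m α).mem_of_le (Nat.le_succ _) (h.memP s)
  have hB : IsStruct (genB Y) := by
    refine ⟨⟨der_commute_iOp _, der_commute_conjOp hα hr ?_⟩, der_commute_axisOp hα hr ?_ h.axisP⟩
    · rintro (s | s)
      · have := conjOp_of_mem_stateSpace h.stateS (Sum.inl s)
        simp only [Sum.elim_inl] at this ⊢
        rw [map_neg, this]
        rfl
      · exact h.conjP s
    · intro j
      change axisOp (-Y.2.2 j) = 0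
      rw [map_neg, axisOp_of_mem_stateSpace h.stateS, neg_zero]
  refine ⟨genA_raises h.memP h.memT h.memS, genB_raises h.memP h.memS, der_mul _, ?_, ?_, hB⟩
  · intro f g
    change genB Y (f * g) + Y.2.1 * (f * g) = (genB Y f + Y.2.1 * f) * g + f * genB Y g
    rw [genB, der_mul]; ring
  · exact hB.toIsReal.add (mulLeft_isReal h.conjT)

theorem IsStruct.conj_X_inl {K : Module.End ℝ (Ser m)} (h : IsStruct K) :
    K (MvPowerSeries.X (Sum.inl 1)) = conjOp (K (MvPowerSeries.X (Sum.inl 0))) := by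
  rw [← commute_apply h.commConj, conjOp_X]
  simp [swapVar]

/-- A derivation is determined by its values on the variables, and `a` differs from `b` by
multiplication by `a 1`. Nothing forces `a 1` to depend on zw and μ only, so this gives an `IsGen`
and not yet an element of A⁰. -/
theorem LPair.exists_gen (hα : 1 ≤ α) {a b : Module.End ℝ (Ser m)} (h : LPair m α a b) :
    ∃ Y : Gen m, IsGen α Y ∧ genA Y = a ∧ genB Y = b := by
  let Y : Gen m := (fun l => b (MvPowerSeries.X (Sum.inr l)), a 1,
    fun j => -b (MvPowerSeries.X (Sum.inl j)))
  have hb : genB Y = b := by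
    rw [leibniz_eq_der hα (h.raisesB.mono (Nat.zero_le 1)) h.leibB h.structB.commI, genB]
    congr 1
    funext s
    rcases s with s | s
    · exact neg_neg _
    · rfl
  have hS : Y.2.2 ∈ (vfFilt m α).F 2 := mem_vfFilt.2 fun j =>
    Submodule.neg_mem _ (h.raisesB _ _ (X_mem_serFilt (α := α) (Sum.inl j)))
  refine ⟨Y, ⟨fun l => ?_, h.structB.axis_of_X_inr, fun l => h.raisesB _ _ (X_mem_serFilt (α := α) (Sum.inr l)), ?_,
    h.raisesA.mem 1, ?_, hS⟩, ?_, hb⟩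
  · change conjOp (b _) = b _
    rw [← commute_apply h.structB.commConj, conjOp_X]
    rfl
  · change conjOp (a 1) = a 1
    rw [← commute_apply h.realA.commConj, conjOp_one]
  · refine mem_stateSpace_of_mem_two hS ?_ ?_
    · change -b _ = conjOp (-b _)
      rw [map_neg, h.structB.conj_X_inl]
    · change axisOp (-b _) = 0
      rw [map_neg, ← commute_apply h.structB.commAxis, axisOp_X_inl, map_zero, neg_zero]
  · refine LinearMap.ext fun f => ?_
    change genB Y f + a 1 * f = a f
    rw [hb]
    conv_rhs => rw [← one_mul f, h.leibA, one_mul]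
    ring

/-! ### The homological equation of a Hopf singularity -/

/-- The linear part `(κ z, -κ w)`. -/
def hopfPart (m : ℕ) (κ : ℂ) : VF m :=
  ![κ • MvPowerSeries.X (Sum.inl 0), -(κ • MvPowerSeries.X (Sum.inl 1))]

theorem vder_hopfPart (hα : 1 ≤ α) (κ : ℂ) (f : Ser m) :
    vder (hopfPart m κ) f = κ • chargeOp f := by
  rw [chargeOp_eq_vder (α := α) hα, vder_apply, vder_apply]
  simp [hopfPart]

theorem coeff_hopfPart (κ : ℂ) (e : Expo m) : MvPowerSeries.coeff e (hopfPart m κ 0) =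
    κ * MvPowerSeries.coeff e (MvPowerSeries.X (Sum.inl 0) : Ser m) := by
  simp [hopfPart]

theorem axisOp_smul (κ : ℂ) (f : Ser m) : axisOp (κ • f) = κ • axisOp f := by
  ext e
  rw [coeff_axisOp, map_smul, map_smul, coeff_axisOp]
  split_ifs <;> simp

theorem conjOp_smul (κ : ℂ) (f : Ser m) : conjOp (κ • f) = conj κ • conjOp f := by
  ext e
  simp [coeff_conjOp]

theorem conj_of_re_eq_zero {κ : ℂ} (h : κ.re = 0) : conj κ = -κ := by
  apply Complex.ext <;> simp [h]

theorem hopfPart_mem {κ : ℂ} (hκ : κ.re = 0) : hopfPart m κ ∈ stateSpace m := by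
  classical
  rw [mem_stateSpace_iff]
  refine ⟨?_, ?_, ?_, ?_⟩
  · change -(κ • MvPowerSeries.X (Sum.inl 1)) = conjOp (κ • MvPowerSeries.X (Sum.inl 0))
    rw [conjOp_smul, conjOp_X, conj_of_re_eq_zero hκ, neg_smul]
    simp [swapVar]
  · change axisOp (κ • MvPowerSeries.X (Sum.inl 0)) = 0
    rw [axisOp_smul, axisOp_X_inl, smul_zero]
  · rw [coeff_hopfPart, MvPowerSeries.coeff_X, if_neg, mul_zero]
    intro h
    have := DFunLike.congr_fun h (Sum.inl 0)
    simp [wExp] at this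
  · rw [coeff_hopfPart, MvPowerSeries.coeff_X, zExp, if_pos rfl, mul_one, hκ]

theorem exists_of_wt_eq_one (hα : 1 ≤ α) {e : Expo m} (he : wt α e = 1) (hs : stateDeg e ≠ 0) :
    e = zExp m ∨ e = wExp m := by
  by_contra! h
  have h1 : Admissible e := (admissible_iff e).2 ⟨by lia, h.2⟩
  rcases h1.2 with h2 | h2
  · rw [wt] at he
    have h3 : paramDeg e ≤ α * paramDeg e := Nat.le_mul_of_pos_left _ hα
    lia
  · exact h.1 h2

theorem sub_hopfPart_mem (hα : 1 ≤ α) {v : VF m} (hv : v ∈ stateSpace m) :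
    v - hopfPart m (MvPowerSeries.coeff (zExp m) (v 0)) ∈ (vfFilt m α).F 2 := by
  classical
  set κ := MvPowerSeries.coeff (zExp m) (v 0) with hκ
  have hκ' : κ.re = 0 := ((mem_stateSpace_iff v).1 hv).2.2.2
  have hu : v - hopfPart m κ ∈ stateSpace m := Submodule.sub_mem _ hv (hopfPart_mem hκ')
  have h0 : (v - hopfPart m κ) 0 ∈ (serFilt m α).F 2 := by
    intro e he
    change MvPowerSeries.coeff e _ = 0
    by_cases hs : stateDeg e = 0
    · exact (axisOp_eq_zero_iff _).1 ((mem_stateSpace_iff _).1 hu).2.1 e hs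
    · have : wt α e = 1 := by rw [wt] at he ⊢; lia
      rcases exists_of_wt_eq_one hα this hs with rfl | rfl
      · rw [Pi.sub_apply, map_sub, coeff_hopfPart, MvPowerSeries.coeff_X, zExp, if_pos rfl,
          mul_one, hκ, zExp, sub_self]
      · exact ((mem_stateSpace_iff _).1 hu).2.2.1
  rw [mem_vfFilt]
  intro i
  fin_cases i
  · exact h0
  · have h1 := ((mem_stateSpace_iff _).1 hu).1
    change (v - hopfPart m κ) 1 ∈ _
    rw [h1]
    exact conjOp_raises α _ _ h0

/-- Division of the coefficients by `κ` times the charge. -/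
def divCharge (κ : ℂ) : Module.End ℝ (Ser m) where
  toFun f := fun e => MvPowerSeries.coeff e f / (κ * charge e)
  map_add' f g := by
    ext e
    change MvPowerSeries.coeff e (f + g) / (κ * charge e) =
      MvPowerSeries.coeff e f / (κ * charge e) + MvPowerSeries.coeff e g / (κ * charge e)
    rw [map_add, add_div]
  map_smul' c f := by
    ext e
    change MvPowerSeries.coeff e (c • f) / (κ * charge e) =
      c • (MvPowerSeries.coeff e f / (κ * charge e))
    simp [mul_div_assoc]

theorem coeff_divCharge (κ : ℂ) (e : Expo m) (f : Ser m) :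
    MvPowerSeries.coeff e (divCharge κ f) = MvPowerSeries.coeff e f / (κ * charge e) := rfl

theorem divCharge_raises (κ : ℂ) : Raises (serFilt m α) (serFilt m α) 0 (divCharge κ) :=
  fun n f hf e he => by
    change MvPowerSeries.coeff e f / (κ * charge e) = 0
    rw [mem_serFilt.1 hf e he, zero_div]

theorem conj_charge (e : Expo m) : conj (charge e) = charge e := by simp [charge]

theorem charge_swapExp (e : Expo m) : charge (swapExp e) = -charge e := by
  simp [charge, swapExp_inl_zero, swapExp_inl_one]

theorem divCharge_commute_conjOp {κ : ℂ} (hκ : κ.re = 0) :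
    Commute (divCharge κ : Module.End ℝ (Ser m)) conjOp := by
  refine LinearMap.ext fun f => MvPowerSeries.ext fun e => ?_
  change MvPowerSeries.coeff e (divCharge κ (conjOp f)) =
    MvPowerSeries.coeff e (conjOp (divCharge κ f))
  rw [coeff_divCharge, coeff_conjOp, coeff_conjOp, coeff_divCharge, map_div₀, map_mul,
    conj_of_re_eq_zero hκ, conj_charge, charge_swapExp, neg_mul_neg]

/-- Split X_v = κ · charge + X_u with u of grade at least one. With q the division by κ · charge,
the equation s + X_u(q s) = f is solved by a geometric series. Then h = q s, and g is what the
rotation cannot reach in s, its charge-zero part. Since κ is imaginary, q respects the real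
structure. -/
theorem hopf_homological (hα : 1 ≤ α) {v : VF m} (hv : v ∈ stateSpace m)
    (hH : MvPowerSeries.coeff (zExp m) (v 0) ≠ 0) {f : Ser m} {n : ℕ}
    (hf : conjOp f = f) (hfn : f ∈ (serFilt m α).F n) :
    ∃ g h : Ser m, f = g + vder v h ∧ conjOp g = g ∧ chargeOp g = 0 ∧ g ∈ (serFilt m α).F n ∧
      conjOp h = h ∧ h ∈ (serFilt m α).F n := by
  set κ := MvPowerSeries.coeff (zExp m) (v 0) with hκdef
  have hκ : κ.re = 0 := ((mem_stateSpace_iff v).1 hv).2.2.2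
  set u := v - hopfPart m κ with hu
  have hu2 : u ∈ (vfFilt m α).F 2 := sub_hopfPart_mem hα hv
  have hus : u ∈ stateSpace m := Submodule.sub_mem _ hv (hopfPart_mem hκ)
  have hvu : ∀ h, vder v h = κ • chargeOp h + vder u h := by
    intro h
    rw [hu, map_sub, LinearMap.sub_apply, vder_hopfPart hα, add_sub_cancel]
  let U : Module.End ℝ (Ser m) := 1 + vder u * divCharge κ
  have hU : Raises (serFilt m α) (serFilt m α) 1 (U - 1) := by
    have : U - 1 = vder u * divCharge κ := add_sub_cancel_left _ _
    rw [this]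
    exact (vder_raises (p := 1) hu2).mul (divCharge_raises κ)
  have hUc : Commute (U - 1) conjOp := by
    have : U - 1 = vder u * divCharge κ := add_sub_cancel_left _ _
    rw [this]
    exact (vder_isStruct hα hus).commConj.mul_left (divCharge_commute_conjOp hκ)
  set s := invOp (serFilt m α) hU f with hs
  have hsf : s + vder u (divCharge κ s) = f := apply_invOp hU f
  have hsc : conjOp s = s := by
    have : Commute (invOp (serFilt m α) hU) conjOp := commute_of_limit hU _ (conjOp_raises α) hUc
    rw [hs, ← commute_apply this, hf]
  have hsn : s ∈ (serFilt m α).F n := ser_raises_zero hU _ _ _ hfn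
  have hqc : conjOp (divCharge κ s) = divCharge κ s := by
    rw [← commute_apply (divCharge_commute_conjOp hκ), hsc]
  have hqn : divCharge κ s ∈ (serFilt m α).F n := divCharge_raises κ _ _ hsn
  refine ⟨s - vder (hopfPart m κ) (divCharge κ s), divCharge κ s, ?_, ?_, ?_, ?_, hqc, hqn⟩
  · rw [hvu, vder_hopfPart hα, ← hsf]; ring
  · rw [map_sub, ← commute_apply (vder_isStruct hα (hopfPart_mem hκ)).commConj, hqc, hsc]
  · rw [vder_hopfPart hα]
    ext e
    rw [coeff_chargeOp, map_sub, map_smul, coeff_chargeOp, coeff_divCharge,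
      MvPowerSeries.coeff_zero]
    -- Division by zero is zero in `divCharge`, so coefficients of charge zero remain in g, while
    -- all others cancel.
    by_cases he : charge e = 0
    · rw [he, zero_mul]
    · have hκ0 : κ ≠ 0 := hH
      rw [smul_eq_mul]
      field_simp
      simp
  · exact Submodule.sub_mem _ hsn
      (vder_raises (p := 0) (stateSpace_le_vfFilt (hopfPart_mem hκ)) _ _ hqn)

/-- The bracket [hv, v] equals X_v(h) v, because the terms h v′v cancel. A time component of the
form X_v(h) is thus the same as the state component hv. -/
theorem diffl_time_shift (v : VF m) (P : Fin m → Ser m) (g h : Ser m) (S : VF m) :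
    diffl v (P, g + vder v h, S) = diffl v (P, g, S + fun i => h * v i) := by
  have hb : ∀ i, bracket (S + fun i => h * v i) v i = bracket S v i + vder v h * v i := by
    intro i
    rw [bracket_apply, bracket_apply, map_add, LinearMap.add_apply, Pi.add_apply, map_add,
      vder_mul]
    have : vder (fun i => h * v i) (v i) = h * vder v (v i) := by
      rw [vder_apply, vder_apply, Finset.mul_sum]
      exact Finset.sum_congr rfl fun j _ => by ring
    rw [this]; ring
  funext i
  change (∑ l : Fin m, MvPowerSeries.pderiv ℂ (Sum.inr l) (v i) * P l) + (g + vder v h) * v i +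
    bracket S v i = (∑ l : Fin m, MvPowerSeries.pderiv ℂ (Sum.inr l) (v i) * P l) + g * v i +
    bracket (S + fun i => h * v i) v i
  rw [hb]; ring

/-- Every infinitesimal transformation of a Hopf singularity is given by a generator with a time
component depending only on `z w` and the parameters. -/
theorem LPair.exists_genSpace (hα : 1 ≤ α) {v : VF m} (hv : v ∈ stateSpace m)
    (hH : MvPowerSeries.coeff (zExp m) (v 0) ≠ 0) {a b : Module.End ℝ (Ser m)}
    (h : LPair m α a b) : ∃ Y ∈ genSpace α, diffl v Y = tanAct a b v := by
  obtain ⟨⟨P, T, S⟩, hY, rfl, rfl⟩ := h.exists_gen hα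
  obtain ⟨g, k, rfl, hg1, hg2, hg3, hk1, hk2⟩ := hopf_homological hα hv hH hY.conjT hY.memT
  rw [tanAct_gen, diffl_time_shift]
  have hk2' : (fun i => k * v i) ∈ (vfFilt m α).F 2 := mem_vfFilt.2 fun i =>
    mul_mem_serFilt hk2 (mem_vfFilt.1 (stateSpace_le_vfFilt hv) i)
  have hks : (fun i => k * v i) ∈ stateSpace m := by
    refine mem_stateSpace_of_mem_two hk2' ?_ ?_
    · rw [conjOp_mul, hk1, ((mem_stateSpace_iff v).1 hv).1]
    · rw [axisOp_mul, axisOp_of_mem_stateSpace hv, mul_zero]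
  refine ⟨(P, g, S + fun i => k * v i), mem_genSpace_iff.2
    ⟨⟨hY.conjP, hY.axisP, hY.memP, hg1, hg3, ?_, ?_⟩, hg2⟩, rfl⟩
  · exact Submodule.add_mem _ hY.stateS hks
  · exact Submodule.add_mem _ hY.memS hk2'

/-! ### Grade parts -/

theorem coeff_gradePart (n : ℤ) (v : VF m) (i : Fin 2) (e : Expo m) :
    MvPowerSeries.coeff e (gradePart α n v i) =
      if (wt α e : ℤ) - 1 = n then MvPowerSeries.coeff e (v i) else 0 := rfl

theorem gradePart_eq_of_sub_mem {u v : VF m} {r : ℕ} (h : u - v ∈ (vfFilt m α).F (r + 2)) :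
    gradePart α r u = gradePart α r v := by
  funext i
  ext e
  rw [coeff_gradePart, coeff_gradePart]
  split_ifs with he
  · have : MvPowerSeries.coeff e (u i - v i) = 0 := mem_vfFilt.1 h i e (by lia)
    rwa [map_sub, sub_eq_zero] at this
  · rfl

theorem sub_mem_of_gradePart_eq {u v : VF m} {r : ℕ} (h : u - v ∈ (vfFilt m α).F (r + 1))
    (hg : gradePart α r u = gradePart α r v) : u - v ∈ (vfFilt m α).F (r + 2) := by
  rw [mem_vfFilt]
  intro i e he
  change MvPowerSeries.coeff e (u i - v i) = 0
  by_cases hw : wt α e < r + 1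
  · exact mem_vfFilt.1 h i e hw
  · have := congrArg (fun w => MvPowerSeries.coeff e (w i)) hg
    simp only [coeff_gradePart] at this
    rw [if_pos (by lia), if_pos (by lia)] at this
    rw [map_sub, this, sub_self]

theorem gradePart_zero_of_mem {u : VF m} {r : ℕ} (h : u ∈ (vfFilt m α).F (r + 2)) :
    gradePart α r u = 0 := by
  rw [gradePart_eq_of_sub_mem (v := 0) (by simpa using h), map_zero]

theorem gradePart_mem_stateSpace {v : VF m} (hv : v ∈ stateSpace m) (n : ℤ) :
    gradePart α n v ∈ stateSpace m := by
  obtain ⟨h1, h2, h3⟩ := hv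
  refine ⟨fun e => ?_, fun e he => ?_, ?_⟩
  · rw [coeff_gradePart, coeff_gradePart, wt_swapExp, h1]
    split_ifs <;> simp
  · rw [coeff_gradePart] at he
    split_ifs at he
    · exact h2 e he
    · exact absurd rfl he
  · rw [coeff_gradePart]
    split_ifs
    · exact h3
    · rfl

theorem gradePart_mem_stateGrade {v : VF m} (hv : v ∈ stateSpace m) (n : ℤ) :
    gradePart α n v ∈ stateGrade α n :=
  ⟨gradePart_mem_stateSpace hv n, fun i e he => by rw [coeff_gradePart, if_neg he]⟩

theorem gradePart_eq_self {v : VF m} {n : ℤ} (hv : v ∈ stateGrade α n) : gradePart α n v = v := by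
  funext i
  ext e
  rw [coeff_gradePart]
  split_ifs with he
  · rfl
  · rw [hv.2 i e he]

theorem stateGrade_le_vfFilt {r : ℕ} {v : VF m} (hv : v ∈ stateGrade α (r : ℤ)) :
    v ∈ (vfFilt m α).F (r + 1) :=
  mem_vfFilt.2 fun i e he => hv.2 i e (by lia)

theorem sub_gradePart_mem {v : VF m} {r : ℕ} (h : v ∈ (vfFilt m α).F (r + 1)) :
    v - gradePart α r v ∈ (vfFilt m α).F (r + 2) := by
  rw [mem_vfFilt]
  intro i e he
  change MvPowerSeries.coeff e (v i - gradePart α r v i) = 0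
  rw [map_sub, coeff_gradePart]
  split_ifs with hw
  · rw [sub_self]
  · rw [sub_zero]
    exact mem_vfFilt.1 h i e (by lia)

/-! ### Removable terms -/

/-- At level r the boundaries carry the index r − 1, so in grade r the generators range over F¹A⁰,
which is everything. -/
theorem genFilt_sub_eq (r : ℕ) :
    (genFilt α ((r : ℤ) - ((r : ℤ) - 1)) : Submodule ℝ (Gen m)) = genSpace α := by
  rw [genSpace_eq]; congr 1; simp

theorem tanAct_mem_two {a b : Module.End ℝ (Ser m)} (h : LPair m α a b) {v : VF m}
    (hv : v ∈ (vfFilt m α).F 1) : tanAct a b v ∈ (vfFilt m α).F 2 := by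
  rw [mem_vfFilt]
  intro j
  exact Submodule.sub_mem _ (h.raisesA _ _ (mem_vfFilt.1 hv j))
    (vder_mem hv (h.raisesB _ _ (X_mem_serFilt (α := α) (Sum.inl j))))

theorem LPair.apply_a {a b : Module.End ℝ (Ser m)} (h : LPair m α a b) (f : Ser m) :
    a f = b f + a 1 * f := by
  conv_lhs => rw [← one_mul f, h.leibA, one_mul, add_comm]

theorem tanAct_mem_stateSpace (hα : 1 ≤ α) {a b : Module.End ℝ (Ser m)} (h : LPair m α a b)
    {v : VF m} (hv : v ∈ stateSpace m) : tanAct a b v ∈ stateSpace m := by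
  refine mem_stateSpace_of_mem_two (tanAct_mem_two h (stateSpace_le_vfFilt hv)) ?_ ?_
  · simp only [tanAct]
    rw [map_sub, ← commute_apply h.realA.commConj, ← ((mem_stateSpace_iff v).1 hv).1,
      ← commute_apply (vder_isStruct hα hv).commConj, h.structB.conj_X_inl]
  · simp only [tanAct]
    rw [map_sub, axisOp_vder hα hv, h.apply_a, map_add, axisOp_mul,
      ← commute_apply h.structB.commAxis, axisOp_of_mem_stateSpace hv, map_zero, mul_zero]
    simp

/-- Passing from A⁰ to the full Lie algebra costs nothing, by `LPair.exists_genSpace`. Only this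
description is stable under conjugation, since A⁰ itself is not. -/
theorem mem_removable_iff (hα : 1 ≤ α) {v : VF m} (hv : v ∈ stateSpace m)
    (hH : MvPowerSeries.coeff (zExp m) (v 0) ≠ 0) {r : ℕ} {x : VF m} :
    x ∈ removable α v r r ↔ ∃ a b, LPair m α a b ∧ tanAct a b v ∈ (vfFilt m α).F (r + 1) ∧
      gradePart α r (tanAct a b v) = x := by
  rw [removable, specB, genFilt_sub_eq]
  constructor
  · rintro ⟨y, ⟨hy, Y, hY, rfl⟩, rfl⟩
    refine ⟨genA Y, genB Y, (mem_genSpace_iff.1 hY).1.lPair hα, ?_, ?_⟩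
    · rw [tanAct_gen]; exact (mem_stateFilt_iff.1 hy).2
    · rw [tanAct_gen]
  · rintro ⟨a, b, h, h1, rfl⟩
    obtain ⟨Y, hY, hYd⟩ := h.exists_genSpace hα hv hH
    exact ⟨_, ⟨mem_stateFilt_iff.2 ⟨tanAct_mem_stateSpace hα h hv, h1⟩, Y, hY, hYd⟩, rfl⟩

/-! ### Invariance of the removable spaces along an orbit. -/

theorem LPair.conj {A B a b : Module.End ℝ (Ser m)} (hG : GPair m α A B) (h : LPair m α a b) :
    LPair m α (A * a * invOp (serFilt m α) hG.unipA) (B * b * invOp (serFilt m α) hG.unipB) where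
  raisesA := by simpa using (hG.raisesA.mul h.raisesA).mul hG.inv.raisesA
  raisesB := by simpa using (hG.raisesB.mul h.raisesB).mul hG.inv.raisesB
  leibB f g := by
    simp only [Module.End.mul_apply, hG.inv.mulB, h.leibB, map_add, hG.mulB, apply_invOp]
  leibA f g := by
    simp only [Module.End.mul_apply, hG.inv.mulA, h.leibA, map_add, hG.mulA, apply_invOp]
  realA := (hG.realA.mul h.realA).mul hG.inv.realA
  structB := (hG.structB.mul h.structB).mul hG.inv.structB

theorem Rel.coeff_zExp {A B : Module.End ℝ (Ser m)} (hG : GPair m α A B) {v w : VF m}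
    (hv : v ∈ stateSpace m) (hr : Rel A B v w) :
    MvPowerSeries.coeff (zExp m) (w 0) = MvPowerSeries.coeff (zExp m) (v 0) := by
  have h := hG.act_sub_mem (stateSpace_le_vfFilt (α := α) hv)
  rw [← hr.eq_act hG] at h
  have : MvPowerSeries.coeff (zExp m) (w 0 - v 0) = 0 :=
    mem_vfFilt.1 h 0 _ (by rw [wt_zExp]; lia)
  rwa [map_sub, sub_eq_zero] at this

theorem Rel.mem_stateSpace (hα : 1 ≤ α) {A B : Module.End ℝ (Ser m)} (hG : GPair m α A B)
    {v w : VF m} (hv : v ∈ stateSpace m) (hr : Rel A B v w) : w ∈ stateSpace m := by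
  rw [hr.eq_act hG]; exact hG.act_mem hα hv

/-- Conjugating (a, b) by (A, B) turns the tangent vector at v into its image under the
transformation, a tangent vector at w. The image has the same lowest-grade part because the action
is unipotent. -/
theorem Rel.removable_le (hα : 1 ≤ α) {A B : Module.End ℝ (Ser m)} (hG : GPair m α A B)
    {v w : VF m} (hv : v ∈ stateSpace m) (hH : MvPowerSeries.coeff (zExp m) (v 0) ≠ 0)
    (hr : Rel A B v w) (r : ℕ) : removable α v r r ≤ removable α w r r := by
  have hw := hr.mem_stateSpace hα hG hv
  intro x hx
  rw [mem_removable_iff hα hv hH] at hx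
  obtain ⟨a, b, h, h1, rfl⟩ := hx
  rw [mem_removable_iff hα hw (by rwa [hr.coeff_zExp hG hv])]
  have hx1 := stateSpace_le_vfFilt (α := α) (tanAct_mem_stateSpace hα h hv)
  have hrel := hG.rel_act hα hx1
  have key : tanAct (A * a * invOp (serFilt m α) hG.unipA)
      (B * b * invOp (serFilt m α) hG.unipB) w = hG.act (tanAct a b v) := by
    apply vder_injective
    rw [(h.conj hG).vder_tanAct hα (stateSpace_le_vfFilt hw)]
    refine LinearMap.ext fun f => ?_
    conv_rhs => rw [← apply_invOp hG.unipB f, hrel, h.vder_tanAct hα (stateSpace_le_vfFilt hv)]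
    conv_lhs => rw [← apply_invOp hG.unipB f]
    simp only [LinearMap.sub_apply, Module.End.mul_apply, hr _, invOp_apply, map_sub]
  have hsub := hG.act_sub_mem h1
  refine ⟨_, _, h.conj hG, ?_, ?_⟩
  · rw [key]
    have := Submodule.add_mem _ ((vfFilt m α).mem_of_le (Nat.le_succ _) hsub) h1
    rwa [sub_add_cancel] at this
  · rw [key]
    exact gradePart_eq_of_sub_mem hsub

theorem Rel.removable_eq (hα : 1 ≤ α) {A B : Module.End ℝ (Ser m)} (hG : GPair m α A B)
    {v w : VF m} (hv : v ∈ stateSpace m) (hH : MvPowerSeries.coeff (zExp m) (v 0) ≠ 0)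
    (hr : Rel A B v w) (r : ℕ) : removable α w r r = removable α v r r :=
  le_antisymm
    ((hr.symm hG).removable_le hα hG.inv (hr.mem_stateSpace hα hG hv)
      (by rwa [hr.coeff_zExp hG hv]) r)
    (hr.removable_le hα hG hv hH r)

/-! ### Comparison of a transformation with its logarithm -/

section Intertwine

variable {M : Type*} [AddCommGroup M] [Module ℝ M] {Φ : CFilt M}

/-- The difference K^k D − D L^k telescopes into terms each containing K D − D L exactly once. -/
theorem ser_intertwine {K L D : Module.End ℝ M} {r : ℕ} (hK : Raises Φ Φ 1 K)
    (hL : Raises Φ Φ 1 L) (hD : Raises Φ Φ 0 D) (h : Raises Φ Φ r (K * D - D * L))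
    (a : PowerSeries ℝ) : Raises Φ Φ r (ser Φ hK a * D - D * ser Φ hL a) := by
  have hpow : ∀ k, Raises Φ Φ r (K ^ k * D - D * L ^ k) := by
    intro k
    induction k with
    | zero => simp only [pow_zero, one_mul, mul_one, sub_self]; exact fun _ _ _ => Submodule.zero_mem _
    | succ k ih =>
      have h1 : K ^ (k + 1) * D - D * L ^ (k + 1) =
          K ^ k * (K * D - D * L) + (K ^ k * D - D * L ^ k) * L := by
        rw [pow_succ, pow_succ]
        simp only [mul_sub, sub_mul, mul_assoc]
        abel
      have h0 : Raises Φ Φ 0 (K ^ k) := fun n x hx => Φ.mem_of_le (by lia) (hK.pow_mem k hx)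
      rw [h1]
      have h2 := (h0.mul h).add ((ih.mul hL).mono (show 0 + r ≤ r + 1 by lia))
      rwa [zero_add] at h2
  intro n x hx
  have e1 := ser_sub_sum_mem hK a (n + r) (D x)
  have e2 := hD _ _ (ser_sub_sum_mem hL a (n + r) x)
  have e3 : ∑ i ∈ Finset.range (n + r), PowerSeries.coeff i a • (K ^ i) (D x) -
      D (∑ i ∈ Finset.range (n + r), PowerSeries.coeff i a • (L ^ i) x) ∈ Φ.F (n + r) := by
    rw [map_sum, ← Finset.sum_sub_distrib]
    refine Submodule.sum_mem _ fun i _ => ?_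
    rw [map_smul, ← smul_sub]
    exact Submodule.smul_mem _ _ (hpow i n x hx)
  have := Submodule.sub_mem _ (Submodule.add_mem _ e1 e3) e2
  rw [map_sub] at this
  convert this using 1
  rw [LinearMap.sub_apply, Module.End.mul_apply, Module.End.mul_apply]
  abel

/-- Beyond its linear term, a series contributes to the twisted commutator only products carrying at
least one more factor `K` or `L`, each of which raises the filtration. Both exp − 1 and the
logarithm are thus linear to leading order. -/
theorem ser_intertwine_sub {K L D : Module.End ℝ M} {r : ℕ} (hK : Raises Φ Φ 1 K)
    (hL : Raises Φ Φ 1 L) (hD : Raises Φ Φ 0 D) (h : Raises Φ Φ r (K * D - D * L))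
    {a : PowerSeries ℝ} (h0 : PowerSeries.constantCoeff a = 0) (h1 : PowerSeries.coeff 1 a = 1) :
    Raises Φ Φ (r + 1) (ser Φ hK a * D - D * ser Φ hL a - (K * D - D * L)) := by
  obtain ⟨c, hc⟩ : (PowerSeries.X : PowerSeries ℝ) ^ 2 ∣ a - PowerSeries.X := by
    rw [PowerSeries.X_pow_dvd_iff]
    intro i hi
    interval_cases i
    · simp [h0]
    · simp [h1]
  have hl : a = PowerSeries.X + PowerSeries.X * (PowerSeries.X * c) := by
    rw [← mul_assoc, ← pow_two, ← hc]; ring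
  have hs := ser_intertwine hK hL hD h (PowerSeries.X * c)
  have e : ser Φ hK a * D - D * ser Φ hL a - (K * D - D * L) =
      K * (ser Φ hK (PowerSeries.X * c) * D - D * ser Φ hL (PowerSeries.X * c)) +
      (K * D - D * L) * ser Φ hL (PowerSeries.X * c) := by
    rw [hl, map_add, map_add, ser_X, ser_X, map_mul _ PowerSeries.X (_ * c),
      map_mul _ PowerSeries.X (_ * c), ser_X, ser_X]
    simp only [mul_add, add_mul, mul_sub, sub_mul, mul_assoc]
    abel
  rw [e]
  refine Raises.add ?_ ?_
  · have := hK.mul hs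
    rwa [add_comm] at this
  · exact h.mul (ser_raises hL hL (by simp))

theorem logOp_intertwine {A B D : Module.End ℝ M} {r : ℕ} (hA : Raises Φ Φ 1 (A - 1))
    (hB : Raises Φ Φ 1 (B - 1)) (hD : Raises Φ Φ 0 D) (h : Raises Φ Φ r (A * D - D * B)) :
    Raises Φ Φ (r + 1) (logOp Φ hA * D - D * logOp Φ hB - (A * D - D * B)) := by
  have h' : (A - 1) * D - D * (B - 1) = A * D - D * B := by
    simp only [sub_mul, mul_sub, one_mul, mul_one]; abel
  have := ser_intertwine_sub hA hB hD (by rwa [h']) constantCoeff_logSeries coeff_one_logSeries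
  rwa [h'] at this

theorem expOp_intertwine {K L D : Module.End ℝ M} {r : ℕ} (hK : Raises Φ Φ 1 K)
    (hL : Raises Φ Φ 1 L) (hD : Raises Φ Φ 0 D) (h : Raises Φ Φ r (K * D - D * L)) :
    Raises Φ Φ (r + 1) (expOp Φ hK * D - D * expOp Φ hL - (K * D - D * L)) := by
  have := ser_intertwine_sub hK hL hD h (a := PowerSeries.exp ℝ - 1) (by simp)
    (by simp [PowerSeries.coeff_exp, PowerSeries.coeff_one])
  rw [map_sub, map_one, map_sub, map_one] at this
  change Raises Φ Φ (r + 1) ((expOp Φ hK - 1) * D - D * (expOp Φ hL - 1) - _) at this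
  convert this using 1
  simp only [sub_mul, mul_sub, one_mul, mul_one]
  abel

end Intertwine

/-- Take (a, b) = log(A, B). To leading order a X_v − X_v b equals A X_v − X_v B, which is X_{w−v}
B, and B is the identity to leading order. Hence w − v and the tangent vector have the same part of
grade r. -/
theorem Rel.exists_tangent (hα : 1 ≤ α) {A B : Module.End ℝ (Ser m)} (hG : GPair m α A B)
    {v w : VF m} (hv : v ∈ stateSpace m) (hr : Rel A B v w) {r : ℕ}
    (hd : w - v ∈ (vfFilt m α).F (r + 1)) :
    ∃ a b, LPair m α a b ∧ tanAct a b v ∈ (vfFilt m α).F (r + 1) ∧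
      gradePart α r (tanAct a b v) = gradePart α r w - gradePart α r v := by
  have hD : Raises (serFilt m α) (serFilt m α) 0 (vder v) :=
    vder_raises (p := 0) (stateSpace_le_vfFilt hv)
  have hE : Raises (serFilt m α) (serFilt m α) r (vder (w - v)) := vder_raises hd
  have hθ : A * vder v - vder v * B = vder (w - v) * B := by
    refine LinearMap.ext fun f => ?_
    simp only [LinearMap.sub_apply, Module.End.mul_apply, map_sub, hr f]
  have hθr : Raises (serFilt m α) (serFilt m α) r (A * vder v - vder v * B) := by
    rw [hθ]; exact hE.mul hG.raisesB
  have h1 := logOp_intertwine hG.unipA hG.unipB hD hθr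
  have h2 : Raises (serFilt m α) (serFilt m α) (r + 1) (vder (w - v) * (B - 1)) :=
    hE.mul hG.unipB
  have hL := hG.log
  have h3 : vder (tanAct (logOp (serFilt m α) hG.unipA) (logOp (serFilt m α) hG.unipB) v -
      (w - v)) = logOp (serFilt m α) hG.unipA * vder v - vder v * logOp (serFilt m α) hG.unipB -
        (A * vder v - vder v * B) + vder (w - v) * (B - 1) := by
    rw [map_sub, hL.vder_tanAct hα (stateSpace_le_vfFilt hv), hθ, mul_sub, mul_one]
    abel
  have h4 : tanAct (logOp (serFilt m α) hG.unipA) (logOp (serFilt m α) hG.unipB) v - (w - v) ∈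
      (vfFilt m α).F (r + 2) := by
    rw [mem_vfFilt]
    intro j
    rw [← vder_X_inl (_ - _) j, h3]
    have := (h1.add h2) _ _ (X_mem_serFilt (α := α) (Sum.inl j))
    exact (serFilt m α).mem_of_le (by simp [varWt]; lia) this
  refine ⟨_, _, hL, ?_, ?_⟩
  · have := Submodule.add_mem _ ((vfFilt m α).mem_of_le (Nat.le_succ _) h4) hd
    rwa [sub_add_cancel] at this
  · rw [gradePart_eq_of_sub_mem h4, map_sub]

theorem Rel.gradePart_sub_mem_removable (hα : 1 ≤ α) {A B : Module.End ℝ (Ser m)}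
    (hG : GPair m α A B) {v w : VF m} (hv : v ∈ stateSpace m)
    (hH : MvPowerSeries.coeff (zExp m) (v 0) ≠ 0) (hr : Rel A B v w) {r : ℕ}
    (hd : w - v ∈ (vfFilt m α).F (r + 1)) :
    gradePart α r w - gradePart α r v ∈ removable α v r r := by
  rw [mem_removable_iff hα hv hH]
  exact hr.exists_tangent hα hG hv hd

/-! ### Formal basis style complements -/

theorem basisField_zero (b : BasisIndex m) : basisField b 0 =
    MvPowerSeries.monomial b.1.2 (if b.1.1 then Complex.I else 1) := rfl

theorem basisField_one (b : BasisIndex m) : basisField b 1 =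
    MvPowerSeries.monomial (swapExp b.1.2) (conj (if b.1.1 then Complex.I else 1)) := rfl

theorem basisField_mem_stateGrade (b : BasisIndex m) :
    basisField b ∈ stateGrade α (basisGrade α b) := by
  classical
  obtain ⟨⟨t, e⟩, ha, hz⟩ := b
  have hsw : ∀ e' : Expo m, swapExp e' = e ↔ e' = swapExp e := fun e' =>
    ⟨fun h => by rw [← h, swapExp_swapExp], fun h => by rw [h, swapExp_swapExp]⟩
  refine ⟨⟨fun e' => ?_, fun e' he' => ?_, ?_⟩, fun i e' he' => ?_⟩
  · rw [basisField_zero, basisField_one, MvPowerSeries.coeff_monomial,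
      MvPowerSeries.coeff_monomial]
    simp only [hsw]
    split_ifs <;> simp
  · rw [basisField_zero, MvPowerSeries.coeff_monomial] at he'
    split_ifs at he' with h <;> simp_all
  · rw [basisField_zero, MvPowerSeries.coeff_monomial]
    split_ifs with h1 h2
    · exact Complex.I_re
    · exact absurd (hz h1.symm) h2
    · rfl
  · fin_cases i
    · change MvPowerSeries.coeff e' (basisField _ 0) = 0
      rw [basisField_zero, MvPowerSeries.coeff_monomial, if_neg]
      rintro rfl
      exact he' rfl
    · change MvPowerSeries.coeff e' (basisField _ 1) = 0
      rw [basisField_one, MvPowerSeries.coeff_monomial, if_neg]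
      rintro rfl
      exact he' (by rw [wt_swapExp]; rfl)

theorem styleSpan_mono (ord : ℕ ≃ BasisIndex m) (n : ℤ) (W : Submodule ℝ (VF m)) :
    Monotone (styleSpan α ord n W) := by
  refine monotone_nat_of_le_succ fun k => ?_
  rw [styleSpan]
  split_ifs
  · exact le_sup_left
  · exact le_rfl

theorem styleSpan_le (ord : ℕ ≃ BasisIndex m) (n : ℤ) (W : Submodule ℝ (VF m)) {V : Submodule ℝ (VF m)}
    (hV : ∀ b : BasisIndex m, basisGrade α b = n → basisField b ∉ W → basisField b ∈ V) (k : ℕ) :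
    styleSpan α ord n W k ≤ V := by
  induction k with
  | zero => exact bot_le
  | succ k ih =>
    rw [styleSpan]
    split_ifs with h
    · refine sup_le ih ?_
      rw [Submodule.span_singleton_le_iff_mem]
      exact hV _ h.1 fun hW => h.2 (Submodule.mem_sup_left hW)
    · exact ih

theorem styleComplement_le (ord : ℕ ≃ BasisIndex m) (n : ℤ) (W : Submodule ℝ (VF m))
    {V : Submodule ℝ (VF m)}
    (hV : ∀ b : BasisIndex m, basisGrade α b = n → basisField b ∉ W → basisField b ∈ V) :
    styleComplement α ord n W ≤ V :=
  iSup_le (styleSpan_le ord n W hV)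

theorem styleComplement_le_stateGrade (ord : ℕ ≃ BasisIndex m) (n : ℤ) (W : Submodule ℝ (VF m)) :
    styleComplement α ord n W ≤ stateGrade α n :=
  styleComplement_le ord n W fun b hb _ => hb ▸ basisField_mem_stateGrade b

theorem disjoint_sup_span {V : Type*} [AddCommGroup V] [Module ℝ V] {N W : Submodule ℝ V} {b : V}
    (h : Disjoint N W) (hb : b ∉ W ⊔ N) : Disjoint (N ⊔ Submodule.span ℝ {b}) W := by
  rw [Submodule.disjoint_def] at h ⊢
  intro x hx hxW
  obtain ⟨y, hy, z, hz, rfl⟩ := Submodule.mem_sup.1 hx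
  obtain ⟨c, rfl⟩ := Submodule.mem_span_singleton.1 hz
  by_cases hc : c = 0
  · subst hc
    rw [zero_smul, add_zero] at hxW ⊢
    exact h y hy hxW
  · exfalso
    apply hb
    have h1 : c • b ∈ W ⊔ N := by
      have := Submodule.sub_mem _ (Submodule.mem_sup_left (T := N) hxW)
        (Submodule.mem_sup_right (S := W) hy)
      rwa [add_sub_cancel_left] at this
    have := Submodule.smul_mem _ c⁻¹ h1
    rwa [smul_smul, inv_mul_cancel₀ hc, one_smul] at this

theorem disjoint_styleComplement (ord : ℕ ≃ BasisIndex m) (n : ℤ) (W : Submodule ℝ (VF m)) :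
    Disjoint (styleComplement α ord n W) W := by
  have hk : ∀ k, Disjoint (styleSpan α ord n W k) W := by
    intro k
    induction k with
    | zero => exact disjoint_bot_left
    | succ k ih =>
      rw [styleSpan]
      split_ifs with h
      · exact disjoint_sup_span ih h.2
      · exact ih
  rw [Submodule.disjoint_def]
  intro x hx hxW
  rw [styleComplement, Submodule.mem_iSup_of_directed _ (styleSpan_mono ord n W).directed_le] at hx
  obtain ⟨k, hk'⟩ := hx
  exact Submodule.disjoint_def.1 (hk k) x hk' hxW

theorem basisField_mem_sup (ord : ℕ ≃ BasisIndex m) (n : ℤ) (W : Submodule ℝ (VF m))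
    (b : BasisIndex m) (hb : basisGrade α b = n) :
    basisField b ∈ styleComplement α ord n W ⊔ W := by
  obtain ⟨k, rfl⟩ := ord.surjective b
  by_cases h : basisField (ord k) ∈ W ⊔ styleSpan α ord n W k
  · rw [sup_comm] at h
    exact sup_le_sup_right (le_iSup (styleSpan α ord n W) k) W h
  · refine Submodule.mem_sup_left (le_iSup (styleSpan α ord n W) (k + 1) ?_)
    rw [styleSpan, if_pos ⟨hb, h⟩]
    exact Submodule.mem_sup_right (Submodule.mem_span_singleton_self _)

theorem stateGrade_le_of_basisField (hα : 1 ≤ α) {n : ℕ} {V : Submodule ℝ (VF m)}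
    (hV : ∀ b : BasisIndex m, basisGrade α b = n → basisField b ∈ V) :
    stateGrade α (n : ℤ) ≤ V := by
  classical
  intro x hx
  -- With c the coefficient of x at e, `t e` is Re c times the X-field plus Im c times the Y-field.
  -- At e = z there is no X-field, but there c is imaginary.
  let t : Expo m → VF m := fun e => ![MvPowerSeries.monomial e (MvPowerSeries.coeff e (x 0)),
    MvPowerSeries.monomial (swapExp e) (conj (MvPowerSeries.coeff e (x 0)))]
  have ht : ∀ e, t e ∈ V := by
    intro e
    by_cases hc : MvPowerSeries.coeff e (x 0) = 0
    · have : t e = 0 := by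
        funext i; fin_cases i <;> simp [t, hc]
      rw [this]; exact Submodule.zero_mem _
    · have ha := hx.1.2.1 e hc
      have hg : (wt α e : ℤ) - 1 = n := by
        by_contra h
        exact hc (hx.2 0 e h)
      have h1 : (MvPowerSeries.coeff e (x 0)).im • basisField ⟨(true, e), ha, fun _ => rfl⟩ ∈ V :=
        Submodule.smul_mem _ _ (hV _ hg)
      by_cases hz : e = zExp m
      · convert h1 using 1
        have hre : (MvPowerSeries.coeff e (x 0)).re = 0 := by rw [hz]; exact hx.1.2.2
        have hcc : MvPowerSeries.coeff e (x 0) =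
          (MvPowerSeries.coeff e (x 0)).im • Complex.I := by apply Complex.ext <;> simp [hre]
        funext i
        ext e'
        fin_cases i
        · change MvPowerSeries.coeff e' (MvPowerSeries.monomial e _) =
            (MvPowerSeries.coeff e (x 0)).im • MvPowerSeries.coeff e' (basisField _ 0)
          rw [basisField_zero, MvPowerSeries.coeff_monomial, MvPowerSeries.coeff_monomial]
          by_cases he : e' = e
          · rw [if_pos he, if_pos he]
            exact hcc
          · rw [if_neg he, if_neg he, smul_zero]
        · change MvPowerSeries.coeff e' (MvPowerSeries.monomial (swapExp e) _) =
            (MvPowerSeries.coeff e (x 0)).im • MvPowerSeries.coeff e' (basisField _ 1)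
          rw [basisField_one, MvPowerSeries.coeff_monomial, MvPowerSeries.coeff_monomial]
          by_cases he : e' = swapExp e
          · rw [if_pos he, if_pos he]
            conv_lhs => rw [hcc]
            simp
          · rw [if_neg he, if_neg he, smul_zero]
      · have h2 : (MvPowerSeries.coeff e (x 0)).re •
            basisField ⟨(false, e), ha, fun h => absurd h hz⟩ ∈ V :=
          Submodule.smul_mem _ _ (hV _ hg)
        have h3 := Submodule.add_mem _ h1 h2
        convert h3 using 1
        funext i
        ext e'
        fin_cases i
        · change MvPowerSeries.coeff e' (MvPowerSeries.monomial e _) =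
            (MvPowerSeries.coeff e (x 0)).im • MvPowerSeries.coeff e' (basisField _ 0) +
            (MvPowerSeries.coeff e (x 0)).re • MvPowerSeries.coeff e' (basisField _ 0)
          rw [basisField_zero, basisField_zero, MvPowerSeries.coeff_monomial,
            MvPowerSeries.coeff_monomial, MvPowerSeries.coeff_monomial]
          by_cases he : e' = e
          · rw [if_pos he, if_pos he, if_pos he]
            apply Complex.ext <;> simp
          · rw [if_neg he, if_neg he, if_neg he, smul_zero, smul_zero, add_zero]
        · change MvPowerSeries.coeff e' (MvPowerSeries.monomial (swapExp e) _) =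
            (MvPowerSeries.coeff e (x 0)).im • MvPowerSeries.coeff e' (basisField _ 1) +
            (MvPowerSeries.coeff e (x 0)).re • MvPowerSeries.coeff e' (basisField _ 1)
          rw [basisField_one, basisField_one, MvPowerSeries.coeff_monomial,
            MvPowerSeries.coeff_monomial, MvPowerSeries.coeff_monomial]
          by_cases he : e' = swapExp e
          · rw [if_pos he, if_pos he, if_pos he]
            apply Complex.ext <;> simp
          · rw [if_neg he, if_neg he, if_neg he, smul_zero, smul_zero, add_zero]
  -- A field of grade n has weight n + 1, so the finitely many exponents of weight below n + 2
  -- suffice.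
  have hsum : x = ∑ e ∈ (finite_wt_lt (m := m) hα (n + 2)).toFinset, t e := by
    have hsw : ∀ e e' : Expo m, e' = swapExp e ↔ e = swapExp e' := fun e e' =>
      ⟨fun h => by rw [h, swapExp_swapExp], fun h => by rw [h, swapExp_swapExp]⟩
    funext i
    ext e'
    rw [Finset.sum_apply, map_sum]
    fin_cases i
    · change MvPowerSeries.coeff e' (x 0) = ∑ e ∈ _, MvPowerSeries.coeff e'
        (MvPowerSeries.monomial e (MvPowerSeries.coeff e (x 0)))
      simp only [MvPowerSeries.coeff_monomial]
      rw [Finset.sum_ite_eq]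
      split_ifs with h
      · rfl
      · refine hx.2 0 e' fun h' => h ?_
        simp
        lia
    · change MvPowerSeries.coeff e' (x 1) = ∑ e ∈ _, MvPowerSeries.coeff e'
        (MvPowerSeries.monomial (swapExp e) (conj (MvPowerSeries.coeff e (x 0))))
      simp only [MvPowerSeries.coeff_monomial, hsw]
      rw [Finset.sum_ite_eq']
      split_ifs with h
      · exact hx.1.1 e'
      · refine hx.2 1 e' fun h' => h ?_
        simp [wt_swapExp]
        lia
  rw [hsum]
  exact Submodule.sum_mem _ fun e _ => ht e

theorem styleComplement_sup (hα : 1 ≤ α) (ord : ℕ ≃ BasisIndex m) {n : ℕ}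
    {W : Submodule ℝ (VF m)} (hW : W ≤ stateGrade α (n : ℤ)) :
    styleComplement α ord n W ⊔ W = stateGrade α (n : ℤ) :=
  le_antisymm (sup_le (styleComplement_le_stateGrade ord n W) hW)
    (stateGrade_le_of_basisField hα fun b hb => basisField_mem_sup ord n W b hb)

/-! ### Pages of the spectral sequence -/

theorem removable_le_stateGrade (v : VF m) (r : ℕ) :
    removable α v r r ≤ stateGrade α (r : ℤ) := by
  rintro _ ⟨y, hy, rfl⟩
  exact gradePart_mem_stateGrade hy.1.1 _

theorem specZ_bot {r p : ℤ} : specZ (stateFilt (m := m) α) (fun _ => (⊥ : Submodule ℝ PUnit.{1}))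
    (0 : VF m →ₗ[ℝ] PUnit.{1}) r p = stateFilt α p := by
  rw [specZ, inf_eq_left]
  intro x _
  simp

/-- The complex ends after the state space, so every element is a cocycle on every page. The
boundaries coincide by `genFilt_sub_eq`. -/
theorem pageEInf_eq (v : VF m) (r : ℕ) : pageEInf α v r = pageE α v r r := by
  have h : ∀ p, specZInf (stateFilt (m := m) α) (0 : VF m →ₗ[ℝ] PUnit.{1}) p = stateFilt α p := by
    intro p
    rw [specZInf, LinearMap.ker_zero, inf_top_eq]
  rw [pageEInf, pageE, specEInf, specE, h, h, specZ_bot, specZ_bot, specBInf, specB,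
    genFilt_sub_eq]

theorem pageE_num (v : VF m) (r : ℕ) : (pageE α v r r).num = stateFilt α r :=
  specZ_bot (r := r) (p := r)

theorem mem_pageE_den (v : VF m) (r : ℕ) (x : VF m) : x ∈ (pageE α v r r).den ↔
    ∃ y ∈ stateFilt α ((r : ℤ) + 1), ∃ z ∈ specB (genFilt α) (stateFilt α) (diffl v) (r - 1) r,
      y + z = x := by
  have : (pageE α v r r).den = stateFilt α ((r : ℤ) + 1) ⊔
      specB (genFilt α) (stateFilt α) (diffl v) (r - 1) r := by
    rw [← specZ_bot (r := (r : ℤ) - 1)]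
    rfl
  rw [this, Submodule.mem_sup]

theorem stateGrade_le_num (v : VF m) (r : ℕ) :
    stateGrade α (r : ℤ) ≤ (pageE α v r r).num := by
  rw [pageE_num]
  exact fun x hx => mem_stateFilt_iff.2 ⟨hx.1, stateGrade_le_vfFilt hx⟩

theorem sub_gradePart_mem_stateFilt {v : VF m} {r : ℕ} (h : v ∈ stateFilt α (r : ℤ)) :
    v - gradePart α r v ∈ stateFilt α ((r : ℤ) + 1) := by
  have h' := mem_stateFilt_iff.1 h
  exact mem_stateFilt_iff (p := r + 1).2
    ⟨Submodule.sub_mem _ h'.1 (gradePart_mem_stateSpace h'.1 _), sub_gradePart_mem h'.2⟩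

theorem mem_den_iff_of_mem_stateGrade (v : VF m) (r : ℕ) {x : VF m}
    (hx : x ∈ stateGrade α (r : ℤ)) :
    x ∈ (pageE α v r r).den ↔ x ∈ removable α v r r := by
  rw [mem_pageE_den]
  constructor
  · rintro ⟨y, hy, z, hz, rfl⟩
    refine ⟨z, hz, ?_⟩
    have hy' : gradePart α r y = 0 :=
      gradePart_zero_of_mem (mem_stateFilt_iff (p := r + 1).1 hy).2
    rw [← gradePart_eq_self hx, map_add, hy', zero_add]
  · rintro ⟨z, hz, rfl⟩
    refine ⟨gradePart α r z - z, ?_, z, hz, sub_add_cancel _ _⟩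
    rw [← neg_sub]
    exact Submodule.neg_mem _ (sub_gradePart_mem_stateFilt hz.1)

theorem ofLE_eq_zero_iff (v : VF m) (r : ℕ) {W : Submodule ℝ (VF m)}
    (hW : W ≤ stateGrade α (r : ℤ)) (h : W ≤ (pageE α v r r).num) (x : W) :
    (pageE α v r r).ofLE W h x = 0 ↔ (x : VF m) ∈ removable α v r r := by
  rw [← mem_den_iff_of_mem_stateGrade v r (hW x.2)]
  change Submodule.Quotient.mk _ = 0 ↔ _
  rw [Submodule.Quotient.mk_eq_zero]
  rfl

theorem ofLE_stateGrade_surjective (v : VF m) (r : ℕ)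
    (h : stateGrade α (r : ℤ) ≤ (pageE α v r r).num) :
    Function.Surjective ((pageE α v r r).ofLE (stateGrade α r) h) := by
  intro q
  obtain ⟨⟨y, hy⟩, rfl⟩ := Submodule.mkQ_surjective _ q
  have hy' : y ∈ stateFilt α (r : ℤ) := by rwa [pageE_num] at hy
  refine ⟨⟨gradePart α r y, gradePart_mem_stateGrade (mem_stateFilt_iff.1 hy').1 _⟩, ?_⟩
  change Submodule.Quotient.mk _ = Submodule.Quotient.mk _
  rw [Submodule.Quotient.eq]
  change gradePart α r y - y ∈ (pageE α v r r).den
  rw [mem_pageE_den]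
  refine ⟨_, ?_, 0, Submodule.zero_mem _, add_zero _⟩
  rw [← neg_sub]
  exact Submodule.neg_mem _ (sub_gradePart_mem_stateFilt hy')

theorem normalSpace_le_stateGrade (ord : ℕ ≃ BasisIndex m) (v : VF m) (r : ℕ) :
    normalSpace α ord v r r ≤ stateGrade α (r : ℤ) := styleComplement_le_stateGrade _ _ _

theorem ofLE_normalSpace_bijective (hα : 1 ≤ α) (ord : ℕ ≃ BasisIndex m) (v : VF m) (r : ℕ)
    (h : normalSpace α ord v r r ≤ (pageE α v r r).num) :
    Function.Bijective ((pageE α v r r).ofLE (normalSpace α ord v r r) h) := by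
  constructor
  · rw [injective_iff_map_eq_zero]
    intro x hx
    rw [ofLE_eq_zero_iff v r (normalSpace_le_stateGrade ord v r)] at hx
    exact Subtype.ext (Submodule.disjoint_def.1 (disjoint_styleComplement ord r _) _ x.2 hx)
  · intro q
    obtain ⟨⟨y, hy⟩, rfl⟩ := ofLE_stateGrade_surjective v r (stateGrade_le_num v r) q
    have hy' := hy
    rw [← styleComplement_sup hα ord (removable_le_stateGrade v r), Submodule.mem_sup] at hy'
    obtain ⟨n, hn, t, ht, rfl⟩ := hy'
    refine ⟨⟨n, hn⟩, ?_⟩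
    change Submodule.Quotient.mk _ = Submodule.Quotient.mk _
    rw [Submodule.Quotient.eq]
    change n - (n + t) ∈ (pageE α v r r).den
    rw [sub_add_cancel_left]
    exact Submodule.neg_mem _
      ((mem_den_iff_of_mem_stateGrade v r (removable_le_stateGrade v r ht)).2 ht)

/-! ### Substitutions -/

/-- The difference estimate is inductive through xy − x′y′ = (x − x′)y + x′(y − y′), which needs the
size of y and x′ as well; hence the joint statement. -/
theorem prod_pow_sub_mem {a a' : Var m → Ser m} {p : ℕ}
    (ha : ∀ s, a s ∈ (serFilt m α).F (varWt m α s))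
    (ha' : ∀ s, a' s ∈ (serFilt m α).F (varWt m α s))
    (h : ∀ s, a s - a' s ∈ (serFilt m α).F (varWt m α s + p)) (d : Expo m) :
    (d.prod fun s n => a s ^ n) ∈ (serFilt m α).F (wt α d) ∧
    (d.prod fun s n => a' s ^ n) ∈ (serFilt m α).F (wt α d) ∧
    (d.prod fun s n => a s ^ n) - (d.prod fun s n => a' s ^ n) ∈
      (serFilt m α).F (wt α d + p) := by
  classical
  have hstep : ∀ {i j : ℕ} {x x' y y' : Ser m}, x ∈ (serFilt m α).F i → x' ∈ (serFilt m α).F i →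
      x - x' ∈ (serFilt m α).F (i + p) → y ∈ (serFilt m α).F j → y' ∈ (serFilt m α).F j →
      y - y' ∈ (serFilt m α).F (j + p) → x * y - x' * y' ∈ (serFilt m α).F (i + j + p) := by
    intro i j x x' y y' hx hx' hxx hy hy' hyy
    have h1 := mul_mem_serFilt hxx hy
    have h2 := mul_mem_serFilt hx' hyy
    rw [show i + p + j = i + j + p by ring] at h1
    rw [← add_assoc] at h2
    have h3 : x * y - x' * y' = (x - x') * y + x' * (y - y') := by ring
    exact h3 ▸ Submodule.add_mem _ h1 h2
  induction d using Finsupp.induction_linear with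
  | zero => simp [wt_zero, (serFilt m α).mem_zero]
  | add d d' hd hd' =>
    obtain ⟨h1, h2, h3⟩ := hd
    obtain ⟨h1', h2', h3'⟩ := hd'
    have hp : ∀ b : Var m → Ser m, ((d + d').prod fun s n => b s ^ n) =
        (d.prod fun s n => b s ^ n) * d'.prod fun s n => b s ^ n := fun b =>
      Finsupp.prod_add_index' (fun _ => pow_zero _) (fun _ _ _ => pow_add _ _ _)
    rw [hp, hp, wt_add]
    exact ⟨mul_mem_serFilt h1 h1', mul_mem_serFilt h2 h2', hstep h1 h2 h3 h1' h2' h3'⟩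
  | single s n =>
    have hp : ∀ b : Var m → Ser m, ((Finsupp.single s n).prod fun s n => b s ^ n) = b s ^ n :=
      fun b => Finsupp.prod_single_index (pow_zero _)
    rw [hp, hp]
    clear hp
    induction n with
    | zero => simp [wt_zero, (serFilt m α).mem_zero]
    | succ n ih =>
      obtain ⟨h1, h2, h3⟩ := ih
      rw [Finsupp.single_add, wt_add, wt_single, pow_succ, pow_succ]
      exact ⟨mul_mem_serFilt h1 (ha s), mul_mem_serFilt h2 (ha' s),
        hstep h1 h2 h3 (ha s) (ha' s) (h s)⟩

theorem hasSubst_of_mem (hα : 1 ≤ α) {a : Var m → Ser m}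
    (ha : ∀ s, a s ∈ (serFilt m α).F (varWt m α s)) : MvPowerSeries.HasSubst a := by
  refine MvPowerSeries.hasSubst_of_constantCoeff_zero fun s => ?_
  refine ha s 0 ?_
  rw [wt_zero]
  rcases s with s | s
  · exact Nat.one_pos
  · exact hα

theorem subst_sub_subst_mem (hα : 1 ≤ α) {a a' : Var m → Ser m} {p n : ℕ}
    (ha : ∀ s, a s ∈ (serFilt m α).F (varWt m α s))
    (ha' : ∀ s, a' s ∈ (serFilt m α).F (varWt m α s))
    (h : ∀ s, a s - a' s ∈ (serFilt m α).F (varWt m α s + p)) {f : Ser m}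
    (hf : f ∈ (serFilt m α).F n) :
    MvPowerSeries.subst a f - MvPowerSeries.subst a' f ∈ (serFilt m α).F (n + p) := by
  intro e he
  change MvPowerSeries.coeff e _ = 0
  rw [map_sub, MvPowerSeries.coeff_subst (hasSubst_of_mem hα ha),
    MvPowerSeries.coeff_subst (hasSubst_of_mem hα ha'), sub_eq_zero]
  refine finsum_congr fun d => ?_
  by_cases hd : wt α d < n
  · rw [mem_serFilt.1 hf d hd, zero_smul, zero_smul]
  · have := (prod_pow_sub_mem ha ha' h d).2.2 e (by lia)
    change MvPowerSeries.coeff e _ = 0 at this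
    rw [map_sub, sub_eq_zero] at this
    rw [this]

/-- Substitution as an operator. -/
def substOp {a : Var m → Ser m} (ha : MvPowerSeries.HasSubst a) : Module.End ℝ (Ser m) :=
  (MvPowerSeries.substAlgHom (R := ℂ) ha).toLinearMap.restrictScalars ℝ

theorem substOp_apply {a : Var m → Ser m} (ha : MvPowerSeries.HasSubst a) (f : Ser m) :
    substOp ha f = MvPowerSeries.subst a f := by
  rw [← MvPowerSeries.coe_substAlgHom ha]; rfl

theorem substOp_mul {a : Var m → Ser m} (ha : MvPowerSeries.HasSubst a) (f g : Ser m) :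
    substOp ha (f * g) = substOp ha f * substOp ha g :=
  map_mul (MvPowerSeries.substAlgHom (R := ℂ) ha) f g

theorem substOp_C {a : Var m → Ser m} (ha : MvPowerSeries.HasSubst a) (c : ℂ) :
    substOp ha (MvPowerSeries.C c) = MvPowerSeries.C c :=
  (MvPowerSeries.substAlgHom (R := ℂ) ha).commutes c

theorem substOp_X {a : Var m → Ser m} (ha : MvPowerSeries.HasSubst a) (s : Var m) :
    substOp ha (MvPowerSeries.X s) = a s := by
  rw [substOp_apply, MvPowerSeries.subst_X ha]

theorem substOp_commute_iOp {a : Var m → Ser m} (ha : MvPowerSeries.HasSubst a) :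
    Commute (substOp ha) iOp :=
  LinearMap.ext fun f => map_smul (MvPowerSeries.substAlgHom (R := ℂ) ha) Complex.I f

/-- The values of a change of parameters on the variables. -/
def paramVal (P : Fin m → Ser m) : Var m → Ser m :=
  Sum.elim (fun j => MvPowerSeries.X (Sum.inl j)) (fun l => MvPowerSeries.X (Sum.inr l) + P l)

theorem paramVal_mem {P : Fin m → Ser m} (hP : ∀ l, P l ∈ (serFilt m α).F α) (s : Var m) :
    paramVal P s ∈ (serFilt m α).F (varWt m α s) := by
  rcases s with s | s
  · exact X_mem_serFilt (Sum.inl s)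
  · exact Submodule.add_mem _ (X_mem_serFilt (Sum.inr s)) (hP s)

theorem paramVal_sub_mem {P P' : Fin m → Ser m} {p : ℕ}
    (h : ∀ l, P l - P' l ∈ (serFilt m α).F (α + p)) (s : Var m) :
    paramVal P s - paramVal P' s ∈ (serFilt m α).F (varWt m α s + p) := by
  rcases s with s | s
  · simp [paramVal]
  · change (MvPowerSeries.X (Sum.inr s) + P s) - (MvPowerSeries.X (Sum.inr s) + P' s) ∈ _
    rw [add_sub_add_left_eq_sub]
    exact h s

/-- Real changes of parameters tangent to the identity. -/
structure IsParam (α : ℕ) (P : Fin m → Ser m) : Prop where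
  real : ∀ l, conjOp (P l) = P l
  axis : ∀ l, axisOp (P l) = P l
  mem : ∀ l, P l ∈ (serFilt m α).F (α + 1)

theorem IsParam.mem_val {P : Fin m → Ser m} (h : IsParam α P) (s : Var m) :
    paramVal P s ∈ (serFilt m α).F (varWt m α s) :=
  paramVal_mem (fun l => (serFilt m α).mem_of_le (Nat.le_succ _) (h.mem l)) s

theorem IsParam.hasSubst (hα : 1 ≤ α) {P : Fin m → Ser m} (h : IsParam α P) :
    MvPowerSeries.HasSubst (paramVal P) := hasSubst_of_mem hα h.mem_val

/-- The operator of a change of parameters. -/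
def paramOp (hα : 1 ≤ α) {P : Fin m → Ser m} (h : IsParam α P) : Module.End ℝ (Ser m) :=
  substOp (h.hasSubst hα)

theorem paramOp_sub_mem (hα : 1 ≤ α) {P P' : Fin m → Ser m} (h : IsParam α P) (h' : IsParam α P')
    {p : ℕ} (hp : ∀ l, P l - P' l ∈ (serFilt m α).F (α + p)) (f : Ser m) :
    paramOp hα h f - paramOp hα h' f ∈ (serFilt m α).F p := by
  have := subst_sub_subst_mem hα h.mem_val h'.mem_val (paramVal_sub_mem hp)
    ((serFilt m α).mem_zero f)
  rw [zero_add] at this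
  rwa [paramOp, paramOp, substOp_apply, substOp_apply]

theorem paramOp_unip (hα : 1 ≤ α) {P : Fin m → Ser m} (h : IsParam α P) :
    Raises (serFilt m α) (serFilt m α) 1 (paramOp hα h - 1) := by
  intro n f hf
  have := subst_sub_subst_mem hα (a' := paramVal 0) (p := 1) h.mem_val
    (paramVal_mem fun l => Submodule.zero_mem _)
    (paramVal_sub_mem fun l => by simpa using h.mem l) hf
  have h0 : (paramVal 0 : Var m → Ser m) = MvPowerSeries.X := by
    funext s
    rcases s with s | s <;> simp [paramVal]
  rw [h0, MvPowerSeries.subst_self] at this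
  rwa [LinearMap.sub_apply, paramOp, substOp_apply, Module.End.one_apply]

theorem paramOp_gPair (hα : 1 ≤ α) {P : Fin m → Ser m} (h : IsParam α P) :
    GPair m α (paramOp hα h) (paramOp hα h) := by
  have hr := (paramOp_unip hα h).of_sub_one
  have hs : IsStruct (paramOp hα h) := by
    refine ⟨⟨substOp_commute_iOp _, ?_⟩, ?_⟩
    · refine end_ext hα (hr.mul (conjOp_raises α)) ((conjOp_raises α).mul hr) (fun c => ?_)
        fun f s hf => ?_
      · rw [Module.End.mul_apply, Module.End.mul_apply, conjOp_C, paramOp, substOp_C, substOp_C,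
          conjOp_C]
      · simp only [Module.End.mul_apply] at hf ⊢
        rw [conjOp_mul, paramOp, substOp_mul, substOp_mul, conjOp_mul]
        rw [paramOp] at hf
        rw [hf, conjOp_X, substOp_X, substOp_X]
        congr 1
        rcases s with s | s
        · change _ = conjOp (MvPowerSeries.X _)
          rw [conjOp_X]; rfl
        · change _ = conjOp (MvPowerSeries.X _ + P s)
          rw [map_add, conjOp_X, h.real]; rfl
    · refine end_ext hα (hr.mul (axisOp_raises α)) ((axisOp_raises α).mul hr) (fun c => ?_)
        fun f s hf => ?_
      · rw [Module.End.mul_apply, Module.End.mul_apply, axisOp_C, paramOp, substOp_C, axisOp_C]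
      · simp only [Module.End.mul_apply] at hf ⊢
        rw [axisOp_mul, paramOp, substOp_mul, substOp_mul, axisOp_mul]
        rw [paramOp] at hf
        rw [hf, substOp_X]
        congr 1
        rcases s with s | s
        · change _ = axisOp (MvPowerSeries.X _)
          rw [axisOp_X_inl, map_zero]
        · change _ = axisOp (MvPowerSeries.X _ + P s)
          rw [map_add, axisOp_X_inr, h.axis, substOp_X]; rfl
  exact ⟨paramOp_unip hα h, paramOp_unip hα h, substOp_mul _, substOp_mul _, hs.toIsReal, hs⟩

theorem paramMap_eq (hα : 1 ≤ α) {P : Fin m → Ser m} (h : IsParam α P) (v : VF m) (i : Fin 2) :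
    paramMap P v i = paramOp hα h (v i) := by
  rw [paramOp, substOp_apply]; rfl

theorem paramOp_X_inl (hα : 1 ≤ α) {P : Fin m → Ser m} (h : IsParam α P) (j : Fin 2) :
    paramOp hα h (MvPowerSeries.X (Sum.inl j)) = MvPowerSeries.X (Sum.inl j) := substOp_X _ _

theorem paramOp_X_inr (hα : 1 ≤ α) {P : Fin m → Ser m} (h : IsParam α P) (l : Fin m) :
    paramOp hα h (MvPowerSeries.X (Sum.inr l)) = MvPowerSeries.X (Sum.inr l) + P l := substOp_X _ _

theorem rel_paramMap (hα : 1 ≤ α) {P : Fin m → Ser m} (h : IsParam α P) {v : VF m}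
    (hv : v ∈ (vfFilt m α).F 1) : Rel (paramOp hα h) (paramOp hα h) v (paramMap P v) := by
  have hr := (paramOp_gPair hα h).rel_act hα hv
  convert hr using 1
  funext i
  have h1 := hr (MvPowerSeries.X (Sum.inl i))
  rw [paramOp_X_inl, vder_X_inl, vder_X_inl] at h1
  rw [h1, paramMap_eq hα h]

/-! ### State maps -/

/-- The operator `u ↦ [S, u]`. -/
def adOp (S : VF m) : Module.End ℝ (VF m) where
  toFun := bracket S
  map_add' u v := by
    funext i
    simp only [bracket_apply, Pi.add_apply, map_add, LinearMap.add_apply]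
    ring
  map_smul' c u := by
    funext i
    simp only [bracket_apply, Pi.smul_apply, map_smul, LinearMap.smul_apply, RingHom.id_apply,
      smul_sub]

theorem adOp_raises {S : VF m} {p : ℕ} (hS : S ∈ (vfFilt m α).F (p + 1)) :
    Raises (vfFilt m α) (vfFilt m α) p (adOp S) := by
  intro n u hu
  rw [mem_vfFilt]
  intro i
  change bracket S u i ∈ _
  rw [bracket_apply]
  refine Submodule.sub_mem _ ?_ (vder_raises hS _ _ (mem_vfFilt.1 hu i))
  exact (serFilt m α).mem_of_le (show n + p ≤ n + (p + 1) - 1 by lia)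
    (vder_mem hu (mem_vfFilt.1 hS i))

theorem adOp_iterate (S : VF m) (n : ℕ) (u : VF m) : (bracket S)^[n] u = (adOp S ^ n) u := by
  induction n generalizing u with
  | zero => rfl
  | succ n ih => rw [Function.iterate_succ_apply, ih, pow_succ, Module.End.mul_apply]; rfl

/-- Each application of ad_S raises the weight, so the coefficient at e sees only iterates up to `wt
α e`, and the finitary sum is a partial sum of the operator exponential. -/
theorem stateMap_eq {S : VF m} (hS : S ∈ (vfFilt m α).F 2) (v : VF m) :
    stateMap S v = expOp (vfFilt m α) (adOp_raises (p := 1) hS) v := by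
  funext i
  ext e
  have h0 : ∀ n, wt α e < n → MvPowerSeries.coeff e ((adOp S ^ n) v i) = 0 := by
    intro n hn
    have := (adOp_raises (p := 1) hS).pow_mem n ((vfFilt m α).mem_zero v)
    rw [zero_add] at this
    exact mem_vfFilt.1 this i e hn
  have h1 := ser_sub_sum_mem (adOp_raises (p := 1) hS) (PowerSeries.exp ℝ) (wt α e + 1) v
  have h2 := mem_vfFilt.1 h1 i e (Nat.lt_succ_self _)
  change MvPowerSeries.coeff e _ = 0 at h2
  rw [Pi.sub_apply, map_sub, sub_eq_zero] at h2
  change _ = MvPowerSeries.coeff e (ser (vfFilt m α) (adOp_raises (p := 1) hS)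
    (PowerSeries.exp ℝ) v i)
  rw [h2, Finset.sum_apply, map_sum]
  change (∑ᶠ n : ℕ, ((n.factorial : ℂ)⁻¹) * MvPowerSeries.coeff e ((bracket S)^[n] v i)) = _
  rw [finsum_eq_sum_of_support_subset (s := Finset.range (wt α e + 1))]
  · refine Finset.sum_congr rfl fun n _ => ?_
    rw [adOp_iterate, coeff_exp_real, Pi.smul_apply]
    change _ = ((n.factorial : ℝ)⁻¹ • (MvPowerSeries.coeff e ((adOp S ^ n) v i)))
    rw [Complex.real_smul]
    simp
  · intro n hn
    by_contra h
    simp only [Finset.coe_range, Set.mem_Iio, not_lt] at h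
    refine hn ?_
    change _ * MvPowerSeries.coeff e ((bracket S)^[n] v i) = 0
    rw [adOp_iterate, h0 n (by lia), mul_zero]

/-- The operator of a state map. -/
def stateOp {S : VF m} (hS : S ∈ (vfFilt m α).F 2) : Module.End ℝ (Ser m) :=
  expOp (serFilt m α) (vder_raises (p := 1) hS).neg

theorem vder_filtered (i j : ℕ) (v : VF m) (f : Ser m) (hv : v ∈ (vfFilt m α).F i)
    (hf : f ∈ (serFilt m α).F j) : (vder : VF m →ₗ[ℝ] _) v f ∈ (serFilt m α).F (i + j - 1) :=
  vder_mem hv hf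

theorem pderiv_comm (s t : Var m) (f : Ser m) :
    MvPowerSeries.pderiv ℂ s (MvPowerSeries.pderiv ℂ t f) =
      MvPowerSeries.pderiv ℂ t (MvPowerSeries.pderiv ℂ s f) := by
  classical
  ext e
  simp only [MvPowerSeries.coeff_pderiv]
  rw [show e + Finsupp.single s 1 + Finsupp.single t 1 =
    e + Finsupp.single t 1 + Finsupp.single s 1 by rw [add_right_comm]]
  by_cases h : s = t
  · subst h; rfl
  · simp only [Finsupp.add_apply, Finsupp.single_apply, if_neg h, if_neg (Ne.symm h), add_zero]
    ring

/-- The second-order terms cancel by symmetry of second derivatives. With this convention fields map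
to derivations by an anti-homomorphism, which accounts for the minus sign in `stateOp`. -/
theorem vder_bracket (u v : VF m) (f : Ser m) :
    vder (bracket u v) f = vder v (vder u f) - vder u (vder v f) := by
  have hexp : ∀ u v : VF m, vder v (vder u f) =
      ∑ j : Fin 2, (MvPowerSeries.pderiv ℂ (Sum.inl j) f * vder v (u j) +
        vder v (MvPowerSeries.pderiv ℂ (Sum.inl j) f) * u j) := by
    intro u v
    rw [vder_apply u, map_sum]
    exact Finset.sum_congr rfl fun j _ => by rw [vder_mul, add_comm]
  rw [hexp u v, hexp v u, vder_apply, Fin.sum_univ_two, Fin.sum_univ_two, Fin.sum_univ_two,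
    bracket_apply, bracket_apply]
  simp only [vder_apply, Fin.sum_univ_two]
  rw [pderiv_comm (Sum.inl 1) (Sum.inl 0)]
  ring

/-- This is `expOp_bilin` for the pairing (v, f) ↦ X_v f, on which −X_S acts by the Leibniz rule
with ad_S on fields and −X_S on series. -/
theorem rel_stateMap {S : VF m} (hS : S ∈ (vfFilt m α).F 2) (v : VF m) :
    Rel (stateOp hS) (stateOp hS) v (stateMap S v) := by
  intro f
  rw [stateMap_eq hS]
  refine (expOp_bilin (Φ₁ := vfFilt m α) (Φ₂ := serFilt m α) (Φ₃ := serFilt m α)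
    (vder : VF m →ₗ[ℝ] _) vder_filtered (adOp_raises (p := 1) hS) (vder_raises (p := 1) hS).neg
    (vder_raises (p := 1) hS).neg (fun u g => ?_) v f).symm
  change -vder S (vder u g) = vder (bracket S u) g + vder u (-vder S g)
  rw [vder_bracket, map_neg]
  ring

theorem IsGen.stateOp_lPair (hα : 1 ≤ α) {Y : Gen m} (h : IsGen α Y) :
    LPair m α (-vder Y.2.2) (-vder Y.2.2) := by
  have hS : IsGen α ((0, 0, Y.2.2) : Gen m) := by
    refine ⟨fun l => ?_, fun l => ?_, fun l => Submodule.zero_mem _, ?_, Submodule.zero_mem _,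
      h.stateS, h.memS⟩
    all_goals exact map_zero _
  have hB : genB ((0, 0, Y.2.2) : Gen m) = -vder Y.2.2 := by
    refine LinearMap.ext fun f => ?_
    rw [genB_apply]
    simp
  have hA : genA ((0, 0, Y.2.2) : Gen m) = -vder Y.2.2 := by
    rw [genA, hB]
    refine LinearMap.ext fun f => ?_
    simp
  have := hS.lPair hα
  rwa [hA, hB] at this

/-! ### The near-identity map of a generator as an element of the group. -/

theorem IsGen.isParam {Y : Gen m} (h : IsGen α Y) : IsParam α Y.1 := ⟨h.conjP, h.axisP, h.memP⟩

/-- The automorphism of power series induced by a generator. -/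
def IsGen.opB (hα : 1 ≤ α) {Y : Gen m} (h : IsGen α Y) : Module.End ℝ (Ser m) :=
  paramOp hα h.isParam * stateOp h.memS

/-- The automorphism of power series induced by a generator, followed by the time rescaling. -/
def IsGen.opA (hα : 1 ≤ α) {Y : Gen m} (h : IsGen α Y) : Module.End ℝ (Ser m) :=
  LinearMap.mulLeft ℝ (1 + Y.2.1) * h.opB hα

theorem IsGen.gPair (hα : 1 ≤ α) {Y : Gen m} (h : IsGen α Y) :
    GPair m α (h.opA hα) (h.opB hα) := by
  have hB : GPair m α (h.opB hα) (h.opB hα) :=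
    (paramOp_gPair hα h.isParam).mul (h.stateOp_lPair hα).exp
  refine ⟨?_, hB.unipB, hB.mulB, fun f g => ?_, ?_, hB.structB⟩
  · have h1 := hB.unipB.add ((mulLeft_raises h.memT).mul hB.raisesB)
    convert h1 using 1
    refine LinearMap.ext fun f => ?_
    change (1 + Y.2.1) * h.opB hα f - f = h.opB hα f - f + Y.2.1 * h.opB hα f
    ring
  · change (1 + Y.2.1) * h.opB hα (f * g) = (1 + Y.2.1) * h.opB hα f * h.opB hα g
    rw [hB.mulB, mul_assoc]
  · refine (mulLeft_isReal ?_).mul hB.realA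
    rw [map_add, conjOp_one, h.conjT]

theorem rel_timeMap (T : Ser m) (v : VF m) : Rel (LinearMap.mulLeft ℝ (1 + T)) 1 v (timeMap T v) := by
  intro f
  change vder (timeMap T v) f = (1 + T) * vder v f
  rw [vder_apply, vder_apply, Finset.mul_sum]
  refine Finset.sum_congr rfl fun j _ => ?_
  change _ * (v j + T * v j) = _
  ring

theorem IsGen.rel_nearId (hα : 1 ≤ α) {Y : Gen m} (h : IsGen α Y) {v : VF m}
    (hv : v ∈ stateSpace m) : Rel (h.opA hα) (h.opB hα) v (nearId Y v) := by
  have h1 : Rel (stateOp h.memS) (stateOp h.memS) v (stateMap Y.2.2 v) := rel_stateMap h.memS v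
  have h2 : stateMap Y.2.2 v ∈ stateSpace m := h1.mem_stateSpace hα (h.stateOp_lPair hα).exp hv
  have h3 := h1.trans (rel_paramMap hα h.isParam (stateSpace_le_vfFilt h2))
  have h4 := h3.trans (rel_timeMap Y.2.1 _)
  rwa [one_mul] at h4

theorem IsGen.opA_one (hα : 1 ≤ α) {Y : Gen m} (h : IsGen α Y) : h.opA hα 1 = 1 + Y.2.1 := by
  have : h.opB hα 1 = 1 := (h.gPair hα).map_one_B
  change (1 + Y.2.1) * h.opB hα 1 = _
  rw [this, mul_one]

/-! ### Every transformation comes from a generator -/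

/-- The parameter component of a transformation. -/
def paramPart (B : Module.End ℝ (Ser m)) (l : Fin m) : Ser m :=
  B (MvPowerSeries.X (Sum.inr l)) - MvPowerSeries.X (Sum.inr l)

theorem GPair.isParam {A B : Module.End ℝ (Ser m)} (h : GPair m α A B) :
    IsParam α (paramPart B) := by
  refine ⟨fun l => ?_, fun l => ?_, fun l => ?_⟩
  · rw [paramPart, map_sub, ← commute_apply h.structB.commConj, conjOp_X]; rfl
  · rw [paramPart, map_sub, h.structB.axis_of_X_inr, axisOp_X_inr]
  · exact h.unipB _ _ (X_mem_serFilt (α := α) (Sum.inr l))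

/-- The automorphism of a transformation, with the change of parameters removed. -/
def GPair.stateB (hα : 1 ≤ α) {A B : Module.End ℝ (Ser m)} (h : GPair m α A B) :
    Module.End ℝ (Ser m) := invOp (serFilt m α) (paramOp_unip hα h.isParam) * B

theorem GPair.diag {A B : Module.End ℝ (Ser m)} (h : GPair m α A B) : GPair m α B B :=
  ⟨h.unipB, h.unipB, h.mulB, h.mulB, h.structB.toIsReal, h.structB⟩

theorem GPair.stateB_gPair (hα : 1 ≤ α) {A B : Module.End ℝ (Ser m)} (h : GPair m α A B) :
    GPair m α (h.stateB hα) (h.stateB hα) := (paramOp_gPair hα h.isParam).inv.diag.mul h.diag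

theorem paramOp_mul_stateB (hα : 1 ≤ α) {A B : Module.End ℝ (Ser m)} (h : GPair m α A B) :
    paramOp hα h.isParam * h.stateB hα = B := by
  rw [GPair.stateB, ← mul_assoc, mul_invOp, one_mul]

theorem GPair.stateB_X_inr (hα : 1 ≤ α) {A B : Module.End ℝ (Ser m)} (h : GPair m α A B)
    (l : Fin m) : h.stateB hα (MvPowerSeries.X (Sum.inr l)) = MvPowerSeries.X (Sum.inr l) := by
  have h1 : B (MvPowerSeries.X (Sum.inr l)) =
      paramOp hα h.isParam (MvPowerSeries.X (Sum.inr l)) := by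
    rw [paramOp_X_inr, paramPart, add_sub_cancel]
  rw [GPair.stateB, Module.End.mul_apply, h1, invOp_apply]

theorem ser_apply_eq_zero {M : Type*} [AddCommGroup M] [Module ℝ M] {Φ : CFilt M}
    {K : Module.End ℝ M} (hK : Raises Φ Φ 1 K) {a : PowerSeries ℝ}
    (ha : PowerSeries.constantCoeff a = 0) {x : M} (hx : K x = 0) : ser Φ hK a x = 0 := by
  obtain ⟨b, rfl⟩ := PowerSeries.X_dvd_iff.2 ha
  rw [mul_comm, map_mul, ser_X, Module.End.mul_apply, hx, map_zero]

/-- The generator of a transformation. -/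
def GPair.gen (hα : 1 ≤ α) {A B : Module.End ℝ (Ser m)} (h : GPair m α A B) : Gen m :=
  (paramPart B, A 1 - 1,
    fun j => -logOp (serFilt m α) (h.stateB_gPair hα).unipB (MvPowerSeries.X (Sum.inl j)))

/-- Once the change of parameters is split off, the remaining automorphism fixes every parameter.
Its logarithm then kills the parameters and is the derivation of a field. -/
theorem GPair.neg_vder_gen (hα : 1 ≤ α) {A B : Module.End ℝ (Ser m)} (h : GPair m α A B) :
    -vder (h.gen hα).2.2 = logOp (serFilt m α) (h.stateB_gPair hα).unipB := by
  have hl := (h.stateB_gPair hα).log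
  rw [leibniz_eq_vder hα (hl.raisesB.mono (Nat.zero_le 1)) hl.leibB hl.structB.commI, ← map_neg]
  · congr 1
    funext j
    exact neg_neg _
  · intro l
    refine ser_apply_eq_zero _ constantCoeff_logSeries ?_
    rw [LinearMap.sub_apply, h.stateB_X_inr, Module.End.one_apply, sub_self]

theorem GPair.isGen (hα : 1 ≤ α) {A B : Module.End ℝ (Ser m)} (h : GPair m α A B) :
    IsGen α (h.gen hα) := by
  have hl := (h.stateB_gPair hα).log
  have hS : (h.gen hα).2.2 ∈ (vfFilt m α).F 2 := mem_vfFilt.2 fun j =>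
    Submodule.neg_mem _ (hl.raisesB _ _ (X_mem_serFilt (α := α) (Sum.inl j)))
  refine ⟨h.isParam.real, h.isParam.axis, h.isParam.mem, ?_, h.unipA.mem 1, ?_, hS⟩
  · change conjOp (A 1 - 1) = A 1 - 1
    rw [map_sub, ← commute_apply h.realA.commConj, conjOp_one]
  · refine mem_stateSpace_of_mem_two hS ?_ ?_
    · change -logOp _ _ _ = conjOp (-logOp _ _ _)
      rw [map_neg, hl.structB.conj_X_inl]
    · change axisOp (-logOp _ _ _) = 0
      rw [map_neg, ← commute_apply hl.structB.commAxis, axisOp_X_inl, map_zero, neg_zero]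

theorem GPair.opB_gen (hα : 1 ≤ α) {A B : Module.End ℝ (Ser m)} (h : GPair m α A B) :
    (h.isGen hα).opB hα = B := by
  have h1 : stateOp (h.isGen hα).memS = h.stateB hα := by
    rw [← expOp_logOp (h.stateB_gPair hα).unipB, stateOp]
    congr 1
    exact h.neg_vder_gen hα
  rw [IsGen.opB, h1]
  exact paramOp_mul_stateB hα h

theorem GPair.opA_gen (hα : 1 ≤ α) {A B : Module.End ℝ (Ser m)} (h : GPair m α A B) :
    (h.isGen hα).opA hα = A := by
  refine LinearMap.ext fun f => ?_
  rw [((h.isGen hα).gPair hα).apply_A, h.opB_gen, IsGen.opA_one, h.apply_A]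
  congr 1
  exact add_sub_cancel _ _

theorem GPair.rel_gen (hα : 1 ≤ α) {A B : Module.End ℝ (Ser m)} (h : GPair m α A B) {v : VF m}
    (hv : v ∈ stateSpace m) : Rel A B v (nearId (h.gen hα) v) := by
  have := (h.isGen hα).rel_nearId hα hv
  rwa [h.opA_gen, h.opB_gen] at this

/-- Membership in A⁰ depends on the time factor alone; the state and parameter components are always
admissible. -/
theorem GPair.gen_mem_genSpace (hα : 1 ≤ α) {A B : Module.End ℝ (Ser m)} (h : GPair m α A B)
    (hA : chargeOp (A 1) = 0) : h.gen hα ∈ genSpace α := by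
  refine mem_genSpace_iff.2 ⟨h.isGen hα, ?_⟩
  change chargeOp (A 1 - 1) = 0
  have := chargeOp_C (m := m) 1
  rw [map_sub, hA, zero_sub, neg_eq_zero]
  simpa using this

/-- The generator depends continuously on the transformation. -/
theorem GPair.gen_sub_mem (hα : 1 ≤ α) {A B A' B' : Module.End ℝ (Ser m)} (h : GPair m α A B)
    (h' : GPair m α A' B') {N : ℕ} (hA : ∀ f, A f - A' f ∈ (serFilt m α).F (α + N))
    (hB : ∀ f, B f - B' f ∈ (serFilt m α).F (α + N)) :
    (∀ l, (h.gen hα).1 l - (h'.gen hα).1 l ∈ (serFilt m α).F (α + N)) ∧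
    (h.gen hα).2.1 - (h'.gen hα).2.1 ∈ (serFilt m α).F N ∧
    (h.gen hα).2.2 - (h'.gen hα).2.2 ∈ (vfFilt m α).F N := by
  have hP : ∀ l, paramPart B l - paramPart B' l ∈ (serFilt m α).F (α + N) := fun l => by
    rw [paramPart, paramPart, sub_sub_sub_cancel_right]
    exact hB _
  have hN : N ≤ α + N := Nat.le_add_left _ _
  refine ⟨hP, ?_, ?_⟩
  · change (A 1 - 1) - (A' 1 - 1) ∈ _
    rw [sub_sub_sub_cancel_right]
    exact (serFilt m α).mem_of_le hN (hA 1)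
  · have hsub : ∀ {C D : Module.End ℝ (Ser m)}, (∀ f, C f - D f ∈ (serFilt m α).F N) →
        ∀ f, (C - 1) f - (D - 1) f ∈ (serFilt m α).F N := by
      intro C D hCD f
      simpa using hCD f
    have hi := ser_sub_ser_mem (paramOp_unip hα h.isParam) (paramOp_unip hα h'.isParam)
      (hsub (paramOp_sub_mem hα h.isParam h'.isParam hP)) (1 + PowerSeries.X)⁻¹
    have hs : ∀ f, h.stateB hα f - h'.stateB hα f ∈ (serFilt m α).F N := by
      intro f
      have h1 := (invOp_sub_one_raises (paramOp_unip hα h.isParam)).of_sub_one _ _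
        ((serFilt m α).mem_of_le hN (hB f))
      have h2 := hi (B' f)
      have := Submodule.add_mem _ h1 h2
      rw [map_sub] at this
      rwa [← sub_add_sub_cancel]
    rw [mem_vfFilt]
    intro j
    have := ser_sub_ser_mem (h.stateB_gPair hα).unipB (h'.stateB_gPair hα).unipB (hsub hs)
      logSeries (MvPowerSeries.X (Sum.inl j))
    have := Submodule.neg_mem _ this
    rw [neg_sub'] at this
    exact this

theorem GPair.gen_filtTendsto (hα : 1 ≤ α) {A B : ℕ → Module.End ℝ (Ser m)}
    {A' B' : Module.End ℝ (Ser m)} (h : ∀ n, GPair m α (A n) (B n)) (h' : GPair m α A' B')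
    (hA : ∀ N, ∀ᶠ n in atTop, ∀ f, A n f - A' f ∈ (serFilt m α).F N)
    (hB : ∀ N, ∀ᶠ n in atTop, ∀ f, B n f - B' f ∈ (serFilt m α).F N)
    (hc : ∀ n, chargeOp (A n 1) = 0) (hc' : chargeOp (A' 1) = 0) :
    FiltTendsto (genFilt α) (fun n => (h n).gen hα) (h'.gen hα) := by
  intro N
  -- M ≥ 1 makes the maximum in `genFilt` equal to M. In the estimates below, α accounts for the
  -- grade shift of the parameter space and the further 1 for that of the state space.
  set M := N.toNat + 1 with hM
  filter_upwards [hA (α + (M + 1)), hB (α + (M + 1))] with n h1 h2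
  have h3 := (h n).gen_sub_mem hα h' h1 h2
  have h4 : (h n).gen hα - h'.gen hα ∈ genSpace α :=
    Submodule.sub_mem _ ((h n).gen_mem_genSpace hα (hc n)) (h'.gen_mem_genSpace hα hc')
  have h5 := mem_genSpace_iff.1 h4
  have h6 : (h n).gen hα - h'.gen hα ∈ genFilt α (M : ℤ) := by
    rw [mem_genFilt_iff (by lia)]
    exact ⟨fun l => ⟨h5.1.conjP l, h5.1.axisP l, (serFilt m α).mem_of_le (by lia) (h3.1 l)⟩,
      ⟨h5.1.conjT, h5.2, (serFilt m α).mem_of_le (by lia) h3.2.1⟩, h5.1.stateS, h3.2.2⟩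
  obtain ⟨g1, g2, g3⟩ := h6
  have hle : max 1 N ≤ max 1 (M : ℤ) := by lia
  refine ⟨fun l e => ?_, fun e => ?_, g3.1, fun i e he => g3.2 i e (by lia)⟩
  · exact ⟨(g1 l e).1, (g1 l e).2.1, fun he => (g1 l e).2.2 (by lia)⟩
  · exact ⟨(g2 e).1, (g2 e).2.1, fun he => (g2 e).2.2 (by lia)⟩

/-! ### Normalization by successive exponentials -/

/-- Converse to `Rel.exists_tangent`: the exponential moves v by the prescribed tangent vector up to
higher grade. -/
theorem LPair.exp_act_sub_mem (hα : 1 ≤ α) {a b : Module.End ℝ (Ser m)} (h : LPair m α a b)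
    {v : VF m} (hv : v ∈ stateSpace m) {r : ℕ} (ht : tanAct a b v ∈ (vfFilt m α).F (r + 1)) :
    h.exp.act v - v - tanAct a b v ∈ (vfFilt m α).F (r + 2) := by
  have hv1 := stateSpace_le_vfFilt (α := α) hv
  have hr := h.exp.rel_act hα hv1
  have hE : Raises (serFilt m α) (serFilt m α) r (vder (tanAct a b v)) := vder_raises ht
  have hE' := hE
  rw [h.vder_tanAct hα hv1] at hE'
  have h1 := expOp_intertwine h.raisesA h.raisesB (vder_raises (p := 0) hv1) hE'
  rw [← h.vder_tanAct hα hv1] at h1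
  have h2 : vder (h.exp.act v - v - tanAct a b v) =
      (expOp (serFilt m α) h.raisesA * vder v - vder v * expOp (serFilt m α) h.raisesB -
        vder (tanAct a b v)) * invOp (serFilt m α) h.exp.unipB +
      vder (tanAct a b v) * (invOp (serFilt m α) h.exp.unipB - 1) := by
    refine LinearMap.ext fun f => ?_
    simp only [map_sub, LinearMap.sub_apply, LinearMap.add_apply, Module.End.mul_apply,
      Module.End.one_apply]
    rw [← hr, apply_invOp]
    abel
  have h3 := (h1.mul h.exp.inv.raisesB).add (hE.mul h.exp.inv.unipB)
  rw [mem_vfFilt]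
  intro j
  rw [← vder_X_inl (_ - _) j, h2]
  exact (serFilt m α).mem_of_le (by simp [varWt]; lia)
    (h3 _ _ (X_mem_serFilt (α := α) (Sum.inl j)))

theorem GPair.act_sub {A B : Module.End ℝ (Ser m)} (h : GPair m α A B) (u v : VF m) :
    h.act (u - v) = h.act u - h.act v := by
  funext j
  simp only [GPair.act, map_sub, LinearMap.sub_apply, Pi.sub_apply]

/-- One step of the normalization: an exponential changes the grade `r` part by a prescribed
amount and leaves the lower grades unchanged. -/
theorem GPair.act_exp (hα : 1 ≤ α) {A B a b : Module.End ℝ (Ser m)} (hG : GPair m α A B)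
    (h : LPair m α a b) {v : VF m} (hv : v ∈ stateSpace m) {r : ℕ}
    (ht : tanAct a b v ∈ (vfFilt m α).F (r + 1)) :
    (hG.mul h.exp).act v - hG.act v ∈ (vfFilt m α).F (r + 1) ∧
    gradePart α r ((hG.mul h.exp).act v) =
      gradePart α r (hG.act v) + gradePart α r (tanAct a b v) := by
  have h1 := h.exp_act_sub_mem hα hv ht
  have h2 : h.exp.act v - v ∈ (vfFilt m α).F (r + 1) := by
    have := Submodule.add_mem _ ((vfFilt m α).mem_of_le (Nat.le_succ _) h1) ht
    rwa [sub_add_cancel] at this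
  have h3 := hG.act_sub_mem h2
  have h4 : (hG.mul h.exp).act v = hG.act (h.exp.act v) := by
    have hr := h.exp.rel_act hα (stateSpace_le_vfFilt (α := α) hv)
    have hr' := hG.rel_act hα (stateSpace_le_vfFilt (α := α) (h.exp.act_mem hα hv))
    exact ((hr.trans hr').eq_act (hG.mul h.exp)).symm
  have h5 : (hG.mul h.exp).act v - hG.act v - tanAct a b v ∈ (vfFilt m α).F (r + 2) := by
    rw [h4, ← hG.act_sub]
    have := Submodule.add_mem _ h3 h1
    rwa [sub_add_sub_cancel] at this
  constructor
  · have := Submodule.add_mem _ ((vfFilt m α).mem_of_le (Nat.le_succ _) h5) ht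
    rwa [sub_add_cancel] at this
  · rw [← map_add]
    refine gradePart_eq_of_sub_mem ?_
    rwa [← sub_sub]

theorem expOp_apply_sub_mem {A K : Module.End ℝ (Ser m)}
    (hA : Raises (serFilt m α) (serFilt m α) 0 A) (hK : Raises (serFilt m α) (serFilt m α) 1 K)
    {s : ℕ} (hs : Raises (serFilt m α) (serFilt m α) s K) (f : Ser m) :
    (A * expOp (serFilt m α) hK) f - A f ∈ (serFilt m α).F s := by
  have := hA _ _ ((expOp_sub_one_raises hK hs).mem f)
  rw [LinearMap.sub_apply, map_sub] at this
  exact this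

/-- Normalization grade by grade, with a convergent sequence of transformations. -/
theorem exists_normalizing (hα : 1 ≤ α) {v : VF m} (hv : v ∈ stateSpace m)
    (Q : Module.End ℝ (Ser m) → Module.End ℝ (Ser m) → Prop) (hQ1 : Q 1 1)
    (hQm : ∀ {A B A' B'}, Q A B → Q A' B' → Q (A * A') (B * B'))
    (N : ℕ → Submodule ℝ (VF m)) (h0 : gradePart α (0 : ℕ) v ∈ N 0)
    (s : ℕ → ℕ) (hs : Tendsto s atTop atTop)
    (step : ∀ (r : ℕ) (A B : Module.End ℝ (Ser m)) (hG : GPair m α A B), 1 ≤ r → Q A B →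
      ∃ (a b : Module.End ℝ (Ser m)) (h : LPair m α a b),
        Q (expOp (serFilt m α) h.raisesA) (expOp (serFilt m α) h.raisesB) ∧
        Raises (serFilt m α) (serFilt m α) (s r) a ∧ Raises (serFilt m α) (serFilt m α) (s r) b ∧
        tanAct a b v ∈ (vfFilt m α).F (r + 1) ∧
        gradePart α r (hG.act v) + gradePart α r (tanAct a b v) ∈ N r) :
    ∃ (A B : ℕ → Module.End ℝ (Ser m)) (A' B' : Module.End ℝ (Ser m))
      (hG : ∀ n, GPair m α (A n) (B n)), GPair m α A' B' ∧ (∀ n, Q (A n) (B n)) ∧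
      (∀ N, ∀ᶠ n in atTop, ∀ f, A n f - A' f ∈ (serFilt m α).F N) ∧
      (∀ N, ∀ᶠ n in atTop, ∀ f, B n f - B' f ∈ (serFilt m α).F N) ∧
      ∀ n k : ℕ, k ≤ n → gradePart α k ((hG n).act v) ∈ N k := by
  let σ := {p : Module.End ℝ (Ser m) × Module.End ℝ (Ser m) // GPair m α p.1 p.2 ∧ Q p.1 p.2}
  have hstep : ∀ (n : ℕ) (p : σ), ∃ q : σ,
      (∀ f, q.1.1 f - p.1.1 f ∈ (serFilt m α).F (s (n + 1))) ∧
      (∀ f, q.1.2 f - p.1.2 f ∈ (serFilt m α).F (s (n + 1))) ∧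
      q.2.1.act v - p.2.1.act v ∈ (vfFilt m α).F (n + 2) ∧
      gradePart α (n + 1 : ℕ) (q.2.1.act v) ∈ N (n + 1) := by
    rintro n ⟨⟨A, B⟩, hG, hQ⟩
    obtain ⟨a, b, h, h1, h2, h3, h4, h5⟩ := step (n + 1) A B hG (by lia) hQ
    have h6 := hG.act_exp hα h hv h4
    -- The new exponential is applied before the transformation already built. Tangent vectors are
    -- therefore always taken at the fixed field v, so that a single rate s serves for all r, and
    -- applying (A, B) afterwards does not change their lowest-grade part.
    refine ⟨⟨(_, _), hG.mul h.exp, hQm hQ h1⟩, expOp_apply_sub_mem hG.raisesA h.raisesA h2,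
      expOp_apply_sub_mem hG.raisesB h.raisesB h3, h6.1, ?_⟩
    rw [h6.2]
    exact h5
  choose next hA hB hact hN using hstep
  let p : ℕ → σ := fun n => Nat.rec ⟨(1, 1), GPair.one, hQ1⟩ next n
  have hp : ∀ n, p (n + 1) = next n (p n) := fun n => rfl
  have hs' : ∀ N, ∀ᶠ n in atTop, N ≤ s (n + 1) := fun N =>
    (tendsto_add_atTop_iff_nat 1).2 hs |>.eventually (eventually_ge_atTop N)
  obtain ⟨A', hA'⟩ := exists_limit_op (serFilt m α) (fun n => (p n).1.1) fun N => by
    filter_upwards [hs' N] with n hn f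
    exact (serFilt m α).mem_of_le hn (hA n (p n) f)
  obtain ⟨B', hB'⟩ := exists_limit_op (serFilt m α) (fun n => (p n).1.2) fun N => by
    filter_upwards [hs' N] with n hn f
    exact (serFilt m α).mem_of_le hn (hB n (p n) f)
  refine ⟨fun n => (p n).1.1, fun n => (p n).1.2, A', B', fun n => (p n).2.1, ?_,
    fun n => (p n).2.2, hA', hB', ?_⟩
  · exact GPair.of_tends (fun n => (p n).2.1) (fun f N => (hA' N).mono fun n hn => hn f)
      (fun f N => (hB' N).mono fun n hn => hn f)
  · intro n
    induction n with
    | zero =>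
      intro k hk
      obtain rfl : k = 0 := by lia
      have : (p 0).2.1.act v = v := ((Rel.refl v).eq_act GPair.one).symm
      rw [this]
      exact h0
    | succ n ih =>
      intro k hk
      rcases Nat.lt_or_ge k (n + 1) with hk' | hk'
      · have := ih k (by lia)
        rwa [gradePart_eq_of_sub_mem ((vfFilt m α).mem_of_le (by lia) (hact n (p n)))]
      · obtain rfl : k = n + 1 := by lia
        exact hN n (p n)

theorem GPair.act_sub_act_mem {A B A' B' : Module.End ℝ (Ser m)} (h : GPair m α A B)
    (h' : GPair m α A' B') {N : ℕ} (hA : ∀ f, A f - A' f ∈ (serFilt m α).F N)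
    (hB : ∀ f, B f - B' f ∈ (serFilt m α).F N) {v : VF m} (hv : v ∈ (vfFilt m α).F 1) :
    h.act v - h'.act v ∈ (vfFilt m α).F N := by
  rw [mem_vfFilt]
  intro j
  have hi := ser_sub_ser_mem h.unipB h'.unipB (N := N) (fun f => by simpa using hB f)
    (1 + PowerSeries.X)⁻¹ (MvPowerSeries.X (Sum.inl j))
  have h1 := h.raisesA _ _ (vder_raises (p := 0) hv _ _ hi)
  have h2 := hA (vder v (invOp (serFilt m α) h'.unipB (MvPowerSeries.X (Sum.inl j))))
  rw [map_sub, map_sub] at h1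
  rw [add_zero, add_zero] at h1
  change A (vder v (invOp (serFilt m α) h.unipB (MvPowerSeries.X (Sum.inl j)))) -
    A' (vder v (invOp (serFilt m α) h'.unipB (MvPowerSeries.X (Sum.inl j)))) ∈ _
  rw [← sub_add_sub_cancel _
    (A (vder v (invOp (serFilt m α) h'.unipB (MvPowerSeries.X (Sum.inl j)))))]
  exact Submodule.add_mem _ h1 h2

/-! ### Resonant vector fields -/

theorem chargeOp_eq_smul_iff {q : ℂ} {f : Ser m} : chargeOp f = q • f ↔
    ∀ e, charge e ≠ q → MvPowerSeries.coeff e f = 0 := by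
  refine ⟨fun h e he => ?_, fun h => ?_⟩
  · have := congrArg (MvPowerSeries.coeff e) h
    rw [coeff_chargeOp, map_smul, smul_eq_mul] at this
    by_contra hc
    exact he (mul_right_cancel₀ hc this)
  · ext e
    rw [coeff_chargeOp, map_smul, smul_eq_mul]
    by_cases he : charge e = q
    · rw [he]
    · rw [h e he, mul_zero, mul_zero]

/-- Vector fields commuting with the rotation field. -/
def resonant (m : ℕ) : Submodule ℝ (VF m) where
  carrier := {u | ∀ i, chargeOp (u i) = varCharge m (Sum.inl i) • u i}
  zero_mem' i := by simp
  add_mem' := by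
    intro u v hu hv i
    rw [Pi.add_apply, map_add, hu i, hv i, smul_add]
  smul_mem' := by
    intro c u hu i
    rw [Pi.smul_apply, map_smul, hu i, smul_comm]

theorem mem_resonant_iff {u : VF m} : u ∈ resonant m ↔
    ∀ i, chargeOp (u i) = varCharge m (Sum.inl i) • u i := Iff.rfl

theorem mem_resonant_iff_coeff {u : VF m} : u ∈ resonant m ↔ ∀ i e,
    charge e ≠ varCharge m (Sum.inl i) → MvPowerSeries.coeff e (u i) = 0 :=
  forall_congr' fun _ => chargeOp_eq_smul_iff

/-- The bracket with the linear part. -/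
def hopfOp (m : ℕ) (κ : ℂ) : Module.End ℝ (VF m) where
  toFun u := fun i => κ • (chargeOp (u i) - varCharge m (Sum.inl i) • u i)
  map_add' u v := by
    funext i
    simp only [Pi.add_apply, map_add, smul_add, smul_sub]
    abel
  map_smul' c u := by
    funext i
    simp only [Pi.smul_apply, map_smul, RingHom.id_apply, smul_sub, smul_comm c]

theorem hopfOp_apply (κ : ℂ) (u : VF m) (i : Fin 2) :
    hopfOp m κ u i = κ • (chargeOp (u i) - varCharge m (Sum.inl i) • u i) := rfl

theorem coeff_hopfOp (κ : ℂ) (u : VF m) (i : Fin 2) (e : Expo m) :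
    MvPowerSeries.coeff e (hopfOp m κ u i) =
      κ * (charge e - varCharge m (Sum.inl i)) * MvPowerSeries.coeff e (u i) := by
  rw [hopfOp_apply, map_smul, map_sub, map_smul, coeff_chargeOp, smul_eq_mul, smul_eq_mul]
  ring

theorem bracket_hopfPart (hα : 1 ≤ α) (κ : ℂ) (u : VF m) :
    bracket u (hopfPart m κ) = hopfOp m κ u := by
  funext i
  rw [bracket_apply, vder_hopfPart hα, hopfOp_apply, smul_sub]
  congr 1
  have hs : ∀ (c : ℂ) (f : Ser m), vder u (c • f) = c • vder u f := by
    intro c f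
    rw [vder_apply, vder_apply, Finset.smul_sum]
    refine Finset.sum_congr rfl fun j _ => ?_
    rw [Derivation.map_smul, smul_mul_assoc]
  fin_cases i
  · change vder u (κ • MvPowerSeries.X (Sum.inl 0)) = κ • (1 : ℂ) • u 0
    rw [hs, vder_X_inl, one_smul]
  · change vder u (-(κ • MvPowerSeries.X (Sum.inl 1))) = κ • (-1 : ℂ) • u 1
    rw [map_neg, hs, vder_X_inl, neg_smul, one_smul, smul_neg]

theorem hopfOp_eq_zero_iff {κ : ℂ} (hκ : κ ≠ 0) {u : VF m} : hopfOp m κ u = 0 ↔ u ∈ resonant m := by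
  rw [mem_resonant_iff, funext_iff]
  refine forall_congr' fun i => ?_
  rw [hopfOp_apply, Pi.zero_apply, smul_eq_zero_iff_right hκ, sub_eq_zero]

theorem charge_zExp : charge (zExp m) = 1 := by
  have := charge_single (m := m) (Sum.inl 0)
  rw [zExp, this]; rfl

theorem hopfOp_mem_stateGrade {κ : ℂ} (hκ : κ.re = 0) {u : VF m} {n : ℤ}
    (hu : u ∈ stateGrade α n) : hopfOp m κ u ∈ stateGrade α n := by
  obtain ⟨⟨h1, h2, h3⟩, h4⟩ := hu
  have e0 : varCharge m (Sum.inl 0) = 1 := rfl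
  have e1 : varCharge m (Sum.inl 1) = -1 := rfl
  refine ⟨⟨fun e => ?_, fun e he => h2 e fun h => he ?_, ?_⟩, fun i e he => ?_⟩
  · rw [coeff_hopfOp, coeff_hopfOp, h1, map_mul, map_mul, map_sub, conj_of_re_eq_zero hκ,
      conj_charge, charge_swapExp, e0, e1, map_one]
    ring
  · rw [coeff_hopfOp, h, mul_zero]
  · rw [coeff_hopfOp, e0, charge_zExp]
    simp
  · rw [coeff_hopfOp, h4 i e he, mul_zero]

theorem stateGrade_zero_le_resonant (hα : 1 ≤ α) : stateGrade α ((0 : ℕ) : ℤ) ≤ resonant m := by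
  intro u hu
  obtain ⟨⟨h1, h2, h3⟩, h4⟩ := hu
  have hz : ∀ e, MvPowerSeries.coeff e (u 0) ≠ 0 → charge e = 1 := by
    intro e he
    have ha := h2 e he
    have hw : wt α e = 1 := by
      by_contra h
      exact he (h4 0 e (by lia))
    rcases exists_of_wt_eq_one hα hw (by have := ha.1; lia) with rfl | rfl
    · exact charge_zExp
    · exact absurd rfl ((admissible_iff _).1 ha).2
  rw [mem_resonant_iff_coeff]
  intro i e he
  fin_cases i
  · by_contra h
    exact he (hz e h)
  · change MvPowerSeries.coeff e (u 1) = 0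
    rw [h1]
    by_contra h
    have := hz (swapExp e) fun h' => h (by rw [h', map_zero])
    rw [charge_swapExp] at this
    refine he ?_
    change charge e = -1
    rw [← this, neg_neg]

/-- For imaginary κ the operator `hopfOp` exchanges the X- and Y-directions at an exponent. Its
square acts on a basis field by a real scalar, which is nonzero off resonance, so c⁻¹ times the
first image is a preimage. -/
theorem basisField_resonant_or {κ : ℂ} (hκ : κ.re = 0) (hκ0 : κ ≠ 0) (b : BasisIndex m) :
    basisField b ∈ resonant m ∨
      ∃ S ∈ stateGrade α (basisGrade α b), hopfOp m κ S = basisField b := by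
  classical
  have e0 : varCharge m (Sum.inl 0) = 1 := rfl
  have e1 : varCharge m (Sum.inl 1) = -1 := rfl
  by_cases hq : charge b.1.2 = 1
  · left
    rw [mem_resonant_iff_coeff]
    intro i e he
    fin_cases i
    · change MvPowerSeries.coeff e (basisField b 0) = 0
      rw [basisField_zero, MvPowerSeries.coeff_monomial, if_neg]
      rintro rfl
      exact he hq
    · change MvPowerSeries.coeff e (basisField b 1) = 0
      rw [basisField_one, MvPowerSeries.coeff_monomial, if_neg]
      rintro rfl
      refine he ?_
      rw [charge_swapExp, hq]
      rfl
  · right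
    set q : ℝ := (b.1.2 (Sum.inl 0) : ℝ) - b.1.2 (Sum.inl 1) with hqdef
    have hqc : charge b.1.2 = (q : ℂ) := by simp [charge, hqdef]
    have hq1 : q - 1 ≠ 0 := by
      intro h
      refine hq ?_
      rw [hqc, sub_eq_zero.1 h, Complex.ofReal_one]
    have hκi : κ = κ.im * Complex.I := by apply Complex.ext <;> simp [hκ]
    have hκ1 : κ.im ≠ 0 := fun h => hκ0 (by rw [hκi, h]; simp)
    set c : ℝ := -(κ.im * (q - 1)) ^ 2 with hc
    have hc0 : c ≠ 0 := neg_ne_zero.2 (pow_ne_zero _ (mul_ne_zero hκ1 hq1))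
    have hcc : (c : ℂ) = (κ * (charge b.1.2 - 1)) ^ 2 := by
      rw [hqc, hc]
      conv_rhs => rw [hκi]
      push_cast
      rw [mul_pow, mul_pow, mul_pow, Complex.I_sq]
      ring
    have hmem := basisField_mem_stateGrade (α := α) b
    have hmem2 := hopfOp_mem_stateGrade hκ hmem
    refine ⟨c⁻¹ • hopfOp m κ (basisField b), Submodule.smul_mem _ _ hmem2, ?_⟩
    have h2 : hopfOp m κ (hopfOp m κ (basisField b)) = c • basisField b := by
      funext i
      ext e
      have hr : MvPowerSeries.coeff e ((c • basisField b) i) =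
          (c : ℂ) * MvPowerSeries.coeff e (basisField b i) := rfl
      rw [coeff_hopfOp, coeff_hopfOp, hr, hcc]
      fin_cases i
      · change _ * (_ * MvPowerSeries.coeff e (basisField b 0)) =
          _ * MvPowerSeries.coeff e (basisField b 0)
        rw [basisField_zero, MvPowerSeries.coeff_monomial]
        by_cases he : e = b.1.2
        · rw [if_pos he]
          subst he
          change κ * (_ - varCharge m (Sum.inl 0)) * (κ * (_ - varCharge m (Sum.inl 0)) * _) = _
          rw [e0]; ring
        · rw [if_neg he]; ring
      · change _ * (_ * MvPowerSeries.coeff e (basisField b 1)) =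
          _ * MvPowerSeries.coeff e (basisField b 1)
        rw [basisField_one, MvPowerSeries.coeff_monomial]
        by_cases he : e = swapExp b.1.2
        · rw [if_pos he]
          subst he
          change κ * (_ - varCharge m (Sum.inl 1)) * (κ * (_ - varCharge m (Sum.inl 1)) * _) = _
          rw [e1, charge_swapExp]; ring
        · rw [if_neg he]; ring
    rw [map_smul, h2, smul_smul, inv_mul_cancel₀ hc0, one_smul]

theorem stateGrade_le_resonant_sup (hα : 1 ≤ α) {κ : ℂ} (hκ : κ.re = 0) (hκ0 : κ ≠ 0) (n : ℕ) :
    stateGrade α (n : ℤ) ≤ resonant m ⊔ (stateGrade α (n : ℤ)).map (hopfOp m κ) := by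
  refine stateGrade_le_of_basisField hα fun b hb => ?_
  rcases basisField_resonant_or (α := α) hκ hκ0 b with h | ⟨S, hS, h⟩
  · exact Submodule.mem_sup_left h
  · rw [hb] at hS
    exact Submodule.mem_sup_right ⟨S, hS, h⟩

/-! ### Nonresonant terms are removable. -/

theorem diffl_state (v S : VF m) : diffl v (0, 0, S) = bracket S v := by
  funext i
  change (∑ l : Fin m, MvPowerSeries.pderiv ℂ (Sum.inr l) (v i) * 0) + 0 * v i + bracket S v i = _
  simp

theorem isGen_of_mem_stateGrade {r : ℕ} (hr : 1 ≤ r) {S : VF m} (hS : S ∈ stateGrade α (r : ℤ)) :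
    IsGen α ((0, 0, S) : Gen m) := by
  refine ⟨fun l => ?_, fun l => ?_, fun l => Submodule.zero_mem _, ?_, Submodule.zero_mem _,
    hS.1, (vfFilt m α).mem_of_le (by lia) (stateGrade_le_vfFilt hS)⟩
  all_goals exact map_zero _

theorem bracket_sub_hopfOp_mem (hα : 1 ≤ α) {v : VF m} (hv : v ∈ stateSpace m) {r : ℕ} {S : VF m}
    (hS : S ∈ stateGrade α (r : ℤ)) :
    bracket S v - hopfOp m (MvPowerSeries.coeff (zExp m) (v 0)) S ∈ (vfFilt m α).F (r + 2) := by
  rw [← bracket_hopfPart hα]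
  change adOp S v - adOp S _ ∈ _
  rw [← map_sub]
  have := adOp_raises (stateGrade_le_vfFilt hS) _ _ (sub_hopfPart_mem hα hv)
  rwa [add_comm] at this

theorem bracket_mem {v : VF m} (hv : v ∈ stateSpace m) {r : ℕ} {S : VF m}
    (hS : S ∈ stateGrade α (r : ℤ)) : bracket S v ∈ (vfFilt m α).F (r + 1) := by
  have := adOp_raises (stateGrade_le_vfFilt hS) _ _ (stateSpace_le_vfFilt hv)
  rwa [add_comm] at this

theorem hopfOp_mem_removable (hα : 1 ≤ α) {v : VF m} (hv : v ∈ stateSpace m)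
    (hH : MvPowerSeries.coeff (zExp m) (v 0) ≠ 0) {r : ℕ} {S : VF m}
    (hS : S ∈ stateGrade α (r : ℤ)) :
    hopfOp m (MvPowerSeries.coeff (zExp m) (v 0)) S ∈ removable α v r r := by
  have hκ := ((mem_stateSpace_iff v).1 hv).2.2.2
  -- A⁰ contains no generator of grade 0, but there the operator vanishes, all fields of grade 0
  -- being resonant.
  rcases Nat.eq_zero_or_pos r with rfl | hr
  · rw [(hopfOp_eq_zero_iff hH).2 (stateGrade_zero_le_resonant hα hS)]
    exact Submodule.zero_mem _
  · rw [mem_removable_iff hα hv hH]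
    refine ⟨_, _, (isGen_of_mem_stateGrade hr hS).lPair hα, ?_, ?_⟩
    · rw [tanAct_gen, diffl_state]
      exact bracket_mem hv hS
    · rw [tanAct_gen, diffl_state, gradePart_eq_of_sub_mem (bracket_sub_hopfOp_mem hα hv hS),
        gradePart_eq_self (hopfOp_mem_stateGrade hκ hS)]

/-- A nonresonant basis field is itself removable, so the successive choice never selects it,
whatever the enumeration. -/
theorem normalSpace_le_resonant (hα : 1 ≤ α) (ord : ℕ ≃ BasisIndex m) {v : VF m}
    (hv : v ∈ stateSpace m) (hH : MvPowerSeries.coeff (zExp m) (v 0) ≠ 0) (r : ℕ) :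
    normalSpace α ord v r r ≤ resonant m := by
  have hκ := ((mem_stateSpace_iff v).1 hv).2.2.2
  refine styleComplement_le ord _ _ fun b hb hT => ?_
  rcases basisField_resonant_or (α := α) hκ hH b with h | ⟨S, hS, h⟩
  · exact h
  · rw [hb] at hS
    exact absurd (h ▸ hopfOp_mem_removable hα hv hH hS) hT

theorem mem_resonant_of_gradePart {v : VF m} (hv : v ∈ stateSpace m)
    (h : ∀ r : ℕ, gradePart α r v ∈ resonant m) : v ∈ resonant m := by
  rw [mem_resonant_iff_coeff]
  intro i e he
  by_cases hw : wt α e = 0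
  · exact mem_vfFilt.1 (stateSpace_le_vfFilt (α := α) hv) i e (by lia)
  · have := mem_resonant_iff_coeff.1 (h (wt α e - 1)) i e he
    rwa [coeff_gradePart, if_pos (by lia)] at this

theorem gradePart_mem_resonant {v : VF m} (h : v ∈ resonant m) (n : ℤ) :
    gradePart α n v ∈ resonant m := by
  rw [mem_resonant_iff_coeff] at h ⊢
  intro i e he
  rw [coeff_gradePart, h i e he, ite_self]

/-- Every Hopf singularity is transformed into a resonant one without rescaling time. -/
theorem exists_resonant (hα : 1 ≤ α) {v : VF m} (hv : v ∈ stateSpace m)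
    (hH : MvPowerSeries.coeff (zExp m) (v 0) ≠ 0) :
    ∃ (B : Module.End ℝ (Ser m)) (hG : GPair m α B B), hG.act v ∈ resonant m := by
  have hκ := ((mem_stateSpace_iff v).1 hv).2.2.2
  have hstep : ∀ (r : ℕ) (A B : Module.End ℝ (Ser m)) (hG : GPair m α A B), 1 ≤ r → A = B →
      ∃ (a b : Module.End ℝ (Ser m)) (h : LPair m α a b),
        expOp (serFilt m α) h.raisesA = expOp (serFilt m α) h.raisesB ∧
        Raises (serFilt m α) (serFilt m α) (id r) a ∧
        Raises (serFilt m α) (serFilt m α) (id r) b ∧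
        tanAct a b v ∈ (vfFilt m α).F (r + 1) ∧
        gradePart α r (hG.act v) + gradePart α r (tanAct a b v) ∈ resonant m := by
    intro r A B hG hr _
    have hx := gradePart_mem_stateGrade (α := α) (hG.act_mem hα hv) r
    obtain ⟨x, hx1, y, ⟨S, hS, rfl⟩, hxy⟩ :=
      Submodule.mem_sup.1 (stateGrade_le_resonant_sup hα hκ hH r hx)
    have hS' : -S ∈ stateGrade α (r : ℤ) := Submodule.neg_mem _ hS
    have hY := isGen_of_mem_stateGrade hr hS'
    have hAB : genA ((0, 0, -S) : Gen m) = genB ((0, 0, -S) : Gen m) := by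
      rw [genA]
      refine LinearMap.ext fun f => ?_
      simp
    -- The generator used at step r is homogeneous of grade r, so convergence of the composites is
    -- immediate here.
    have hR : Raises (serFilt m α) (serFilt m α) r (genB ((0, 0, -S) : Gen m)) :=
      genB_raises (fun l => Submodule.zero_mem _) (stateGrade_le_vfFilt hS')
    refine ⟨_, _, hY.lPair hα, ?_, ?_, hR, ?_, ?_⟩
    · congr 1
    · rw [hAB]; exact hR
    · rw [tanAct_gen, diffl_state]
      exact bracket_mem hv hS'
    · rw [tanAct_gen, diffl_state, gradePart_eq_of_sub_mem (bracket_sub_hopfOp_mem hα hv hS'),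
        gradePart_eq_self (hopfOp_mem_stateGrade hκ hS'), map_neg, ← hxy, add_neg_cancel_right]
      exact hx1
  obtain ⟨A, B, A', B', hG, hG', hQ, hA, hB, hN⟩ := exists_normalizing hα hv (fun A B => A = B) rfl
    (fun h h' => by rw [h, h']) (fun _ => resonant m)
    (stateGrade_zero_le_resonant hα (gradePart_mem_stateGrade hv _)) id tendsto_id hstep
  have hAB : A' = B' := by
    refine LinearMap.ext fun f => ?_
    have h1 : Tends (serFilt m α) (fun n => A n f) (A' f) := fun N => (hA N).mono fun n hn => hn f
    have h2 : Tends (serFilt m α) (fun n => B n f) (B' f) := fun N => (hB N).mono fun n hn => hn f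
    have h3 : A = B := funext hQ
    rw [h3] at h1
    exact h1.unique h2
  subst hAB
  refine ⟨A', hG', mem_resonant_of_gradePart (α := α) (hG'.act_mem hα hv) fun r => ?_⟩
  obtain ⟨n, h1, h2, h3⟩ := ((hA (r + 2)).and ((hB (r + 2)).and (eventually_ge_atTop r))).exists
  rw [← gradePart_eq_of_sub_mem ((hG n).act_sub_act_mem hG' h1 h2 (stateSpace_le_vfFilt hv))]
  exact hN n r h3

/-! ### Linear compactness -/

section Chevalley

variable {M L : Type*} [AddCommGroup M] [Module ℝ M] [AddCommGroup L] [Module ℝ L]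

/-- A filtered map from a complete filtered space with finite-dimensional quotients: an element of
the image lying deep in the filtration is the image of an element lying deep in the filtration. -/
theorem exists_deep_preimage (G : ℕ → Submodule ℝ M) (hG : Antitone G)
    (hcomp : ∀ x : ℕ → M, (∀ t, x (t + 1) - x t ∈ G t) → ∃ y, ∀ t, y - x t ∈ G t)
    (hfin : ∀ s, ∃ (V : Type) (_ : AddCommGroup V) (_ : Module ℝ V) (_ : FiniteDimensional ℝ V)
      (ε : M →ₗ[ℝ] V), ∀ x ∈ G 0, ε x = 0 → x ∈ G s)
    (F : ℕ → Submodule ℝ L) (hF : Antitone F) (hsep : ∀ x, (∀ n, x ∈ F n) → x = 0)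
    (d : M →ₗ[ℝ] L) (hd : ∀ s, ∀ x ∈ G s, d x ∈ F s) (s : ℕ) :
    ∃ r, ∀ x ∈ G 0, d x ∈ F r → ∃ k ∈ G s, d k = d x := by
  let K : ℕ → Submodule ℝ M := fun r => G 0 ⊓ (F r).comap d
  have hK : Antitone K := fun i j hij x hx => ⟨hx.1, hF hij hx.2⟩
  have hGK : ∀ s, G s ≤ K s := fun s x hx => ⟨hG (Nat.zero_le s) hx, hd s x hx⟩
  -- A Mittag-Leffler condition: the images of the decreasing spaces `K r` in a finite-dimensional
  -- quotient that detects `G s` stabilize.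
  have hstab : ∀ s, ∃ r, ∀ r', ∀ x ∈ K r, ∃ y ∈ K r', x - y ∈ G s := by
    intro s
    obtain ⟨V, _, _, _, ε, hε⟩ := hfin s
    obtain ⟨r, hr⟩ := IsArtinian.monotone_stabilizes
      (R := ℝ) (M := V) ⟨fun r => OrderDual.toDual ((K r).map ε), fun i j hij =>
        Submodule.map_mono (hK hij)⟩
    refine ⟨r, fun r' x hx => ?_⟩
    rcases le_total r r' with h | h
    · have h1 : (K r).map ε = (K r').map ε := hr r' h
      obtain ⟨y, hy, hxy⟩ := h1 ▸ Submodule.mem_map_of_mem (f := ε) hx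
      refine ⟨y, hy, hε _ (Submodule.sub_mem _ hx.1 hy.1) ?_⟩
      rw [map_sub, hxy, sub_self]
    · exact ⟨x, hK h hx, by rw [sub_self]; exact Submodule.zero_mem _⟩
  choose ρ hρ using hstab
  have hnext : ∀ t (x : M), x ∈ K (ρ t) → ∃ y, y ∈ K (ρ (t + 1)) ∧ x - y ∈ G t :=
    fun t x hx => hρ t (ρ (t + 1)) x hx
  choose! next hn1 hn2 using hnext
  refine ⟨ρ s, fun x hx hdx => ?_⟩
  -- Starting from x, each y n lies in K(ρ(s + n)), and the next term differs from it by an element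
  -- of G(s + n). The limit z satisfies d z = 0 and x − z ∈ G s, so x − z is the deep preimage.
  let y : ℕ → M := fun n => Nat.rec x (fun n z => next (s + n) z) n
  have hy : ∀ n, y n ∈ K (ρ (s + n)) := by
    intro n
    induction n with
    | zero => exact ⟨hx, hdx⟩
    | succ n ih => exact hn1 (s + n) _ ih
  have hy' : ∀ n, y (n + 1) - y n ∈ G (s + n) := fun n => by
    rw [← neg_sub]
    exact Submodule.neg_mem _ (hn2 (s + n) _ (hy n))
  obtain ⟨z, hz⟩ := hcomp (fun t => y (t - s)) fun t => by
    rcases Nat.lt_or_ge t s with h | h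
    · rw [show t + 1 - s = t - s by lia, sub_self]
      exact Submodule.zero_mem _
    · have := hy' (t - s)
      rwa [show s + (t - s) = t by lia, show t - s + 1 = t + 1 - s by lia] at this
  have hzn : ∀ n, z - y n ∈ G (s + n) := fun n => by
    have := hz (s + n)
    rwa [show s + n - s = n by lia] at this
  have hdz : d z = 0 := by
    refine hsep _ fun n => ?_
    obtain ⟨u, hu, huy⟩ := hρ (s + n) n (y n) (hy n)
    have h1 := hd _ _ (hzn n)
    have h2 := hd _ _ huy
    have h3 := Submodule.add_mem _ (Submodule.add_mem _ (hF (Nat.le_add_left n s) h1)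
      (hF (Nat.le_add_left n s) h2)) hu.2
    simpa using h3
  refine ⟨x - z, ?_, by rw [map_sub, hdz, sub_zero]⟩
  have := hzn 0
  rw [← neg_sub]
  exact Submodule.neg_mem _ this

/-- For each r the largest depth not exceeding r that works is taken. Depth 0 always works, with x
itself as preimage, and larger depths become available as r grows. -/
theorem exists_deep_preimage_rate (G : ℕ → Submodule ℝ M) (F : ℕ → Submodule ℝ L)
    (hF : Antitone F) (d : M →ₗ[ℝ] L)
    (h : ∀ s, ∃ r, ∀ x ∈ G 0, d x ∈ F r → ∃ k ∈ G s, d k = d x) :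
    ∃ s : ℕ → ℕ, Tendsto s atTop atTop ∧
      ∀ r, ∀ x ∈ G 0, d x ∈ F r → ∃ k ∈ G (s r), d k = d x := by
  classical
  let P : ℕ → ℕ → Prop := fun r s => ∀ x ∈ G 0, d x ∈ F r → ∃ k ∈ G s, d k = d x
  refine ⟨fun r => Nat.findGreatest (P r) r, tendsto_atTop.2 fun s => ?_, fun r => ?_⟩
  · obtain ⟨r₀, hr₀⟩ := h s
    filter_upwards [eventually_ge_atTop r₀, eventually_ge_atTop s] with r h1 h2
    exact Nat.le_findGreatest h2 fun x hx hdx => hr₀ x hx (hF h1 hdx)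
  · exact Nat.findGreatest_spec (P := P r) (Nat.zero_le r) fun x hx _ => ⟨x, hx, rfl⟩

end Chevalley

/-! ### Resonant generators -/

/-- The filtration of the resonant generators. -/
def resGen (m α : ℕ) (s : ℕ) : Submodule ℝ (Gen m) :=
  genFilt α (s : ℤ) ⊓ (resonant m).comap (LinearMap.snd ℝ _ _ ∘ₗ LinearMap.snd ℝ _ _)

theorem mem_resGen {s : ℕ} {Y : Gen m} :
    Y ∈ resGen m α s ↔ Y ∈ genFilt α (s : ℤ) ∧ Y.2.2 ∈ resonant m := Iff.rfl

theorem mem_resGen_coeff {s : ℕ} {Y : Gen m} : Y ∈ resGen m α s ↔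
    (Y.1 ∈ paramFilt α (max 1 (s : ℤ)) ∧ Y.2.1 ∈ timeFilt α (max 1 (s : ℤ)) ∧
      Y.2.2 ∈ stateFilt α (max 1 (s : ℤ))) ∧ Y.2.2 ∈ resonant m := Iff.rfl

theorem resGen_antitone : Antitone (resGen m α) := by
  intro i j hij Y hY
  rw [mem_resGen_coeff] at hY ⊢
  obtain ⟨⟨h1, h2, h3⟩, h4⟩ := hY
  refine ⟨⟨fun l e => ⟨(h1 l e).1, (h1 l e).2.1, fun he => (h1 l e).2.2 (by lia)⟩,
    fun e => ⟨(h2 e).1, (h2 e).2.1, fun he => (h2 e).2.2 (by lia)⟩, h3.1,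
    fun i e he => h3.2 i e (by lia)⟩, h4⟩

/-- All the coefficients of weight less than `N` vanish. -/
def genLow (m α N : ℕ) : Submodule ℝ (Gen m) :=
  (Submodule.pi Set.univ fun _ => (serFilt m α).F N).prod
    (((serFilt m α).F N).prod ((vfFilt m α).F N))

theorem mem_genLow {N : ℕ} {Y : Gen m} : Y ∈ genLow m α N ↔
    (∀ l, Y.1 l ∈ (serFilt m α).F N) ∧ Y.2.1 ∈ (serFilt m α).F N ∧
      Y.2.2 ∈ (vfFilt m α).F N := by
  rw [genLow, Submodule.mem_prod, Submodule.mem_prod, Submodule.mem_pi]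
  simp

theorem resGen_le_genLow (s : ℕ) : resGen m α s ≤ genLow m α s := by
  intro Y hY
  obtain ⟨⟨h1, h2, h3⟩, -⟩ := mem_resGen_coeff.1 hY
  refine mem_genLow.2 ⟨fun l e he => (h1 l e).2.2 (by lia), fun e he => (h2 e).2.2 (by lia),
    mem_vfFilt.2 fun i e he => h3.2 i e (by lia)⟩

theorem mem_resGen_of_approx {s : ℕ} {Y : Gen m}
    (h : ∀ N, ∃ Z ∈ resGen m α s, Y - Z ∈ genLow m α N) : Y ∈ resGen m α s := by
  have key : ∀ N, ∃ Z ∈ resGen m α s, ∀ e, wt α e < N →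
      (∀ l, MvPowerSeries.coeff e (Y.1 l) = MvPowerSeries.coeff e (Z.1 l)) ∧
      MvPowerSeries.coeff e Y.2.1 = MvPowerSeries.coeff e Z.2.1 ∧
      ∀ i, MvPowerSeries.coeff e (Y.2.2 i) = MvPowerSeries.coeff e (Z.2.2 i) := by
    intro N
    obtain ⟨Z, hZ, hYZ⟩ := h N
    obtain ⟨h1, h2, h3⟩ := mem_genLow.1 hYZ
    refine ⟨Z, hZ, fun e he => ⟨fun l => ?_, ?_, fun i => ?_⟩⟩
    · have : MvPowerSeries.coeff e (Y.1 l - Z.1 l) = 0 := h1 l e he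
      rwa [map_sub, sub_eq_zero] at this
    · have : MvPowerSeries.coeff e (Y.2.1 - Z.2.1) = 0 := h2 e he
      rwa [map_sub, sub_eq_zero] at this
    · have : MvPowerSeries.coeff e (Y.2.2 i - Z.2.2 i) = 0 := mem_vfFilt.1 h3 i e he
      rwa [map_sub, sub_eq_zero] at this
  rw [mem_resGen_coeff, mem_resonant_iff_coeff]
  refine ⟨⟨fun l e => ?_, fun e => ?_, ⟨fun e => ?_, fun e he => ?_, ?_⟩, fun i e he => ?_⟩,
    fun i e he => ?_⟩
  · obtain ⟨Z, hZ, hc⟩ := key (wt α e + 1)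
    rw [(hc e (Nat.lt_succ_self _)).1]
    exact (mem_resGen_coeff.1 hZ).1.1 l e
  · obtain ⟨Z, hZ, hc⟩ := key (wt α e + 1)
    rw [(hc e (Nat.lt_succ_self _)).2.1]
    exact (mem_resGen_coeff.1 hZ).1.2.1 e
  · obtain ⟨Z, hZ, hc⟩ := key (wt α e + 1)
    rw [(hc e (Nat.lt_succ_self _)).2.2, (hc (swapExp e) (by rw [wt_swapExp]; lia)).2.2]
    exact (mem_resGen_coeff.1 hZ).1.2.2.1.1 e
  · obtain ⟨Z, hZ, hc⟩ := key (wt α e + 1)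
    rw [(hc e (Nat.lt_succ_self _)).2.2] at he
    exact (mem_resGen_coeff.1 hZ).1.2.2.1.2.1 e he
  · obtain ⟨Z, hZ, hc⟩ := key (wt α (zExp m) + 1)
    rw [(hc _ (Nat.lt_succ_self _)).2.2]
    exact (mem_resGen_coeff.1 hZ).1.2.2.1.2.2
  · obtain ⟨Z, hZ, hc⟩ := key (wt α e + 1)
    rw [(hc e (Nat.lt_succ_self _)).2.2]
    exact (mem_resGen_coeff.1 hZ).1.2.2.2 i e he
  · obtain ⟨Z, hZ, hc⟩ := key (wt α e + 1)
    rw [(hc e (Nat.lt_succ_self _)).2.2]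
    exact mem_resonant_iff_coeff.1 (mem_resGen_coeff.1 hZ).2 i e he

theorem resGen_complete (x : ℕ → Gen m) (hx : ∀ t, x (t + 1) - x t ∈ resGen m α t) :
    ∃ y, ∀ t, y - x t ∈ resGen m α t := by
  have hlow : ∀ N, ∀ᶠ t in atTop, x (t + 1) - x t ∈ genLow m α N := by
    intro N
    filter_upwards [eventually_ge_atTop N] with t ht
    exact resGen_le_genLow _ (resGen_antitone ht (hx t))
  choose P hP using fun l => (serFilt m α).complete (fun t => (x t).1 l) fun N =>
    (hlow N).mono fun t ht => (mem_genLow.1 ht).1 l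
  obtain ⟨T, hT⟩ := (serFilt m α).complete (fun t => (x t).2.1) fun N =>
    (hlow N).mono fun t ht => (mem_genLow.1 ht).2.1
  obtain ⟨S, hS⟩ := (vfFilt m α).complete (fun t => (x t).2.2) fun N =>
    (hlow N).mono fun t ht => (mem_genLow.1 ht).2.2
  refine ⟨(P, T, S), fun t => mem_resGen_of_approx fun N => ?_⟩
  obtain ⟨n, h1, h2, h3, h4⟩ := ((eventually_all.2 fun l => hP l N).and ((hT N).and
    ((hS N).and (eventually_ge_atTop t)))).exists
  refine ⟨x n - x t, ?_, ?_⟩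
  · clear h1 h2 h3
    induction n, h4 using Nat.le_induction with
    | base => rw [sub_self]; exact Submodule.zero_mem _
    | succ k hk ih =>
      have := Submodule.add_mem _ (resGen_antitone hk (hx k)) ih
      rwa [sub_add_sub_cancel] at this
  · rw [sub_sub_sub_cancel_right, ← neg_sub]
    refine Submodule.neg_mem _ (mem_genLow.2 ⟨h1, h2, h3⟩)

theorem resGen_finite (hα : 1 ≤ α) (s : ℕ) : ∃ (V : Type) (_ : AddCommGroup V) (_ : Module ℝ V)
    (_ : FiniteDimensional ℝ V) (ε : Gen m →ₗ[ℝ] V),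
      ∀ x ∈ resGen m α 0, ε x = 0 → x ∈ resGen m α s := by
  -- The weight exceeds the grade by α for parameter components and by 1 for state components. The
  -- bound α + s + 1 covers all coefficients that must vanish, also for s = 0, where `genFilt`
  -- starts at grade 1.
  let E := {e : Expo m // wt α e < α + s + 1}
  have : Finite E := (finite_wt_lt hα (α + s + 1)).to_subtype
  have := Fintype.ofFinite E
  let ε : Gen m →ₗ[ℝ] (Fin m → E → ℂ) × (E → ℂ) × (Fin 2 → E → ℂ) :=
    LinearMap.prodMap
      (LinearMap.pi fun l => LinearMap.pi fun e : E => coeffR e.1 ∘ₗ LinearMap.proj l)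
      (LinearMap.prodMap (LinearMap.pi fun e : E => coeffR e.1)
        (LinearMap.pi fun i => LinearMap.pi fun e : E => coeffR e.1 ∘ₗ LinearMap.proj i))
  refine ⟨_, inferInstance, inferInstance, inferInstance, ε, fun Y hY hε => ?_⟩
  have hP : ∀ l (e : E), MvPowerSeries.coeff e.1 (Y.1 l) = 0 := fun l e =>
    congrFun (congrFun (congrArg Prod.fst hε) l) e
  have hT : ∀ e : E, MvPowerSeries.coeff e.1 Y.2.1 = 0 := fun e =>
    congrFun (congrArg (fun p => p.2.1) hε) e
  have hS : ∀ i (e : E), MvPowerSeries.coeff e.1 (Y.2.2 i) = 0 := fun i e =>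
    congrFun (congrFun (congrArg (fun p => p.2.2) hε) i) e
  rw [mem_resGen_coeff] at hY ⊢
  obtain ⟨⟨h1, h2, h3⟩, h4⟩ := hY
  refine ⟨⟨fun l e => ⟨(h1 l e).1, (h1 l e).2.1, fun he => ?_⟩,
    fun e => ⟨(h2 e).1, (h2 e).2.1, fun he => ?_⟩, h3.1, fun i e he => ?_⟩, h4⟩
  · by_cases h : wt α e < α + s + 1
    · exact hP l ⟨e, h⟩
    · exact (h1 l e).2.2 (by lia)
  · by_cases h : wt α e < α + s + 1
    · exact hT ⟨e, h⟩
    · exact (h2 e).2.2 (by lia)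
  · by_cases h : wt α e < α + s + 1
    · exact hS i ⟨e, h⟩
    · exact h3.2 i e (by lia)

theorem resGen_raises {s : ℕ} {Y : Gen m} (hY : Y ∈ resGen m α s) :
    Raises (serFilt m α) (serFilt m α) s (genA Y) ∧
      Raises (serFilt m α) (serFilt m α) s (genB Y) := by
  have hY' : Y ∈ resGen m α (max 1 s) := by
    rw [mem_resGen_coeff] at hY ⊢
    have : max 1 ((max 1 s : ℕ) : ℤ) = max 1 (s : ℤ) := by push_cast; simp
    rwa [this]
  obtain ⟨h1, h2, h3⟩ := (mem_genFilt_iff (le_max_left 1 s)).1 (mem_resGen.1 hY').1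
  exact ⟨(genA_raises (fun l => (h1 l).2.2) h2.2.2 h3.2).mono (le_max_right 1 s),
    (genB_raises (fun l => (h1 l).2.2) h3.2).mono (le_max_right 1 s)⟩

theorem resGen_zero_le {s : ℕ} {Y : Gen m} (hY : Y ∈ resGen m α s) : Y ∈ genSpace α := by
  have h := mem_resGen.1 (resGen_antitone (Nat.zero_le s) hY)
  have : (genSpace α : Submodule ℝ (Gen m)) = genFilt α ((0 : ℕ) : ℤ) := by
    simp [genSpace, genFilt]
  rw [this]
  exact h.1

theorem diffl_mem_of_resGen {v : VF m} (hv : v ∈ (vfFilt m α).F 1) {s : ℕ} {Y : Gen m}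
    (hY : Y ∈ resGen m α s) : diffl v Y ∈ (vfFilt m α).F (s + 1) := by
  obtain ⟨h1, h2⟩ := resGen_raises hY
  rw [← tanAct_gen, mem_vfFilt]
  intro j
  refine Submodule.sub_mem _ ?_ ?_
  · have := h1 _ _ (mem_vfFilt.1 hv j)
    rwa [add_comm] at this
  · have := vder_raises (p := 0) hv _ _ (h2 _ _ (X_mem_serFilt (α := α) (Sum.inl j)))
    exact (serFilt m α).mem_of_le (by simp [varWt]) this

theorem exists_resGen_rate (hα : 1 ≤ α) {v : VF m} (hv : v ∈ stateSpace m) :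
    ∃ s : ℕ → ℕ, Tendsto s atTop atTop ∧ ∀ r, ∀ Y ∈ resGen m α 0,
      diffl v Y ∈ (vfFilt m α).F r → ∃ Z ∈ resGen m α (s r), diffl v Z = diffl v Y :=
  exists_deep_preimage_rate _ _ (vfFilt m α).anti _
    (exists_deep_preimage (resGen m α) resGen_antitone resGen_complete (resGen_finite hα)
      (vfFilt m α).F (vfFilt m α).anti (vfFilt m α).sep (diffl v) fun s _ hY =>
        (vfFilt m α).mem_of_le (Nat.le_succ s) (diffl_mem_of_resGen (stateSpace_le_vfFilt hv) hY))

/-! ### Projection to the resonant part -/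

open Classical in
/-- The part of charge `q` of a power series. -/
def chargePart (q : ℂ) : Module.End ℝ (Ser m) where
  toFun f := fun e => if charge e = q then MvPowerSeries.coeff e f else 0
  map_add' f g := by
    ext e
    change (if charge e = q then MvPowerSeries.coeff e (f + g) else 0) =
      (if charge e = q then MvPowerSeries.coeff e f else 0) +
        (if charge e = q then MvPowerSeries.coeff e g else 0)
    split_ifs <;> simp
  map_smul' c f := by
    ext e
    change (if charge e = q then MvPowerSeries.coeff e (c • f) else 0) =
      c • (if charge e = q then MvPowerSeries.coeff e f else 0)
    split_ifs <;> simp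

open Classical in
theorem coeff_chargePart (q : ℂ) (f : Ser m) (e : Expo m) :
    MvPowerSeries.coeff e (chargePart q f) =
      if charge e = q then MvPowerSeries.coeff e f else 0 := rfl

theorem chargePart_eq_self {q : ℂ} {f : Ser m} (h : chargeOp f = q • f) : chargePart q f = f := by
  ext e
  rw [coeff_chargePart]
  split_ifs with he
  · rfl
  · exact (chargeOp_eq_smul_iff.1 h e he).symm

theorem chargePart_mul {p q : ℂ} {f g : Ser m} (hg : chargeOp g = p • g) :
    chargePart q (f * g) = chargePart (q - p) f * g := by
  classical
  ext e
  rw [coeff_chargePart, MvPowerSeries.coeff_mul, MvPowerSeries.coeff_mul]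
  split_ifs with he
  · refine Finset.sum_congr rfl fun d hd => ?_
    rw [coeff_chargePart]
    by_cases hp : charge d.2 = p
    · rw [if_pos]
      rw [← he, ← hp, ← Finset.HasAntidiagonal.mem_antidiagonal.1 hd, charge_add, add_sub_cancel_right]
    · rw [chargeOp_eq_smul_iff.1 hg _ hp, mul_zero, mul_zero]
  · refine (Finset.sum_eq_zero fun d hd => ?_).symm
    rw [coeff_chargePart]
    by_cases hp : charge d.2 = p
    · rw [if_neg, zero_mul]
      intro h
      refine he ?_
      rw [← Finset.HasAntidiagonal.mem_antidiagonal.1 hd, charge_add, h, hp, sub_add_cancel]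
    · rw [chargeOp_eq_smul_iff.1 hg _ hp, mul_zero]

theorem chargePart_pderiv (q : ℂ) (s : Var m) (f : Ser m) :
    chargePart q (MvPowerSeries.pderiv ℂ s f) =
      MvPowerSeries.pderiv ℂ s (chargePart (q + varCharge m s) f) := by
  ext e
  rw [coeff_chargePart, MvPowerSeries.coeff_pderiv, MvPowerSeries.coeff_pderiv, coeff_chargePart,
    charge_add, charge_single]
  by_cases h : charge e = q
  · rw [if_pos h, if_pos (by rw [h])]
  · rw [if_neg h, if_neg fun h' => h (add_right_cancel h'), zero_mul]

theorem chargeOp_pderiv {q : ℂ} (s : Var m) {f : Ser m} (h : chargeOp f = q • f) :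
    chargeOp (MvPowerSeries.pderiv ℂ s f) =
      (q - varCharge m s) • MvPowerSeries.pderiv ℂ s f := by
  rw [chargeOp_eq_smul_iff]
  intro e he
  rw [MvPowerSeries.coeff_pderiv, chargeOp_eq_smul_iff.1 h, zero_mul]
  rw [charge_add, charge_single]
  exact fun h => he (by rw [← h, add_sub_cancel_right])

theorem chargeOp_of_axis {f : Ser m} (h : axisOp f = f) : chargeOp f = 0 := by
  rw [chargeOp_eq_zero_iff]
  intro e he
  refine (axisOp_eq_self_iff f).1 h e fun h0 => he ?_
  rw [stateDeg] at h0
  lia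

/-- The resonant part of a vector field. -/
def resPart (u : VF m) : VF m := fun i => chargePart (varCharge m (Sum.inl i)) (u i)

theorem resPart_eq_self {u : VF m} (h : u ∈ resonant m) : resPart u = u :=
  funext fun i => chargePart_eq_self (h i)

theorem resPart_mem_resonant (u : VF m) : resPart u ∈ resonant m := by
  rw [mem_resonant_iff_coeff]
  intro i e he
  rw [resPart, coeff_chargePart, if_neg he]

theorem coeff_resPart_of_eq_zero {u : VF m} {i : Fin 2} {e : Expo m}
    (h : MvPowerSeries.coeff e (u i) = 0) : MvPowerSeries.coeff e (resPart u i) = 0 := by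
  rw [resPart, coeff_chargePart, h, ite_self]

theorem resPart_mem_stateFilt {u : VF m} {p : ℤ} (hu : u ∈ stateFilt α p) :
    resPart u ∈ stateFilt α p := by
  obtain ⟨⟨h1, h2, h3⟩, h4⟩ := hu
  refine ⟨⟨fun e => ?_, fun e he => h2 e fun h => he (coeff_resPart_of_eq_zero h), ?_⟩,
    fun i e he => coeff_resPart_of_eq_zero (h4 i e he)⟩
  · rw [resPart, resPart, coeff_chargePart, coeff_chargePart, h1, charge_swapExp]
    have e0 : varCharge m (Sum.inl 0) = 1 := rfl
    have e1 : varCharge m (Sum.inl 1) = -1 := rfl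
    rw [e0, e1]
    by_cases h : charge e = -1
    · rw [if_pos h, if_pos (by rw [h, neg_neg])]
    · rw [if_neg h, if_neg fun h' => h (by rw [← h', neg_neg]), map_zero]
  · rw [resPart, coeff_chargePart]
    split_ifs
    · exact h3
    · rfl

theorem resPart_mem_vfFilt {u : VF m} {N : ℕ} (hu : u ∈ (vfFilt m α).F N) :
    resPart u ∈ (vfFilt m α).F N :=
  mem_vfFilt.2 fun i e he => coeff_resPart_of_eq_zero (mem_vfFilt.1 hu i e he)

theorem gradePart_resPart (n : ℤ) (u : VF m) :
    gradePart α n (resPart u) = resPart (gradePart α n u) := by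
  funext i
  ext e
  rw [coeff_gradePart, resPart, resPart, coeff_chargePart, coeff_chargePart, coeff_gradePart]
  split_ifs <;> rfl

/-- For resonant v the differential is equivariant under rotations, and the parameter and time
components are invariant, so projecting to the resonant part affects only the state component. -/
theorem resPart_diffl {v : VF m} (hv : v ∈ resonant m) {Y : Gen m}
    (hP : ∀ l, chargeOp (Y.1 l) = 0) (hT : chargeOp Y.2.1 = 0) :
    resPart (diffl v Y) = diffl v (Y.1, Y.2.1, resPart Y.2.2) := by
  funext i
  change chargePart _ ((∑ l : Fin m, MvPowerSeries.pderiv ℂ (Sum.inr l) (v i) * Y.1 l) +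
    Y.2.1 * v i + bracket Y.2.2 v i) =
    (∑ l : Fin m, MvPowerSeries.pderiv ℂ (Sum.inr l) (v i) * Y.1 l) +
    Y.2.1 * v i + bracket (resPart Y.2.2) v i
  have h1 : ∀ l, chargePart (varCharge m (Sum.inl i))
      (MvPowerSeries.pderiv ℂ (Sum.inr l) (v i) * Y.1 l) =
      MvPowerSeries.pderiv ℂ (Sum.inr l) (v i) * Y.1 l := by
    intro l
    rw [chargePart_mul (p := 0) (by rw [hP, zero_smul]), sub_zero, chargePart_eq_self]
    have := chargeOp_pderiv (Sum.inr l) (hv i)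
    rwa [show varCharge m (Sum.inr l) = 0 from rfl, sub_zero] at this
  have h2 : chargePart (varCharge m (Sum.inl i)) (Y.2.1 * v i) = Y.2.1 * v i := by
    rw [chargePart_mul (hv i), sub_self, chargePart_eq_self (by rw [hT, zero_smul])]
  have h3 : ∀ j, chargePart (varCharge m (Sum.inl i))
      (MvPowerSeries.pderiv ℂ (Sum.inl j) (Y.2.2 i) * v j) =
      MvPowerSeries.pderiv ℂ (Sum.inl j) (resPart Y.2.2 i) * v j := by
    intro j
    rw [chargePart_mul (hv j), chargePart_pderiv, sub_add_cancel]
    rfl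
  have h4 : ∀ j, chargePart (varCharge m (Sum.inl i))
      (MvPowerSeries.pderiv ℂ (Sum.inl j) (v i) * Y.2.2 j) =
      MvPowerSeries.pderiv ℂ (Sum.inl j) (v i) * resPart Y.2.2 j := by
    intro j
    rw [mul_comm, chargePart_mul (chargeOp_pderiv (Sum.inl j) (hv i)), sub_sub_cancel, mul_comm]
    rfl
  rw [map_add, map_add, map_sum, h2, bracket, bracket, map_sum]
  simp only [h1, map_sub, h3, h4]

theorem genSpace_chargeOp_param {Y : Gen m} (hY : Y ∈ genSpace α) (l : Fin m) :
    chargeOp (Y.1 l) = 0 := chargeOp_of_axis ((mem_genSpace_iff.1 hY).1.axisP l)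

/-- For a resonant field, resonant removable terms are removed by resonant generators. -/
theorem exists_resGen_of_removable {v : VF m} (hv : v ∈ resonant m) {r : ℕ} {x : VF m}
    (hx : x ∈ removable α v r r) (hxr : x ∈ resonant m) :
    ∃ Y ∈ resGen m α 0, diffl v Y ∈ (vfFilt m α).F (r + 1) ∧ gradePart α r (diffl v Y) = x := by
  rw [removable, specB, genFilt_sub_eq] at hx
  obtain ⟨_, ⟨h1, Y, hY, rfl⟩, rfl⟩ := hx
  have hd := resPart_diffl hv (Y := Y) (genSpace_chargeOp_param hY) (mem_genSpace_iff.1 hY).2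
  refine ⟨(Y.1, Y.2.1, resPart Y.2.2), ?_, ?_, ?_⟩
  · have h0 : max (1 : ℤ) ((0 : ℕ) : ℤ) = 1 := by simp
    rw [mem_resGen_coeff, h0]
    exact ⟨⟨hY.1, hY.2.1, resPart_mem_stateFilt hY.2.2⟩, resPart_mem_resonant _⟩
  · rw [← hd]
    exact resPart_mem_vfFilt (mem_stateFilt_iff.1 h1).2
  · rw [← hd, gradePart_resPart, resPart_eq_self hxr]

/-! ### Transformations commuting with the rotation, and normalization of a resonant field. -/

/-- Compatibility with the charge. -/
def ChargePair (A B : Module.End ℝ (Ser m)) : Prop := Commute A chargeOp ∧ Commute B chargeOp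

theorem chargePair_gen (hα : 1 ≤ α) {s : ℕ} {Y : Gen m} (hY : Y ∈ resGen m α s) :
    ChargePair (genA Y) (genB Y) := by
  have hg := resGen_zero_le hY
  have hG := (mem_genSpace_iff.1 hg).1
  have hB : Commute (genB Y) chargeOp := by
    refine der_commute_chargeOp hα ?_ ?_
    · rintro (j | l)
      · exact Submodule.neg_mem _ (mem_vfFilt.1 ((vfFilt m α).mem_of_le one_le_two hG.memS) j)
      · exact (serFilt m α).mem_of_le (Nat.le_succ _) (hG.memP l)
    · rintro (j | l)
      · change chargeOp (-Y.2.2 j) = _ • -Y.2.2 j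
        rw [map_neg, (mem_resGen.1 hY).2 j, smul_neg]
      · change chargeOp (Y.1 l) = (0 : ℂ) • Y.1 l
        rw [genSpace_chargeOp_param hg, zero_smul]
  refine ⟨hB.add_left (LinearMap.ext fun f => ?_), hB⟩
  change Y.2.1 * chargeOp f = chargeOp (Y.2.1 * f)
  rw [chargeOp_mul, (mem_genSpace_iff.1 hg).2, zero_mul, zero_add]

theorem ChargePair.mem_resonant (hα : 1 ≤ α) {A B : Module.End ℝ (Ser m)} (hG : GPair m α A B)
    (h : ChargePair A B) {v : VF m} (hv : v ∈ stateSpace m) (hr : v ∈ resonant m) :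
    hG.act v ∈ resonant m := by
  have hv1 : Commute (vder v) chargeOp := by
    rw [vder_eq_der]
    refine der_commute_chargeOp hα ?_ ?_
    · rintro (j | l)
      · exact mem_vfFilt.1 (stateSpace_le_vfFilt hv) j
      · exact Submodule.zero_mem _
    · rintro (j | l)
      · exact hr j
      · simp
  have hi : Commute (invOp (serFilt m α) hG.unipB) chargeOp :=
    commute_of_limit hG.unipB _ (chargeOp_raises α) (h.2.sub_left (Commute.one_left _))
  -- The operators are only assumed real linear here; this suffices because the charges of z and w
  -- are ±1.
  have hs : ∀ (K : Module.End ℝ (Ser m)) (j : Fin 2) (f : Ser m),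
      K (varCharge m (Sum.inl j) • f) = varCharge m (Sum.inl j) • K f := by
    intro K j f
    fin_cases j
    · change K ((1 : ℂ) • f) = (1 : ℂ) • K f
      rw [one_smul, one_smul]
    · change K ((-1 : ℂ) • f) = (-1 : ℂ) • K f
      rw [neg_smul, neg_smul, one_smul, one_smul, map_neg]
  intro j
  rw [GPair.act, ← commute_apply h.1, ← commute_apply hv1, ← commute_apply hi, chargeOp_X,
    hs, hs, hs]

/-- Generators have grade at least one, so nothing of grade 0 is removable and the complement is the
whole of grade 0. -/
theorem gradePart_zero_mem_normalSpace (hα : 1 ≤ α) (ord : ℕ ≃ BasisIndex m) {v : VF m}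
    (hv : v ∈ stateSpace m) (hH : MvPowerSeries.coeff (zExp m) (v 0) ≠ 0) :
    gradePart α (0 : ℕ) v ∈ normalSpace α ord v (0 : ℕ) (0 : ℕ) := by
  have h0 : removable α v (0 : ℕ) (0 : ℕ) = ⊥ := by
    rw [eq_bot_iff]
    intro x hx
    obtain ⟨a, b, h, -, rfl⟩ := (mem_removable_iff hα hv hH).1 hx
    exact gradePart_zero_of_mem (tanAct_mem_two h (stateSpace_le_vfFilt hv))
  have hx := gradePart_mem_stateGrade (α := α) hv (0 : ℕ)
  rw [← styleComplement_sup hα ord (removable_le_stateGrade v 0), h0, sup_bot_eq, ← h0] at hx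
  exact hx

/-- Normalization of a resonant field by resonant transformations. -/
theorem exists_normal_form (hα : 1 ≤ α) (ord : ℕ ≃ BasisIndex m) {v : VF m}
    (hv : v ∈ stateSpace m) (hH : MvPowerSeries.coeff (zExp m) (v 0) ≠ 0)
    (hr : v ∈ resonant m) :
    ∃ (A B : ℕ → Module.End ℝ (Ser m)) (A' B' : Module.End ℝ (Ser m))
      (hG : ∀ n, GPair m α (A n) (B n)), GPair m α A' B' ∧ (∀ n, ChargePair (A n) (B n)) ∧
      (∀ N, ∀ᶠ n in atTop, ∀ f, A n f - A' f ∈ (serFilt m α).F N) ∧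
      (∀ N, ∀ᶠ n in atTop, ∀ f, B n f - B' f ∈ (serFilt m α).F N) ∧
      ∀ n k : ℕ, k ≤ n → gradePart α k ((hG n).act v) ∈ normalSpace α ord v k k := by
  obtain ⟨s, hs, hrate⟩ := exists_resGen_rate hα hv
  refine exists_normalizing hα hv ChargePair ⟨Commute.one_left _, Commute.one_left _⟩
    (fun h h' => ⟨h.1.mul_left h'.1, h.2.mul_left h'.2⟩) (fun k => normalSpace α ord v k k) ?_
    (fun r => s (r + 1)) ((tendsto_add_atTop_iff_nat 1).2 hs) ?_
  · exact gradePart_zero_mem_normalSpace hα ord hv hH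
  · intro r A B hG _ hQ
    have hx := gradePart_mem_stateGrade (α := α) (hG.act_mem hα hv) r
    have hxr := gradePart_mem_resonant (α := α) (hQ.mem_resonant hα hG hv hr) r
    rw [← styleComplement_sup hα ord (removable_le_stateGrade v r), Submodule.mem_sup] at hx
    obtain ⟨n, hn, t, ht, hnt⟩ := hx
    -- The removable part to be cancelled is a difference of the current resonant part and an
    -- element of the complement, both resonant.
    have htr : -t ∈ resonant m := by
      have : -t = n - gradePart α r (hG.act v) := by rw [← hnt]; abel
      rw [this]
      exact Submodule.sub_mem _ (normalSpace_le_resonant hα ord hv hH r hn) hxr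
    obtain ⟨Y, hY, hd, hg⟩ := exists_resGen_of_removable hr (Submodule.neg_mem _ ht) htr
    -- `Y` may have low grade. It is exchanged for a resonant generator with the same differential
    -- at depth s(r + 1), which secures convergence.
    obtain ⟨Z, hZ, hZd⟩ := hrate (r + 1) Y hY hd
    rw [← hZd] at hd hg
    have hL := (mem_genSpace_iff.1 (resGen_zero_le hZ)).1.lPair hα
    have hc := chargePair_gen hα hZ
    refine ⟨_, _, hL, ⟨?_, ?_⟩, (resGen_raises hZ).1, (resGen_raises hZ).2, ?_, ?_⟩
    · exact commute_of_limit hL.raisesA _ (chargeOp_raises α) hc.1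
    · exact commute_of_limit hL.raisesB _ (chargeOp_raises α) hc.2
    · rwa [tanAct_gen]
    · rw [tanAct_gen, hg, ← hnt, add_neg_cancel_right]
      exact hn

/-! ### The normalizing sequence and uniqueness -/

theorem genOne_mem (hα : 1 ≤ α) : (GPair.one (m := m) (α := α)).gen hα ∈ genSpace α := by
  refine GPair.gen_mem_genSpace hα _ ?_
  have := chargeOp_C (m := m) 1
  simpa using this

theorem Rel.unique {A B : Module.End ℝ (Ser m)} (h : GPair m α A B) {v w w' : VF m}
    (hr : Rel A B v w) (hr' : Rel A B v w') : w = w' := (hr.eq_act h).trans (hr'.eq_act h).symm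

theorem exists_rel_of_nearId (hα : 1 ≤ α) {Y : ℕ → Gen m} (hY : ∀ n, Y n ∈ genSpace α)
    {vs : ℕ → VF m} (h0 : vs 0 ∈ stateSpace m)
    (hs : ∀ n, vs (n + 1) = nearId (Y (n + 1)) (vs n)) (n : ℕ) :
    ∃ A B, GPair m α A B ∧ Rel A B (vs 0) (vs n) := by
  induction n with
  | zero => exact ⟨1, 1, GPair.one, Rel.refl _⟩
  | succ n ih =>
    obtain ⟨A, B, hG, hr⟩ := ih
    have hg := (mem_genSpace_iff.1 (hY (n + 1))).1
    refine ⟨_, _, (hg.gPair hα).mul hG, hr.trans ?_⟩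
    rw [hs]
    exact hg.rel_nearId hα (hr.mem_stateSpace hα hG h0)

theorem normalSpace_congr (ord : ℕ ≃ BasisIndex m) {v w : VF m} {r : ℕ}
    (h : removable α w r r = removable α v r r) :
    normalSpace α ord w r r = normalSpace α ord v r r := by
  rw [normalSpace, normalSpace, h]

theorem mem_vfFilt_of_mem_stateFilt {u : VF m} {N : ℕ} (h : u ∈ stateFilt α (N : ℤ)) :
    u ∈ (vfFilt m α).F (N + 1) := (mem_stateFilt_iff.1 h).2

/-- A field in normal form that is a limit of fields equivalent to `u` agrees with `u` if `u` is in
normal form. -/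
theorem normal_form_unique (hα : 1 ≤ α) (ord : ℕ ≃ BasisIndex m) {v u w : VF m}
    (hu : u ∈ stateSpace m) (hH : MvPowerSeries.coeff (zExp m) (u 0) ≠ 0)
    (hT : ∀ r : ℕ, removable α u r r = removable α v r r)
    (hun : ∀ r : ℕ, gradePart α r u ∈ normalSpace α ord v r r)
    (hwn : ∀ r : ℕ, gradePart α r w ∈ normalSpace α ord v r r)
    {vs : ℕ → VF m} (hvs : ∀ n, ∃ A B, GPair m α A B ∧ Rel A B u (vs n))
    (hlim : FiltTendsto (stateFilt α) vs w) : w = u := by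
  refine (vfFilt m α).eq_of_forall_sub_mem fun N => ?_
  have key : ∀ r : ℕ, w - u ∈ (vfFilt m α).F (r + 1) := by
    intro r
    induction r with
    | zero =>
      obtain ⟨n, hn⟩ := (hlim (0 : ℕ)).exists
      obtain ⟨A, B, hG, hr⟩ := hvs n
      have h1 := stateSpace_le_vfFilt (α := α)
        (Submodule.sub_mem _ (hr.mem_stateSpace hα hG hu) hu)
      have := Submodule.sub_mem _ h1 (mem_vfFilt_of_mem_stateFilt hn)
      rwa [sub_sub_sub_cancel_left] at this
    | succ r ih =>
      obtain ⟨n, hn⟩ := (hlim (r + 1 : ℕ)).exists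
      have hn' := mem_vfFilt_of_mem_stateFilt hn
      obtain ⟨A, B, hG, hr⟩ := hvs n
      have h1 : vs n - u ∈ (vfFilt m α).F (r + 1) := by
        have := Submodule.add_mem _ ((vfFilt m α).mem_of_le (by lia) hn') ih
        rwa [sub_add_sub_cancel] at this
      -- The difference of the two grade-r parts is removable by equivalence and lies in the
      -- complement by normality, hence vanishes.
      have h2 := hr.gradePart_sub_mem_removable hα hG hu hH h1
      rw [gradePart_eq_of_sub_mem hn', hT] at h2
      have h3 := Submodule.disjoint_def.1 (disjoint_styleComplement ord r (removable α v r r)) _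
        (Submodule.sub_mem _ (hwn r) (hun r)) h2
      exact sub_mem_of_gradePart_eq ih (sub_eq_zero.1 h3)
  exact (vfFilt m α).mem_of_le (Nat.le_succ N) (key N)

/-! ### Assembly of the normalizing sequence. -/

/-- The transformations `1, ψ₁ σ, ψ₂ σ, …`. -/
def chainOp (ψ : ℕ → Module.End ℝ (Ser m)) (σ : Module.End ℝ (Ser m)) :
    ℕ → Module.End ℝ (Ser m)
  | 0 => 1
  | n + 1 => ψ (n + 1) * σ

theorem chain_gPair {A B : ℕ → Module.End ℝ (Ser m)} {σ : Module.End ℝ (Ser m)}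
    (hG : ∀ n, GPair m α (A n) (B n)) (hσ : GPair m α σ σ) (n : ℕ) :
    GPair m α (chainOp A σ n) (chainOp B σ n) := by
  cases n with
  | zero => exact GPair.one
  | succ n => exact (hG (n + 1)).mul hσ

theorem chargeOp_apply_one {K : Module.End ℝ (Ser m)} (h : Commute K chargeOp) :
    chargeOp (K 1) = 0 := by
  have := chargeOp_C (m := m) 1
  rw [map_one] at this
  rw [← commute_apply h, this, map_zero]

theorem chargeOp_one : chargeOp (1 : Ser m) = 0 := chargeOp_apply_one (K := 1) (Commute.one_left _)

theorem chargeOp_chain {A B : ℕ → Module.End ℝ (Ser m)} {σ : Module.End ℝ (Ser m)}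
    (hσ : GPair m α σ σ) (hc : ∀ n, ChargePair (A n) (B n)) (n : ℕ) :
    chargeOp (chainOp A σ n 1) = 0 := by
  cases n with
  | zero => exact chargeOp_one
  | succ n =>
    rw [chainOp, Module.End.mul_apply, hσ.map_one_B]
    exact chargeOp_apply_one (hc _).1

/-- Quotients of consecutive composites give the single steps Φ. After the first step σ cancels, and
the quotient of two transformations commuting with the charge commutes with it. In the first step σ
remains, but it rescales no time and fixes 1. -/
theorem chargeOp_chain_step {A B : ℕ → Module.End ℝ (Ser m)} {σ : Module.End ℝ (Ser m)}
    (hG : ∀ n, GPair m α (A n) (B n)) (hσ : GPair m α σ σ) (hc : ∀ n, ChargePair (A n) (B n))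
    (n : ℕ) : chargeOp (((chainOp A σ (n + 1)) *
      invOp (serFilt m α) (chain_gPair hG hσ n).unipA) 1) = 0 := by
  cases n with
  | zero =>
    have : invOp (serFilt m α) (chain_gPair hG hσ 0).unipA 1 = 1 := invOp_apply _ 1
    rw [Module.End.mul_apply, this]
    exact chargeOp_chain hσ hc 1
  | succ n =>
    set y := invOp (serFilt m α) (hG (n + 1)).unipA 1 with hy
    have h1 : chainOp A σ (n + 1) (invOp (serFilt m α) hσ.unipA y) = 1 := by
      rw [chainOp, Module.End.mul_apply, apply_invOp, hy, apply_invOp]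
    have h2 : invOp (serFilt m α) (chain_gPair hG hσ (n + 1)).unipA 1 =
        invOp (serFilt m α) hσ.unipA y := by
      rw [← h1, invOp_apply]
    have hi : Commute (invOp (serFilt m α) (hG (n + 1)).unipA) chargeOp :=
      commute_of_limit _ _ (chargeOp_raises α) ((hc _).1.sub_left (Commute.one_left _))
    rw [Module.End.mul_apply, h2, chainOp, Module.End.mul_apply, apply_invOp, hy,
      ← Module.End.mul_apply]
    exact chargeOp_apply_one ((hc _).1.mul_left hi)

theorem exists_normalizing_sequence (hα : 1 ≤ α) (ord : ℕ ≃ BasisIndex m) {v : VF m}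
    (hv : v ∈ stateSpace m) (hH : MvPowerSeries.coeff (zExp m) (v 0) ≠ 0) :
    ∃ (vinf : VF m) (Y : ℕ → Gen m) (vs : ℕ → VF m) (Ycomp : ℕ → Gen m) (Yinf : Gen m),
      vinf ∈ stateSpace m ∧
      (∀ r : ℕ, gradePart α r vinf ∈ normalSpace α ord v r r) ∧
      (∀ n, Y n ∈ genSpace α) ∧ vs 0 = v ∧ (∀ n, vs n ∈ stateSpace m) ∧
      (∀ n, vs (n + 1) = nearId (Y (n + 1)) (vs n)) ∧
      (∀ n k : ℕ, k ≤ n → gradePart α k (vs n) ∈ normalSpace α ord v k k) ∧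
      (∀ n r : ℕ, removable α (vs n) r r = removable α v r r) ∧
      FiltTendsto (stateFilt α) vs vinf ∧ (∀ n, Ycomp n ∈ genSpace α) ∧
      (∀ n, ∀ u ∈ stateSpace m, composite Y n u = nearId (Ycomp n) u) ∧
      Yinf ∈ genSpace α ∧ FiltTendsto (genFilt α) Ycomp Yinf ∧ vinf = nearId Yinf v := by
  obtain ⟨σ, hσ, hres⟩ := exists_resonant hα hv hH
  have hv1 := stateSpace_le_vfFilt (α := α) hv
  have hrel := hσ.rel_act hα hv1
  set v' := hσ.act v with hv'def
  have hv' : v' ∈ stateSpace m := hσ.act_mem hα hv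
  have hH' : MvPowerSeries.coeff (zExp m) (v' 0) ≠ 0 := by
    rw [hrel.coeff_zExp hσ hv]; exact hH
  obtain ⟨A, B, A', B', hG, hG', hc, hA, hB, hN⟩ := exists_normal_form hα ord hv' hH' hres
  have hc' : Commute A' chargeOp := commute_of_tends (chargeOp_raises α)
    (fun f N => (hA N).mono fun n hn => hn f) fun n => (hc n).1
  have hχ := chain_gPair hG hσ
  have hχ' := hG'.mul hσ
  have hχA : ∀ N, ∀ᶠ n in atTop, ∀ f, chainOp A σ n f - (A' * σ) f ∈ (serFilt m α).F N := by
    intro N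
    filter_upwards [hA N, eventually_ge_atTop 1] with n hn h1 f
    obtain ⟨n, rfl⟩ := Nat.exists_eq_succ_of_ne_zero (show n ≠ 0 by lia)
    exact hn (σ f)
  have hχB : ∀ N, ∀ᶠ n in atTop, ∀ f, chainOp B σ n f - (B' * σ) f ∈ (serFilt m α).F N := by
    intro N
    filter_upwards [hB N, eventually_ge_atTop 1] with n hn h1 f
    obtain ⟨n, rfl⟩ := Nat.exists_eq_succ_of_ne_zero (show n ≠ 0 by lia)
    exact hn (σ f)
  have hχc' : chargeOp ((A' * σ) 1) = 0 := by
    rw [Module.End.mul_apply, hσ.map_one_B]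
    exact chargeOp_apply_one hc'
  have hστ : ∀ n, GPair m α (chainOp A σ (n + 1) * invOp (serFilt m α) (hχ n).unipA)
      (chainOp B σ (n + 1) * invOp (serFilt m α) (hχ n).unipB) := fun n =>
    (hχ (n + 1)).mul (hχ n).inv
  let Y : ℕ → Gen m
    | 0 => GPair.one.gen hα
    | n + 1 => (hστ n).gen hα
  have hvs : ∀ n, Rel (chainOp A σ n) (chainOp B σ n) v ((hχ n).act v) := fun n =>
    (hχ n).rel_act hα hv1
  have hstep : ∀ (n : ℕ) {u w : VF m}, u ∈ stateSpace m →
      Rel (chainOp A σ n) (chainOp B σ n) u w →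
      Rel (chainOp A σ (n + 1)) (chainOp B σ (n + 1)) u (nearId (Y (n + 1)) w) := by
    intro n u w hu hr
    have h1 := hr.trans ((hστ n).rel_gen hα (hr.mem_stateSpace hα (hχ n) hu))
    rwa [mul_assoc, invOp_mul, mul_assoc, invOp_mul, mul_one, mul_one] at h1
  have hcomp : ∀ (n : ℕ) {u : VF m}, u ∈ stateSpace m →
      Rel (chainOp A σ n) (chainOp B σ n) u (composite Y n u) := by
    intro n u hu
    induction n with
    | zero => exact Rel.refl u
    | succ n ih => exact hstep n hu ih
  have hrem : ∀ r : ℕ, removable α v' r r = removable α v r r := fun r =>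
    hrel.removable_eq hα hσ hv hH r
  have hgrade : ∀ n k : ℕ, k ≤ n →
      gradePart α k ((hχ n).act v) ∈ normalSpace α ord v k k := by
    intro n k hk
    cases n with
    | zero =>
      obtain rfl : k = 0 := by lia
      have : (hχ 0).act v = v := ((Rel.refl v).eq_act (hχ 0)).symm
      rw [this]
      exact gradePart_zero_mem_normalSpace hα ord hv hH
    | succ n =>
      have h1 : (hχ (n + 1)).act v = (hG (n + 1)).act v' :=
        ((hrel.trans ((hG (n + 1)).rel_act hα (stateSpace_le_vfFilt hv'))).eq_act (hχ (n + 1))).symm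
      rw [h1, ← normalSpace_congr ord (hrem k)]
      exact hN (n + 1) k hk
  refine ⟨hχ'.act v, Y, fun n => (hχ n).act v, fun n => (hχ n).gen hα, hχ'.gen hα,
    hχ'.act_mem hα hv, fun r => ?_, fun n => ?_, ?_, fun n => (hχ n).act_mem hα hv, fun n => ?_,
    hgrade, fun n r => (hvs n).removable_eq hα (hχ n) hv hH r, fun N => ?_, fun n => ?_,
    fun n u hu => ?_, hχ'.gen_mem_genSpace hα hχc', ?_, ?_⟩
  · obtain ⟨n, h1, h2, h3⟩ :=
      ((hχA (r + 2)).and ((hχB (r + 2)).and (eventually_ge_atTop r))).exists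
    rw [← gradePart_eq_of_sub_mem ((hχ n).act_sub_act_mem hχ' h1 h2 hv1)]
    exact hgrade n r h3
  · cases n with
    | zero => exact genOne_mem hα
    | succ n => exact (hστ n).gen_mem_genSpace hα (chargeOp_chain_step hG hσ hc n)
  · exact ((Rel.refl v).eq_act (hχ 0)).symm
  · exact (hvs (n + 1)).unique (hχ (n + 1)) (hstep n hv (hvs n))
  · filter_upwards [hχA (N.toNat + 1), hχB (N.toNat + 1)] with n h1 h2
    have h3 := (hχ n).act_sub_act_mem hχ' h1 h2 hv1
    exact ⟨Submodule.sub_mem _ ((hχ n).act_mem hα hv) (hχ'.act_mem hα hv),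
      fun i e he => mem_vfFilt.1 h3 i e (by lia)⟩
  · exact (hχ n).gen_mem_genSpace hα (chargeOp_chain hσ hc n)
  · exact (hcomp n hu).unique (hχ n) ((hχ n).rel_gen hα hu)
  · exact GPair.gen_filtTendsto hα hχ hχ' hχA hχB (chargeOp_chain hσ hc) hχc'
  · exact ((hχ'.rel_gen hα hv).eq_act hχ').symm

end

end ParamNF

/-! ### The main theorem. -/

theorem mainTheorem1 (m α : ℕ) (hα : 1 ≤ α) (ord : ℕ ≃ ParamNF.BasisIndex m)
    (v : ParamNF.VF m) (hv : v ∈ ParamNF.stateSpace m)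
    (hHopf : MvPowerSeries.coeff (ParamNF.zExp m) (v 0) ≠ 0) :
    -- the spectral sequence terms and the complements
    (∀ r : ℕ,
      ParamNF.pageEInf α v r = ParamNF.pageE α v r r ∧
      (∃ h : ParamNF.stateGrade α r ≤ (ParamNF.pageE α v r r).num,
        Function.Surjective ((ParamNF.pageE α v r r).ofLE (ParamNF.stateGrade α r) h) ∧
        LinearMap.ker ((ParamNF.pageE α v r r).ofLE (ParamNF.stateGrade α r) h) =
          (ParamNF.removable α v r r).comap (ParamNF.stateGrade α r).subtype) ∧
      ParamNF.removable α v r r ≤ ParamNF.stateGrade α r ∧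
      ParamNF.normalSpace α ord v r r ⊔ ParamNF.removable α v r r = ParamNF.stateGrade α r ∧
      Disjoint (ParamNF.normalSpace α ord v r r) (ParamNF.removable α v r r) ∧
      (∃ h : ParamNF.normalSpace α ord v r r ≤ (ParamNF.pageE α v r r).num,
        Function.Bijective
          ((ParamNF.pageE α v r r).ofLE (ParamNF.normalSpace α ord v r r) h))) ∧
    ∃ vinf : ParamNF.VF m,
      -- the infinite level normal form
      vinf ∈ ParamNF.stateSpace m ∧
      (∀ r : ℕ, ParamNF.gradePart α r vinf ∈ ParamNF.normalSpace α ord v r r) ∧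
      -- the normalizing sequence
      (∃ (Y : ℕ → ParamNF.Gen m) (vs : ℕ → ParamNF.VF m)
          (Ycomp : ℕ → ParamNF.Gen m) (Yinf : ParamNF.Gen m),
        (∀ n, Y n ∈ ParamNF.genSpace α) ∧
        vs 0 = v ∧
        (∀ n, vs n ∈ ParamNF.stateSpace m) ∧
        (∀ n, vs (n + 1) = ParamNF.nearId (Y (n + 1)) (vs n)) ∧
        (∀ n k : ℕ, k ≤ n →
          ParamNF.gradePart α k (vs n) ∈ ParamNF.normalSpace α ord v k k) ∧
        (∀ n r : ℕ, ParamNF.removable α (vs n) r r = ParamNF.removable α v r r) ∧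
        ParamNF.FiltTendsto (ParamNF.stateFilt α) vs vinf ∧
        (∀ n, Ycomp n ∈ ParamNF.genSpace α) ∧
        (∀ n, ∀ u ∈ ParamNF.stateSpace m,
          ParamNF.composite Y n u = ParamNF.nearId (Ycomp n) u) ∧
        Yinf ∈ ParamNF.genSpace α ∧
        ParamNF.FiltTendsto (ParamNF.genFilt α) Ycomp Yinf ∧
        vinf = ParamNF.nearId Yinf v) ∧
      -- uniqueness
      (∀ (Y : ℕ → ParamNF.Gen m) (vs : ℕ → ParamNF.VF m) (w : ParamNF.VF m),
        (∀ n, Y n ∈ ParamNF.genSpace α) →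
        vs 0 = v →
        (∀ n, vs (n + 1) = ParamNF.nearId (Y (n + 1)) (vs n)) →
        ParamNF.FiltTendsto (ParamNF.stateFilt α) vs w →
        (∀ r : ℕ, ParamNF.gradePart α r w ∈ ParamNF.normalSpace α ord v r r) →
        w = vinf) := by
  refine ⟨fun r => ⟨ParamNF.pageEInf_eq v r, ⟨ParamNF.stateGrade_le_num v r,
    ParamNF.ofLE_stateGrade_surjective v r _, ?_⟩, ParamNF.removable_le_stateGrade v r,
    ParamNF.styleComplement_sup hα ord (ParamNF.removable_le_stateGrade v r),
    ParamNF.disjoint_styleComplement ord r _,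
    (ParamNF.normalSpace_le_stateGrade ord v r).trans (ParamNF.stateGrade_le_num v r),
    ParamNF.ofLE_normalSpace_bijective hα ord v r _⟩, ?_⟩
  · ext x
    rw [LinearMap.mem_ker, ParamNF.ofLE_eq_zero_iff v r le_rfl]
    rfl
  · obtain ⟨vinf, Y, vs, Ycomp, Yinf, h1, h2, h3, h4, h5, h6, h7, h8, h9, h10, h11, h12, h13,
      h14⟩ := ParamNF.exists_normalizing_sequence hα ord hv hHopf
    refine ⟨vinf, h1, h2, ⟨Y, vs, Ycomp, Yinf, h3, h4, h5, h6, h7, h8, h9, h10, h11, h12, h13,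
      h14⟩, fun Y' vs' w hY' h0 hs hlim hw => ?_⟩
    have hg := (ParamNF.mem_genSpace_iff.1 h12).1
    have hr := hg.rel_nearId hα hv
    have hG := hg.gPair hα
    rw [← h14] at hr
    -- Uniqueness is applied at the base field `vinf`. Each `vs' n` is equivalent to it by undoing
    -- the normalizing transformation and then applying the given maps to v.
    refine ParamNF.normal_form_unique hα ord h1 ?_ (hr.removable_eq hα hG hv hHopf) h2 hw
      (fun n => ?_) hlim
    · rw [hr.coeff_zExp hG hv]
      exact hHopf
    · obtain ⟨A, B, hAB, hrel⟩ := ParamNF.exists_rel_of_nearId hα hY' (h0 ▸ hv) hs n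
      rw [h0] at hrel
      exact ⟨_, _, hAB.mul hG.inv, (hr.symm hG).trans hrel⟩
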